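/- **Conventions.** Graphs are undirected multigraphs, possibly with self-loops; the degree $d(v)$ of a node is the number of edges incident to it (a self-loop counts once), $vol(S)=\sum_{v\in S}d(v)$, and the conductance of a graph is the minimum of $|E(S,V\setminus S)|/\min\{vol(S),vol(V\setminus S)\}$ over the nonempty proper subsets $S$ of $V$ (it is $0$ if some such $S$ has volume $0$). The walk matrix of a $\Delta$-regular graph has entries $P(u,v)=(\text{number of edges between }u\text{ and }v)/\Delta$. In every synchronous round each node sends at most one message, to a node whose identifier it knows. **Procedure ExpanderDegreeReduction** on a $\Delta$-regular graph $G=(V,E)$ with $n$ nodes, with parameters $c,\delta$ (tokens), $\ell$ (walk length), $T$ (phases), $R$ (rounds reserved for the walks of a phase). Every node generates $c$ active tokens with its identifier. In each of $T$ phases every active token makes, starting where it is, a random walk of $\ell$ steps, each step along a uniformly random edge incident to the current node. The walks are given $R$ rounds; in each round every node that holds a token that still has to walk sends one such token, one with fewest steps made in this phase (ties are broken by identifiers). Then each active token that has completed its walk becomes inactive, and stays where it is for good, if its node has at most $\delta$ tokens in total (active or not); otherwise it remains active. In the next $\delta$ rounds the nodes inform the sources of the newly inactive tokens they hold, one source per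 round and node. A node is satisfied once all its tokens are inactive and it has been informed of their holders. After the last phase, in $c$ further rounds, each satisfied node creates one edge to each node that holds at least one of its tokens. The output graph $G_\delta$ has one edge between $u$ and $v$ if $u$ created an edge to $v$ or $v$ to $u$. **Theorem.** For every $\Phi\in(0,1/10]$ there are integers $c\ge1$ and $\delta>10c$ such that for all constants $K,\alpha,\beta>0$ and $\kappa\ge1$ there are constants $a_1,a_2,a_3,C>0$ and $n_0$ with the following property. Let $G$ be a $\Delta$-regular graph on $n\ge n_0$ nodes with $\Delta\le K\log n$, with conductance at least $\alpha$, and such that all eigenvalues of its walk matrix $P$ are at least $-1+\beta$ (that is, $G$ is bounded away from bipartite; this holds with $\beta = 2\rho$ if every node has at least $\rho\Delta$ self-loops). Let $L$ be the estimate of $\log n$ known to the nodes, $\log n\le L\le\kappa\log n$, and run the procedure with $\ell=\lceil a_1L\rceil$, $T=\lceil a_2L\rceil$ and $R=\lceil a_3L^2\rceil$. Then 1. $\ell$ exceeds the mixing time of $G$: $|P^\ell(u,v)-1/n|\le 1/n^2$ for all $u,v\in V$; 2. the procedure uses at most $C\log^3n$ rounds and at most $C\,n\log^3n$ messages; 3.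 with probability at least $1-1/n$: in every phase all walks are completed within the $R$ rounds reserved for them, all nodes are satisfied at the end, every node of $G_\delta$ has degree at most $c+\delta$, and $G_\delta$ has conductance at least $\Phi$. -/

import Mathlib

open Finset

/-! ### Multigraphs, volume, cuts and conductance -/

/-- An undirected multigraph, possibly with self-loops, on the node set `V`: `mult u v` is the
number of edges between `u` and `v` (and `mult v v` the number of self-loops at `v`). -/
structure Multigraph (V : Type*) where
  mult : V → V → ℕ
  symm : ∀ u v, mult u v = mult v u

namespace Multigraph

variable {V : Type*} [Fintype V] [DecidableEq V]

/-- The degree of `v`: the number of edges incident to `v`, where a self-loop counts once. -/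
def degree (H : Multigraph V) (v : V) : ℕ := ∑ u, H.mult v u

/-- `vol(S)`, the sum of the degrees of the nodes of `S`. -/
def vol (H : Multigraph V) (S : Finset V) : ℕ := ∑ v ∈ S, H.degree v

/-- `|E(S, V ∖ S)|`, the number of edges leaving `S`. -/
def cut (H : Multigraph V) (S : Finset V) : ℕ := ∑ u ∈ S, ∑ v ∈ Sᶜ, H.mult u v

/-- The conductance of the multigraph: the minimum, over the nonempty proper subsets `S` of `V`, of
`|E(S, V ∖ S)| / min (vol S) (vol (V ∖ S))`. It is `0` if some such `S` has volume `0`. -/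
noncomputable def conductance (H : Multigraph V) : ℝ :=
  ⨅ S : {S : Finset V // S.Nonempty ∧ S ≠ Finset.univ},
    (H.cut S.1 : ℝ) / ((min (H.vol S.1) (H.vol S.1ᶜ) : ℕ) : ℝ)

end Multigraph

/-- A `Δ`-regular undirected multigraph, possibly with self-loops, given by its incidence lists:
`nbr v 0, …, nbr v (Δ - 1)` are the other endpoints of the `Δ` edges incident to `v` (a self-loop
occupies one entry of the list). -/
structure RegularMultigraph (V : Type*) [Fintype V] [DecidableEq V] (Δ : ℕ) where
  nbr : V → Fin Δ → V
  symm : ∀ u v, (univ.filter fun i => nbr u i = v).card = (univ.filter fun i => nbr v i = u).card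

namespace RegularMultigraph

variable {V : Type*} [Fintype V] [DecidableEq V] {Δ : ℕ}

/-- The underlying multigraph. -/
def toMultigraph (G : RegularMultigraph V Δ) : Multigraph V where
  mult u v := (univ.filter fun i => G.nbr u i = v).card
  symm := G.symm

/-- The transition matrix of the random walk that follows a uniformly random incident edge. -/
noncomputable def walkMatrix (G : RegularMultigraph V Δ) : Matrix V V ℝ :=
  Matrix.of fun u v => (G.toMultigraph.mult u v : ℝ) / (Δ : ℝ)

/-- After `t` steps, wherever it started, the random walk is at any given node with probability
`1 / n ± 1 / n ^ 2`. -/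
def MixedAfter (G : RegularMultigraph V Δ) (t : ℕ) : Prop :=
  ∀ u v, |(G.walkMatrix ^ t) u v - 1 / (Fintype.card V : ℝ)| ≤ 1 / (Fintype.card V : ℝ) ^ 2

end RegularMultigraph

/-! ### The procedure, round by round -/

namespace DegreeReduction

/-- The parameters of the procedure. -/
structure Params where
  /-- number of tokens generated by each node -/
  c : ℕ
  /-- a node accepts tokens as long as it has at most `δ` of them -/
  δ : ℕ
  /-- length of the random walk of an active token in one phase -/
  len : ℕ
  /-- number of phases -/
  phases : ℕ
  /-- number of rounds that a phase reserves for the random walks -/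
  walkRounds : ℕ

/-- The tokens: `(v, j)` is the `j`-th token generated by the node `v`. -/
abbrev Token (V : Type*) (p : Params) := V × Fin p.c

/-- The random choices: in phase `i`, the token `t` makes its `j`-th step along the incident edge
number `ω i t j` of the node that it then occupies. The choices are independent and uniform. -/
abbrev Choices (V : Type*) (p : Params) (Δ : ℕ) := Fin p.phases → Token V p → Fin p.len → Fin Δ

/-- A snapshot of the network. -/
structure State (V : Type*) (p : Params) where
  /-- the node at which a token is -/
  pos : Token V p → V
  /-- the number of steps that a token has made in the current phase -/
  hops : Token V p → ℕ
  /-- whether a token is active -/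
  active : Token V p → Bool
  /-- what the source of a token knows about the node that holds it after it became inactive -/
  holder : Token V p → Option V
  /-- the edges created so far: `(u, v)` is an edge created by `u` to `v` -/
  links : Finset (V × V)
  /-- the number of rounds so far -/
  rounds : ℕ
  /-- the number of messages sent so far -/
  messages : ℕ

section

variable {V : Type*} [Fintype V] [LinearOrder V] {p : Params} {Δ : ℕ}

/-- Initially, every node has its `c` tokens, all of them active. -/
def initial : State V p where
  pos t := t.1
  hops _ := 0
  active _ := true
  holder _ := none
  links := ∅
  rounds := 0
  messages := 0

/-- In one round a node can send only one message. If `A` is the set of tokens about which some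
message is waiting to be sent, and `loc t` is the node that has to send the message about `t`, then
the messages sent in this round are those about `serve loc prio A`: each node serves its waiting
token of smallest `prio`, ties being broken by the order of the identifiers. -/
def serve (loc : Token V p → V) (prio : Token V p → ℕ) (A : Finset (Token V p)) :
    Finset (Token V p) :=
  A.filter fun t => ∀ t' ∈ A, loc t' = loc t →
    (toLex (prio t, toLex t) : ℕ ×ₗ (V ×ₗ Fin p.c)) ≤ toLex (prio t', toLex t')

/-- No node sends two messages in one round. -/
theorem serve_injOn (loc : Token V p → V) (prio : Token V p → ℕ) (A : Finset (Token V p)) :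
    Set.InjOn loc (serve loc prio A : Set (Token V p)) := by
  intro t ht t' ht' h
  simp only [serve, coe_filter, Set.mem_ofPred_eq] at ht ht'
  have h1 := le_antisymm (ht.2 t' ht'.1 h.symm) (ht'.2 t ht.1 h)
  exact toLex_inj.mp (Prod.ext_iff.mp (toLex_inj.mp h1)).2

/-- The tokens that still have to walk in the current phase. -/
def walking (x : State V p) : Finset (Token V p) :=
  univ.filter fun t => x.active t = true ∧ x.hops t < p.len

/-- One round of the random walks: every node at which some token still has to walk sends one such
token, with fewest steps made so far, along a random incident edge. -/
def walkRound (G : RegularMultigraph V Δ) (ρ : Token V p → Fin p.len → Fin Δ) (x : State V p) :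
    State V p :=
  let sent := serve x.pos x.hops (walking x)
  { x with
    pos := fun t =>
      if h : x.hops t < p.len then
        if t ∈ sent then G.nbr (x.pos t) (ρ t ⟨x.hops t, h⟩) else x.pos t
      else x.pos t
    hops := fun t => if t ∈ sent then x.hops t + 1 else x.hops t
    rounds := x.rounds + 1
    messages := x.messages + sent.card }

/-- The number of tokens at a node, active or not. -/
def load (x : State V p) (v : V) : ℕ := (univ.filter fun t => x.pos t = v).card

/-- The local decision at the end of the walks: an active token that has completed its walk becomes
inactive if the node where it is has at most `δ` tokens in total; otherwise it remains active. -/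
def settle (x : State V p) : State V p :=
  { x with
    active := fun t =>
      x.active t && !(decide (x.hops t = p.len) && decide (load x (x.pos t) ≤ p.δ)) }

/-- One round of notifications: every node that holds an inactive token whose source has not been
informed yet contacts the source of one such token. -/
def informRound (x : State V p) : State V p :=
  let sent := serve x.pos (fun _ => 0)
    (univ.filter fun t => x.active t = false ∧ x.holder t = none)
  { x with
    holder := fun t => if t ∈ sent then some (x.pos t) else x.holder t
    rounds := x.rounds + 1
    messages := x.messages + sent.card }

/-- At the start of a phase the step counters are reset. -/
def startPhase (x : State V p) : State V p := { x with hops := fun _ => 0 }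

/-- The walks of one phase. -/
def walkPart (G : RegularMultigraph V Δ) (ρ : Token V p → Fin p.len → Fin Δ) (x : State V p) :
    State V p :=
  (walkRound G ρ)^[p.walkRounds] (startPhase x)

/-- One phase: the random walks, the decisions, and `δ` rounds of notifications. -/
def runPhase (G : RegularMultigraph V Δ) (ρ : Token V p → Fin p.len → Fin Δ) (x : State V p) :
    State V p :=
  informRound^[p.δ] (settle (walkPart G ρ x))

/-- The state after the first `k` phases. -/
def afterPhases (G : RegularMultigraph V Δ) (ω : Choices V p Δ) : ℕ → State V p
  | 0 => initial
  | k + 1 =>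
      if h : k < p.phases then runPhase G (ω ⟨k, h⟩) (afterPhases G ω k)
      else afterPhases G ω k

/-- A node is satisfied once it knows the holders of all its tokens, all being inactive. -/
def Satisfied (x : State V p) (v : V) : Prop :=
  ∀ j : Fin p.c, x.active (v, j) = false ∧ (x.holder (v, j)).isSome = true

instance (x : State V p) (v : V) : Decidable (Satisfied x v) := by
  unfold Satisfied; infer_instance

/-- One round of edge creation: every satisfied node that has not yet created an edge to each holder
of its tokens contacts one such holder and creates an edge to it. -/
def linkRound (x : State V p) : State V p :=
  let sent := serve Prod.fst (fun _ => 0)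
    (univ.filter fun t => Satisfied x t.1 ∧ ∃ v, x.holder t = some v ∧ (t.1, v) ∉ x.links)
  { x with
    links := x.links ∪
      univ.filter fun e => ∃ t ∈ sent, t.1 = e.1 ∧ x.holder t = some e.2
    rounds := x.rounds + 1
    messages := x.messages + sent.card }

/-- The final state of the procedure: after all phases, `c` rounds of edge creation. -/
def finalState (G : RegularMultigraph V Δ) (ω : Choices V p Δ) : State V p :=
  linkRound^[p.c] (afterPhases G ω p.phases)

/-- The graph formed by the created edges: `u` and `v` are joined by one edge if one of them created
an edge to the other. -/
def output (G : RegularMultigraph V Δ) (ω : Choices V p Δ) : Multigraph V where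
  mult u v := if (u, v) ∈ (finalState G ω).links ∨ (v, u) ∈ (finalState G ω).links then 1 else 0
  symm u v := by simp only [or_comm]

/-- In every phase, all active tokens complete their walks within the rounds reserved for them. -/
def WalksComplete (G : RegularMultigraph V Δ) (ω : Choices V p Δ) : Prop :=
  ∀ i : Fin p.phases, walking (walkPart G (ω i) (afterPhases G ω i)) = ∅

/-- The probability of an event, the random choices being independent and uniform. -/
noncomputable def prob (E : Set (Choices V p Δ)) : ℝ :=
  (ProbabilityTheory.uniformOn (Set.univ : Set (Choices V p Δ))).real E

end

end DegreeReduction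

/-!
Given the past, the walks of one phase are independent and their ends are almost uniformly
distributed; everything follows from this.

*Mixing.* Cheeger's inequality (`cheeger`), together with the assumed lower bound on the spectrum,
bounds all eigenvalues of the walk matrix on the complement of the constants away from `1` and `-1`.
The spectral theorem then gives exponentially fast mixing
(`RegularMultigraph.abs_walkMatrix_pow_sub_le`).

*Scheduling.* The procedure is compared with an idealised one (`config`) in which all walks of a
phase are completed. If at most `M` walks are at the same node after the same number of steps, then
all walks of length `l` are completed within `M * l` rounds, because tokens with fewest steps have
priority (`le_hops_iterate`); so the two procedures agree (`agrees_afterPhases`). The expected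
number of walks at a node after `j` steps is at most the maximal number of active tokens that a node
had at the start of the phase, as the walk matrix is doubly stochastic, and at the end of a phase it
is bounded by a constant because of mixing. Chernoff bounds make both `O(log n)`, in all phases simultaneously.

*Termination.* Few nodes can hold `δ` tokens, so a token is rejected in a phase with a small
probability, whatever the other tokens do, and it survives logarithmically many phases with
polynomially small probability (`unifProb_act_le`). Moreover, the number of active tokens decreases
by a constant factor in each phase as long as it is at least logarithmic
(`unifProb_numActive_le`): when the walks of a phase are revealed one after the other, at least half
of the tokens rejected at a node arrive when the node holds `δ / 2` tokens already.

*Expansion.* Consider a set `S` of `s ≤ n / 2` nodes, and call the walk of a token generated in `S`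
wasted if it ends in `S`, or where another token of the same source is. Tokens of `S` that become
inactive without a wasted walk give distinct edges leaving `S`, whereas the others account for all
edges within `S` (`cut_output`). With `c = 400`, fewer than `300 s` wasted walks and at most `8 s`
tokens of `S` that are still active leave enough edges for a conductance of `1 / 10`. Only the walks
of the first `k` phases are counted, where `k` is about `(n / s) ^ (1 / 3)`: this is large enough for
at most `8 s` tokens to be active afterwards, and small enough for the probability of `300 s` wasted
walks to be smaller than the inverse of the number of sets of size `s` (`eventually_sizeBound`). For
sets of linear size `k = 1`; there a walk is wasted with probability at most about one half.

All probabilistic estimates rest on `expect_prod_le`, which integrates out the independent choices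
one after the other.
-/

/-! ### Cheeger's inequality and mixing -/

/-- The entries of the powers of a symmetric matrix decay like the powers of any bound on its
eigenvalues. -/
theorem Matrix.IsHermitian.abs_pow_apply_le {V : Type*} [Fintype V] [DecidableEq V]
    {A : Matrix V V ℝ} (hA : A.IsHermitian) {lam : ℝ} (h : ∀ i, |hA.eigenvalues i| ≤ lam)
    (t : ℕ) (u v : V) : |(A ^ t) u v| ≤ lam ^ t := by
  set U : Matrix V V ℝ := (hA.eigenvectorUnitary : Matrix V V ℝ) with hU
  have hUU : U * star U = 1 := Unitary.mul_star_self_of_mem hA.eigenvectorUnitary.2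
  have hAt : A ^ t = U * Matrix.diagonal (fun i => hA.eigenvalues i ^ t) * star U := by
    conv_lhs => rw [hA.spectral_theorem]
    rw [← map_pow, Unitary.conjStarAlgAut_apply, Matrix.diagonal_pow]
    rfl
  have hrow : ∀ u, ∑ i, U u i ^ 2 = 1 := by
    intro u
    have := congrFun (congrFun hUU u) u
    simp only [Matrix.mul_apply, Matrix.star_apply, star_trivial, Matrix.one_apply_eq] at this
    simpa [sq] using this
  have hlam : 0 ≤ lam := (abs_nonneg _).trans (h u)
  have hent : (A ^ t) u v = ∑ i, hA.eigenvalues i ^ t * (U u i * U v i) := by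
    rw [hAt, Matrix.mul_apply]
    refine Finset.sum_congr rfl fun i _ => ?_
    rw [Matrix.mul_diagonal]
    simp only [Matrix.star_apply, star_trivial]
    ring
  calc |(A ^ t) u v| ≤ ∑ i, |hA.eigenvalues i ^ t * (U u i * U v i)| := by
        rw [hent]; exact Finset.abs_sum_le_sum_abs _ _
    _ ≤ ∑ i, lam ^ t * ((U u i ^ 2 + U v i ^ 2) / 2) := by
        refine Finset.sum_le_sum fun i _ => ?_
        rw [abs_mul, abs_pow]
        gcongr
        · exact h i
        · rw [abs_mul]
          nlinarith [sq_nonneg (|U u i| - |U v i|), sq_abs (U u i), sq_abs (U v i)]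
    _ = lam ^ t := by
        rw [← Finset.mul_sum, ← Finset.sum_div, Finset.sum_add_distrib, hrow, hrow]; norm_num

section Cheeger

variable {V : Type*} [Fintype V] [DecidableEq V]

/-- The coarea inequality: if all sets of at most half of the nodes have an edge boundary that is
large compared with their size, then every nonnegative function that is supported on at most half
of the nodes has large total variation along the edges. -/
theorem coarea_le {w : V → V → ℝ} (hsymm : ∀ u v, w u v = w v u) {b : ℝ}
    (hb : ∀ A : Finset V, A.Nonempty → 2 * A.card ≤ Fintype.card V →
      b * A.card ≤ ∑ u ∈ A, ∑ v ∈ Aᶜ, w u v) (k : ℕ) :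
    ∀ f : V → ℝ, (∀ v, 0 ≤ f v) → (univ.filter fun v => f v ≠ 0).card = k →
      2 * k ≤ Fintype.card V → 2 * b * ∑ v, f v ≤ ∑ u, ∑ v, w u v * |f u - f v| := by
  induction k using Nat.strong_induction_on with
  | _ k ih =>
  intro f hf hk hkn
  set A := univ.filter fun v => f v ≠ 0 with hA
  rcases A.eq_empty_or_nonempty with hAe | hAn
  · have h0 : ∀ v, f v = 0 := by
      intro v
      by_contra hv
      have : v ∈ A := by simp [hA, hv]
      simp [hAe] at this
    simp [h0]
  -- Subtract from `f` its least nonzero value on the whole of its support.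
  obtain ⟨v₀, hv₀, hmin⟩ := A.exists_min_image f hAn
  set a := f v₀ with ha
  have ha0 : 0 < a := lt_of_le_of_ne (hf v₀) (Ne.symm (by simpa [hA] using hv₀))
  set χ : V → ℝ := fun v => if v ∈ A then 1 else 0 with hχ
  set g : V → ℝ := fun v => f v - a * χ v with hg
  have hout : ∀ v, v ∉ A → f v = 0 := by
    intro v hv
    by_contra h
    exact hv (by simp [hA, h])
  have hg0 : ∀ v, 0 ≤ g v := by
    intro v
    by_cases hv : v ∈ A
    · have := hmin v hv
      simp only [hg, hχ, hv, if_true]; linarith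
    · simp [hg, hχ, hv, hf v]
  have hsub : (univ.filter fun v => g v ≠ 0) ⊂ A := by
    refine Finset.ssubset_iff_of_subset ?_ |>.2 ⟨v₀, hv₀, ?_⟩
    · intro v hv
      by_contra hvA
      simp only [mem_filter, mem_univ, true_and, hg, hχ, hvA, if_false, hout v hvA] at hv
      simp at hv
    · simp [hg, hχ, hv₀, ← ha]
  have hlt := Finset.card_lt_card hsub
  have ihg := ih _ (by omega) g hg0 rfl (by omega)
  have hpt : ∀ u v, |f u - f v| = |g u - g v| + a * (χ u * (1 - χ v) + χ v * (1 - χ u)) := by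
    intro u v
    by_cases hu : u ∈ A <;> by_cases hv : v ∈ A
    · simp [hg, hχ, hu, hv]
    · have h1 := hmin u hu
      simp only [hg, hχ, hu, hv, if_true, if_false, hout v hv]
      rw [abs_of_nonneg (by linarith [hf u]), abs_of_nonneg (by linarith)]; ring
    · have h1 := hmin v hv
      simp only [hg, hχ, hu, hv, if_true, if_false, hout u hu]
      rw [abs_of_nonpos (by linarith [hf v]), abs_of_nonpos (by linarith)]; ring
    · simp [hg, hχ, hu, hv]
  have hcut : ∑ u, ∑ v, w u v * (χ u * (1 - χ v)) = ∑ u ∈ A, ∑ v ∈ Aᶜ, w u v := by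
    rw [← Finset.sum_subset (Finset.subset_univ A)]
    · refine Finset.sum_congr rfl fun u hu => ?_
      rw [← Finset.sum_subset (Finset.subset_univ Aᶜ)]
      · refine Finset.sum_congr rfl fun v hv => ?_
        simp [hχ, hu, Finset.mem_compl.1 hv]
      · intro v _ hv
        simp [hχ, Finset.notMem_compl.1 hv]
    · intro u _ hu
      simp [hχ, hu]
  have hcut' : ∑ u, ∑ v, w u v * (χ v * (1 - χ u)) = ∑ u ∈ A, ∑ v ∈ Aᶜ, w u v := by
    rw [Finset.sum_comm, ← hcut]
    simp only [hsymm]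
  have hsum : ∑ u, ∑ v, w u v * |f u - f v|
      = ∑ u, ∑ v, w u v * |g u - g v| + 2 * a * ∑ u ∈ A, ∑ v ∈ Aᶜ, w u v := by
    have : 2 * a * ∑ u ∈ A, ∑ v ∈ Aᶜ, w u v = a * (∑ u, ∑ v, w u v * (χ u * (1 - χ v)))
        + a * (∑ u, ∑ v, w u v * (χ v * (1 - χ u))) := by rw [hcut, hcut']; ring
    rw [this]
    simp only [Finset.mul_sum, ← Finset.sum_add_distrib]
    refine Finset.sum_congr rfl fun u _ => Finset.sum_congr rfl fun v _ => ?_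
    rw [hpt]; ring
  have hfs : ∑ v, f v = ∑ v, g v + a * A.card := by
    have : ∑ v, χ v = A.card := by simp [hχ]
    rw [← this, Finset.mul_sum, ← Finset.sum_add_distrib]
    simp [hg]
  have := hb A hAn (by omega)
  rw [hsum, hfs]
  nlinarith

/-- The hard half of Cheeger's inequality: an eigenvector that is positive on at least one and on at
most half of the nodes has an eigenvalue bounded away from `1`. -/
theorem cheeger_of_pos_part {w : V → V → ℝ} (hw : ∀ u v, 0 ≤ w u v)
    (hsymm : ∀ u v, w u v = w v u) {d a : ℝ} (hd : 0 < d) (ha : 0 ≤ a)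
    (hdeg : ∀ u, ∑ v, w u v = d)
    (hb : ∀ A : Finset V, A.Nonempty → 2 * A.card ≤ Fintype.card V →
      a * d * A.card ≤ ∑ u ∈ A, ∑ v ∈ Aᶜ, w u v)
    {x : V → ℝ} {μ : ℝ} (hx : ∀ u, ∑ v, w u v * x v = μ * d * x u)
    (hpos : ∃ u, 0 < x u) (hhalf : 2 * (univ.filter fun v => 0 < x v).card ≤ Fintype.card V) :
    μ ≤ 1 - a ^ 2 / 2 := by
  set y : V → ℝ := fun v => max (x v) 0 with hy
  have hy0 : ∀ v, 0 ≤ y v := fun v => le_max_right _ _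
  set N := ∑ v, y v ^ 2 with hN
  have hNpos : 0 < N := by
    obtain ⟨u, hu⟩ := hpos
    have h1 : y u ^ 2 ≤ N := Finset.single_le_sum (f := fun v => y v ^ 2)
      (fun v _ => sq_nonneg _) (mem_univ u)
    have h2 : y u = x u := max_eq_left hu.le
    have : 0 < x u ^ 2 := by positivity
    rw [h2] at h1; linarith
  -- On the positive part, `P y ≥ P x = μ x`.
  have hquad : μ * d * N ≤ ∑ u, ∑ v, w u v * (y u * y v) := by
    rw [hN, Finset.mul_sum]
    refine Finset.sum_le_sum fun u _ => ?_
    rcases le_or_gt (x u) 0 with h | h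
    · have : y u = 0 := max_eq_right h
      simp [this]
    · have hyu : y u = x u := max_eq_left h.le
      have : μ * d * y u ≤ ∑ v, w u v * y v := by
        rw [hyu, ← hx]
        exact Finset.sum_le_sum fun v _ => mul_le_mul_of_nonneg_left (le_max_left _ _) (hw u v)
      calc μ * d * y u ^ 2 = y u * (μ * d * y u) := by ring
        _ ≤ y u * ∑ v, w u v * y v := mul_le_mul_of_nonneg_left this (hy0 u)
        _ = _ := by rw [Finset.mul_sum]; exact Finset.sum_congr rfl fun v _ => by ring
  have hs1 : ∑ u, ∑ v, w u v * y u ^ 2 = d * N := by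
    simp only [← Finset.sum_mul, hdeg, hN, Finset.mul_sum]
  have hs2 : ∑ u, ∑ v, w u v * y v ^ 2 = d * N := by
    rw [Finset.sum_comm, ← hs1]; simp only [hsymm]
  set E := ∑ u, ∑ v, w u v * (y u - y v) ^ 2 with hE
  set F := ∑ u, ∑ v, w u v * (y u + y v) ^ 2 with hF
  have hEle : E ≤ 2 * (1 - μ) * d * N := by
    have : E = d * N + d * N - 2 * ∑ u, ∑ v, w u v * (y u * y v) := by
      nth_rewrite 1 [← hs1]
      rw [← hs2, hE]
      simp only [Finset.mul_sum, ← Finset.sum_add_distrib, ← Finset.sum_sub_distrib]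
      exact Finset.sum_congr rfl fun u _ => Finset.sum_congr rfl fun v _ => by ring
    rw [this]; nlinarith
  have hFle : F ≤ 4 * d * N := by
    have : F ≤ 2 * (d * N) + 2 * (d * N) := by
      nth_rewrite 1 [← hs1]
      rw [← hs2, hF]
      simp only [Finset.mul_sum, ← Finset.sum_add_distrib]
      refine Finset.sum_le_sum fun u _ => Finset.sum_le_sum fun v _ => ?_
      have := mul_nonneg (hw u v) (sq_nonneg (y u - y v))
      nlinarith
    linarith
  have hE0 : 0 ≤ E := Finset.sum_nonneg fun u _ => Finset.sum_nonneg fun v _ =>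
    mul_nonneg (hw u v) (sq_nonneg _)
  have hco : 2 * (a * d) * N ≤ ∑ u, ∑ v, w u v * |y u ^ 2 - y v ^ 2| := by
    refine coarea_le hsymm hb _ (fun v => y v ^ 2) (fun v => sq_nonneg _) rfl ?_
    have : (univ.filter fun v => y v ^ 2 ≠ 0) = univ.filter fun v => 0 < x v := by
      ext v
      simp only [mem_filter, mem_univ, true_and, hy]
      constructor
      · intro h
        by_contra h'
        exact h (by simp [max_eq_right (not_lt.1 h')])
      · intro h
        rw [max_eq_left h.le]; positivity
    rw [this]; exact hhalf
  have hCS : (∑ u, ∑ v, w u v * |y u ^ 2 - y v ^ 2|) ^ 2 ≤ E * F := by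
    have := Finset.sum_mul_sq_le_sq_mul_sq (univ : Finset (V × V))
      (fun e => Real.sqrt (w e.1 e.2) * |y e.1 - y e.2|)
      (fun e => Real.sqrt (w e.1 e.2) * |y e.1 + y e.2|)
    have e1 : ∑ u, ∑ v, w u v * |y u ^ 2 - y v ^ 2| = ∑ e : V × V,
        (Real.sqrt (w e.1 e.2) * |y e.1 - y e.2|) * (Real.sqrt (w e.1 e.2) * |y e.1 + y e.2|) := by
      rw [← Finset.sum_product', Finset.univ_product_univ]
      refine Finset.sum_congr rfl fun e _ => ?_
      have h1 := Real.mul_self_sqrt (hw e.1 e.2)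
      have h2 : |y e.1 ^ 2 - y e.2 ^ 2| = |y e.1 - y e.2| * |y e.1 + y e.2| := by
        rw [← abs_mul]; congr 1; ring
      rw [h2]
      calc _ = (Real.sqrt (w e.1 e.2) * Real.sqrt (w e.1 e.2)) *
            (|y e.1 - y e.2| * |y e.1 + y e.2|) := by rw [h1]
        _ = _ := by ring
    have e2 : E = ∑ e : V × V, (Real.sqrt (w e.1 e.2) * |y e.1 - y e.2|) ^ 2 := by
      rw [hE, ← Finset.sum_product', Finset.univ_product_univ]
      refine Finset.sum_congr rfl fun e _ => ?_
      rw [mul_pow, Real.sq_sqrt (hw _ _), sq_abs]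
    have e3 : F = ∑ e : V × V, (Real.sqrt (w e.1 e.2) * |y e.1 + y e.2|) ^ 2 := by
      rw [hF, ← Finset.sum_product', Finset.univ_product_univ]
      refine Finset.sum_congr rfl fun e _ => ?_
      rw [mul_pow, Real.sq_sqrt (hw _ _), sq_abs]
    rw [e1, e2, e3]; exact this
  have h1 : (2 * (a * d) * N) ^ 2 ≤ E * F :=
    (pow_le_pow_left₀ (by positivity) hco 2).trans hCS
  have h2 : E * F ≤ (2 * (1 - μ) * d * N) * (4 * d * N) :=
    mul_le_mul hEle hFle (Finset.sum_nonneg fun u _ => Finset.sum_nonneg fun v _ =>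
      mul_nonneg (hw u v) (sq_nonneg _)) (hE0.trans hEle)
  have h3 : (4 * d ^ 2 * N ^ 2) * a ^ 2 ≤ (4 * d ^ 2 * N ^ 2) * (2 * (1 - μ)) := by nlinarith
  have := le_of_mul_le_mul_left h3 (by positivity)
  linarith

/-- The hard half of Cheeger's inequality, for an eigenvector orthogonal to the constants. -/
theorem cheeger {w : V → V → ℝ} (hw : ∀ u v, 0 ≤ w u v)
    (hsymm : ∀ u v, w u v = w v u) {d a : ℝ} (hd : 0 < d) (ha : 0 ≤ a)
    (hdeg : ∀ u, ∑ v, w u v = d)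
    (hb : ∀ A : Finset V, A.Nonempty → 2 * A.card ≤ Fintype.card V →
      a * d * A.card ≤ ∑ u ∈ A, ∑ v ∈ Aᶜ, w u v)
    {x : V → ℝ} {μ : ℝ} (hx : ∀ u, ∑ v, w u v * x v = μ * d * x u)
    (hx0 : x ≠ 0) (hsum : ∑ v, x v = 0) : μ ≤ 1 - a ^ 2 / 2 := by
  have hne : ∃ u, x u ≠ 0 := Function.ne_iff.1 hx0
  have hp : ∃ u, 0 < x u := by
    obtain ⟨u, _, hu⟩ := Finset.exists_pos_of_sum_zero_of_exists_nonzero x hsum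
      (by simpa using hne)
    exact ⟨u, hu⟩
  have hn : ∃ u, 0 < -x u := by
    obtain ⟨u, _, hu⟩ := Finset.exists_pos_of_sum_zero_of_exists_nonzero (s := univ)
      (fun v => -x v) (by simpa using hsum) (by simpa using hne)
    exact ⟨u, hu⟩
  by_cases hhalf : 2 * (univ.filter fun v => 0 < x v).card ≤ Fintype.card V
  · exact cheeger_of_pos_part hw hsymm hd ha hdeg hb hx hp hhalf
  · refine cheeger_of_pos_part hw hsymm hd ha hdeg hb (x := fun v => -x v) (fun u => ?_) hn ?_
    · simp only [mul_neg, Finset.sum_neg_distrib, hx]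
    · have hdisj : Disjoint (univ.filter fun v => 0 < x v) (univ.filter fun v => 0 < -x v) := by
        rw [Finset.disjoint_filter]; intro v _ h1 h2; linarith
      have := Finset.card_le_univ ((univ.filter fun v => 0 < x v) ∪ univ.filter fun v => 0 < -x v)
      rw [Finset.card_union_of_disjoint hdisj] at this
      omega

end Cheeger

namespace Multigraph

variable {V : Type*} [Fintype V] [DecidableEq V]

theorem conductance_le (H : Multigraph V) {S : Finset V} (h1 : S.Nonempty) (h2 : S ≠ univ) :
    H.conductance ≤ (H.cut S : ℝ) / ((min (H.vol S) (H.vol Sᶜ) : ℕ) : ℝ) :=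
  ciInf_le (f := fun S : {S : Finset V // S.Nonempty ∧ S ≠ univ} =>
    (H.cut S.1 : ℝ) / ((min (H.vol S.1) (H.vol S.1ᶜ) : ℕ) : ℝ)) (Set.finite_range _).bddBelow
    ⟨S, h1, h2⟩

end Multigraph

namespace RegularMultigraph

variable {V : Type*} [Fintype V] [DecidableEq V] {Δ : ℕ} (G : RegularMultigraph V Δ)

theorem degree_eq (v : V) : G.toMultigraph.degree v = Δ := by
  simp only [Multigraph.degree, toMultigraph]
  rw [← Finset.card_eq_sum_card_fiberwise (t := univ) (f := G.nbr v) (s := univ)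
    (fun _ _ => by simp)]
  simp

theorem vol_eq (S : Finset V) : G.toMultigraph.vol S = S.card * Δ := by
  simp [Multigraph.vol, degree_eq]

theorem sum_mult (u : V) : ∑ v, (G.toMultigraph.mult u v : ℝ) = Δ := by
  rw [← Nat.cast_sum]
  exact congrArg _ (G.degree_eq u)

variable {G}

theorem degree_pos {α : ℝ} (hα : 0 < α) (h : α ≤ G.toMultigraph.conductance)
    (hn : 2 ≤ Fintype.card V) : 0 < Δ := by
  rcases Nat.eq_zero_or_pos Δ with h0 | h0
  swap
  · exact h0
  obtain ⟨v⟩ : Nonempty V := Fintype.card_pos_iff.1 (by omega)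
  have := G.toMultigraph.conductance_le (Finset.singleton_nonempty v) (fun h' => by
    have := congrArg Finset.card h'
    simp at this; omega)
  rw [vol_eq, vol_eq] at this
  simp only [h0, mul_zero, min_self, Nat.cast_zero, div_zero] at this
  linarith

theorem mul_card_le_cut {α : ℝ} (h : α ≤ G.toMultigraph.conductance) (hΔ : 0 < Δ) {A : Finset V}
    (hA : A.Nonempty) (h2 : 2 * A.card ≤ Fintype.card V) :
    α * Δ * A.card ≤ ∑ u ∈ A, ∑ v ∈ Aᶜ, (G.toMultigraph.mult u v : ℝ) := by
  have hA0 := hA.card_pos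
  have hc : Aᶜ.card = Fintype.card V - A.card := Finset.card_compl A
  have := h.trans (G.toMultigraph.conductance_le hA (fun h' => by
    have := congrArg Finset.card h'
    rw [Finset.card_univ] at this; omega))
  rw [vol_eq, vol_eq, min_eq_left (Nat.mul_le_mul_right _ (by omega)), le_div_iff₀ (by positivity)]
    at this
  calc α * Δ * A.card = α * ((A.card * Δ : ℕ) : ℝ) := by push_cast; ring
    _ ≤ _ := this
    _ = _ := by simp [Multigraph.cut]

theorem walkMatrix_symm (u v : V) : G.walkMatrix u v = G.walkMatrix v u := by
  simp [walkMatrix, G.toMultigraph.symm u v]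

theorem walkMatrix_nonneg (u v : V) : 0 ≤ G.walkMatrix u v := by
  simp only [walkMatrix, Matrix.of_apply]; positivity

theorem sum_walkMatrix (hΔ : 0 < Δ) (u : V) : ∑ v, G.walkMatrix u v = 1 := by
  simp only [walkMatrix, Matrix.of_apply, ← Finset.sum_div, sum_mult]
  field_simp

/-- Spectral gap and bounded bipartiteness together make the walk mix exponentially fast: away from
the constant functions, all eigenvalues of the walk matrix are at most `1 - α ^ 2 / 2` by Cheeger's
inequality and at least `-1 + β` by assumption. -/
theorem abs_walkMatrix_pow_sub_le {α β lam : ℝ} (hα : 0 < α)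
    (h : α ≤ G.toMultigraph.conductance) (hn : 2 ≤ Fintype.card V)
    (hβ : ∀ μ : ℝ, Module.End.HasEigenvalue (Matrix.toLin' G.walkMatrix) μ → -1 + β ≤ μ)
    (h0 : 0 ≤ lam) (h1 : 1 - α ^ 2 / 2 ≤ lam) (h2 : 1 - β ≤ lam) {t : ℕ} (ht : t ≠ 0) (u v : V) :
    |(G.walkMatrix ^ t) u v - 1 / (Fintype.card V : ℝ)| ≤ lam ^ t := by
  have hΔ := degree_pos hα h hn
  have hn0 : (Fintype.card V : ℝ) ≠ 0 := by positivity
  set P := G.walkMatrix with hP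
  set J : Matrix V V ℝ := Matrix.of fun _ _ => 1 / (Fintype.card V : ℝ) with hJ
  have hPJ : P * J = J := by
    ext a b
    simp only [Matrix.mul_apply, hJ, Matrix.of_apply, ← Finset.sum_mul]
    rw [sum_walkMatrix hΔ, one_mul]
  have hJP : J * P = J := by
    ext a b
    simp only [Matrix.mul_apply, hJ, Matrix.of_apply, ← Finset.mul_sum]
    rw [Finset.sum_congr rfl (fun x _ => walkMatrix_symm x b), sum_walkMatrix hΔ, mul_one]
  have hJJ : J * J = J := by
    ext a b
    simp only [Matrix.mul_apply, hJ, Matrix.of_apply, Finset.sum_const, Finset.card_univ,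
      nsmul_eq_mul]
    field_simp
  have hpow : ∀ s : ℕ, s ≠ 0 → (P - J) ^ s = P ^ s - J := by
    intro s hs
    induction s with
    | zero => exact absurd rfl hs
    | succ s ih =>
      rcases Nat.eq_zero_or_pos s with rfl | hs0
      · simp
      · have hPs : ∀ s : ℕ, P ^ s * J = J := by
          intro s
          induction s with
          | zero => simp
          | succ s ih => rw [pow_succ, mul_assoc, hPJ, ih]
        rw [pow_succ, ih hs0.ne', sub_mul, mul_sub, mul_sub, hPs, hJP, hJJ, ← pow_succ]
        abel
  have hH : (P - J).IsHermitian := by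
    ext a b
    simp only [Matrix.conjTranspose_apply, Matrix.sub_apply, star_trivial, hJ, Matrix.of_apply]
    rw [hP, walkMatrix_symm]
  have heig : ∀ i, |hH.eigenvalues i| ≤ lam := by
    intro i
    set μ := hH.eigenvalues i with hμ
    rcases eq_or_ne μ 0 with hz | hz
    · rw [hz, abs_zero]; exact h0
    set x : V → ℝ := ⇑(hH.eigenvectorBasis i) with hx
    have hxe : (P - J).mulVec x = μ • x := hH.mulVec_eigenvectorBasis i
    have hx0 : x ≠ 0 := by
      intro h
      have h1 := hH.eigenvectorBasis.orthonormal.ne_zero i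
      exact h1 (by ext a; exact congrFun h a)
    have hJx : J.mulVec x = 0 := by
      have : J.mulVec ((P - J).mulVec x) = 0 := by
        rw [Matrix.mulVec_mulVec, mul_sub, hJP, hJJ, sub_self, Matrix.zero_mulVec]
      rw [hxe, Matrix.mulVec_smul] at this
      exact (smul_eq_zero.1 this).resolve_left hz
    have hsum : ∑ v, x v = 0 := by
      have := congrFun hJx u
      simp only [Matrix.mulVec, dotProduct, hJ, Matrix.of_apply, ← Finset.mul_sum,
        Pi.zero_apply] at this
      exact (mul_eq_zero.1 this).resolve_left (by positivity)
    have hPx : P.mulVec x = μ • x := by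
      rw [← hxe, Matrix.sub_mulVec, hJx, sub_zero]
    rw [abs_le]
    constructor
    · have := hβ μ (Module.End.hasEigenvalue_of_hasEigenvector (x := x)
        ⟨Module.End.mem_eigenspace_iff.2 (by rw [Matrix.toLin'_apply, hPx]), hx0⟩)
      linarith
    · refine le_trans ?_ h1
      refine cheeger (w := fun u v => (G.toMultigraph.mult u v : ℝ)) (d := Δ) (a := α)
        (x := x) (fun u v => by positivity)
        (fun u v => by rw [G.toMultigraph.symm]) (by positivity) hα.le (G.sum_mult)
        (fun A hA h2 => mul_card_le_cut h hΔ hA h2) (fun u => ?_) hx0 hsum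
      have := congrFun hPx u
      simp only [Matrix.mulVec, dotProduct, Pi.smul_apply, smul_eq_mul, hP, walkMatrix,
        Matrix.of_apply] at this
      have hd0 : (Δ : ℝ) ≠ 0 := by positivity
      calc ∑ v, (G.toMultigraph.mult u v : ℝ) * x v
          = Δ * ∑ v, (G.toMultigraph.mult u v : ℝ) / Δ * x v := by
            rw [Finset.mul_sum]; exact Finset.sum_congr rfl fun v _ => by field_simp
        _ = _ := by rw [this]; ring
  have := hH.abs_pow_apply_le heig t u v
  rwa [hpow t ht] at this

end RegularMultigraph

/-! ### The idealised procedure and its agreement with the procedure -/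

namespace DegreeReduction

section Deterministic

variable {V : Type*} [Fintype V] [LinearOrder V] {p : Params} {Δ : ℕ}

/-- The node that the walk starting at `v` occupies after `j` steps (it stays put after step `l`). -/
def walkPos (G : RegularMultigraph V Δ) {l : ℕ} (v : V) (ρ : Fin l → Fin Δ) : ℕ → V
  | 0 => v
  | j + 1 => if h : j < l then G.nbr (walkPos G v ρ j) (ρ ⟨j, h⟩) else walkPos G v ρ j

/-- What remains of a snapshot between two phases when scheduling is ignored: the positions of the
tokens, and which of them are active. -/
structure Config (V : Type*) (p : Params) where
  /-- the node at which a token is -/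
  pos : Token V p → V
  /-- whether a token is active -/
  act : Token V p → Bool

/-- The position of a token after the walks of a phase, if all walks are completed. -/
def Config.land (G : RegularMultigraph V Δ) (x : Config V p) (ρ : Token V p → Fin p.len → Fin Δ)
    (t : Token V p) : V :=
  if x.act t = true then walkPos G (x.pos t) (ρ t) p.len else x.pos t

/-- One phase in which all walks are completed. -/
def Config.next (G : RegularMultigraph V Δ) (x : Config V p)
    (ρ : Token V p → Fin p.len → Fin Δ) : Config V p where
  pos := x.land G ρ
  act t := x.act t &&
    decide (p.δ < (univ.filter fun t' => x.land G ρ t' = x.land G ρ t).card)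

/-- The configuration after `k` phases, if in every phase all walks are completed. -/
def config (G : RegularMultigraph V Δ) (ω : Choices V p Δ) : ℕ → Config V p
  | 0 => ⟨Prod.fst, fun _ => true⟩
  | k + 1 => if h : k < p.phases then (config G ω k).next G (ω ⟨k, h⟩) else config G ω k

/-- The number of active tokens whose walk is at `v` after exactly `j` steps. -/
def Config.walkLoad (G : RegularMultigraph V Δ) (x : Config V p)
    (ρ : Token V p → Fin p.len → Fin Δ) (j : ℕ) (v : V) : ℕ :=
  (univ.filter fun t => x.act t = true ∧ walkPos G (x.pos t) (ρ t) j = v).card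

/-! ### Scheduling -/

/-- A node that has to send a message about `t` sends one, about a token of at most the same `prio`. -/
theorem exists_mem_serve (loc : Token V p → V) (prio : Token V p → ℕ) {A : Finset (Token V p)}
    {t : Token V p} (ht : t ∈ A) :
    ∃ t' ∈ serve loc prio A, loc t' = loc t ∧ prio t' ≤ prio t := by
  obtain ⟨t', ht', hmin⟩ := (A.filter fun s => loc s = loc t).exists_min_image
    (fun s => (toLex (prio s, toLex s) : ℕ ×ₗ (V ×ₗ Fin p.c))) ⟨t, by simp [ht]⟩
  simp only [mem_filter] at ht' hmin
  refine ⟨t', ?_, ht'.2, ?_⟩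
  · simp only [serve, mem_filter]
    exact ⟨ht'.1, fun s hs hst => hmin s ⟨hs, hst.trans ht'.2⟩⟩
  · have h := hmin t ⟨ht, rfl⟩
    rw [Prod.Lex.le_iff] at h
    rcases h with h | h
    · exact le_of_lt h
    · exact le_of_eq h.1

theorem serve_subset (loc : Token V p → V) (prio : Token V p → ℕ) (A : Finset (Token V p)) :
    serve loc prio A ⊆ A := Finset.filter_subset _ _

theorem card_serve_le (loc : Token V p → V) (prio : Token V p → ℕ) (A : Finset (Token V p)) :
    (serve loc prio A).card ≤ Fintype.card V := by
  rw [← Finset.card_univ]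
  exact Finset.card_le_card_of_injOn loc (fun _ _ => by simp) (serve_injOn loc prio A)

theorem card_le_card_sub_one {ι : Type*} {B B' : Finset ι} (h : B' ⊆ B)
    (hB : ∀ b ∈ B, ∃ t ∈ B, t ∉ B') : B'.card ≤ B.card - 1 := by
  rcases B.eq_empty_or_nonempty with rfl | ⟨b, hb⟩
  · simp [Finset.subset_empty.1 h]
  · obtain ⟨t, ht, ht'⟩ := hB b hb
    have := Finset.card_lt_card ((Finset.ssubset_iff_of_subset h).2 ⟨t, ht, ht'⟩)
    omega

/-- If one application of `f` removes an element from the set `B x` unless it is empty, then `r`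
applications remove `r` elements or empty it. The invariant `P` is carried along. -/
theorem iterate_card_le {α ι : Type*} (f : α → α) (B : α → Finset ι) (P : α → Prop)
    (hP : ∀ x, P x → P (f x)) (hB : ∀ x, P x → (B (f x)).card ≤ (B x).card - 1) {x : α}
    (hx : P x) (r : ℕ) : P (f^[r] x) ∧ (B (f^[r] x)).card ≤ (B x).card - r := by
  induction r with
  | zero => exact ⟨hx, by simp⟩
  | succ r ih =>
    rw [Function.iterate_succ_apply']
    refine ⟨hP _ ih.1, ?_⟩
    have := hB _ ih.1
    omega

/-- What does not change during the walks of a phase, and where the tokens can be. -/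
structure WalkInv (G : RegularMultigraph V Δ) (ρ : Token V p → Fin p.len → Fin Δ)
    (x y : State V p) : Prop where
  active : y.active = x.active
  holder : y.holder = x.holder
  links : y.links = x.links
  pos : ∀ t, y.pos t = walkPos G (x.pos t) (ρ t) (y.hops t)
  hops_active : ∀ t, x.active t = true → y.hops t ≤ p.len
  hops_inactive : ∀ t, x.active t = false → y.hops t = 0

theorem mem_walking_of_sent {y : State V p} {t : Token V p}
    (h : t ∈ serve y.pos y.hops (walking y)) : y.active t = true ∧ y.hops t < p.len := by
  have := serve_subset _ _ _ h
  simpa [walking] using this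

theorem WalkInv.walkRound {G : RegularMultigraph V Δ} {ρ : Token V p → Fin p.len → Fin Δ}
    {x y : State V p} (h : WalkInv G ρ x y) : WalkInv G ρ x (walkRound G ρ y) where
  active := h.active
  holder := h.holder
  links := h.links
  pos t := by
    by_cases hs : t ∈ serve y.pos y.hops (walking y)
    · have hl := (mem_walking_of_sent hs).2
      simp only [DegreeReduction.walkRound, hs, if_true, hl, dif_pos, walkPos]
      rw [h.pos t]
    · simp only [DegreeReduction.walkRound, hs, if_false, dite_eq_ite, ite_self]
      exact h.pos t
  hops_active t ht := by
    by_cases hs : t ∈ serve y.pos y.hops (walking y)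
    · have hl := (mem_walking_of_sent hs).2
      simp only [DegreeReduction.walkRound, hs, if_true]; omega
    · simp only [DegreeReduction.walkRound, hs, if_false]
      exact h.hops_active t ht
  hops_inactive t ht := by
    have hs : t ∉ serve y.pos y.hops (walking y) := by
      intro hs
      have := (mem_walking_of_sent hs).1
      rw [h.active, ht] at this; exact absurd this (by simp)
    simp only [DegreeReduction.walkRound, hs, if_false]
    exact h.hops_inactive t ht

theorem WalkInv.startPhase (G : RegularMultigraph V Δ) (ρ : Token V p → Fin p.len → Fin Δ)
    (x : State V p) : WalkInv G ρ x (startPhase x) where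
  active := rfl
  holder := rfl
  links := rfl
  pos _ := rfl
  hops_active _ _ := Nat.zero_le _
  hops_inactive _ _ := rfl

theorem WalkInv.iterate {G : RegularMultigraph V Δ} {ρ : Token V p → Fin p.len → Fin Δ}
    {x y : State V p} (h : WalkInv G ρ x y) (r : ℕ) :
    WalkInv G ρ x ((DegreeReduction.walkRound G ρ)^[r] y) := by
  induction r with
  | zero => exact h
  | succ r ih => rw [Function.iterate_succ_apply']; exact ih.walkRound

/-- Once all active tokens have made `j` steps, every round decreases the number of tokens at `v`
that have made exactly `j` steps, because these have priority and no new ones arrive. -/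
theorem card_waiting_walkRound_le (G : RegularMultigraph V Δ)
    (ρ : Token V p → Fin p.len → Fin Δ) (y : State V p) {j : ℕ} (hj : j < p.len)
    (hy : ∀ t, y.active t = true → j ≤ y.hops t) (v : V) :
    (univ.filter fun t => (walkRound G ρ y).active t = true ∧ (walkRound G ρ y).hops t = j ∧
      (walkRound G ρ y).pos t = v).card ≤
    (univ.filter fun t => y.active t = true ∧ y.hops t = j ∧ y.pos t = v).card - 1 := by
  have key : ∀ t, (walkRound G ρ y).active t = true → (walkRound G ρ y).hops t = j →
      t ∉ serve y.pos y.hops (walking y) := by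
    intro t ht hh hs
    have := hy t ht
    simp only [walkRound, hs, if_true] at hh
    omega
  refine card_le_card_sub_one ?_ ?_
  · intro t ht
    simp only [mem_filter, mem_univ, true_and] at ht ⊢
    have hs := key t ht.1 ht.2.1
    have h2 := ht.2
    simp only [walkRound, hs, if_false, dite_eq_ite, ite_self] at h2
    exact ⟨ht.1, h2⟩
  · intro b hb
    simp only [mem_filter, mem_univ, true_and] at hb
    obtain ⟨t, ht, h1, h2⟩ := exists_mem_serve y.pos y.hops (A := walking y) (t := b)
      (by simp [walking, hb.1, hb.2.1, hj])
    have hw := mem_walking_of_sent ht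
    refine ⟨t, ?_, ?_⟩
    · simp only [mem_filter, mem_univ, true_and]
      exact ⟨hw.1, le_antisymm (hb.2.1 ▸ h2) (hy t hw.1), h1.trans hb.2.2⟩
    · simp only [mem_filter, mem_univ, true_and]
      intro h
      exact key t h.1 h.2.1 ht

/-- If at most `M` walks are at the same node after the same number of steps, then serving the
tokens with fewest steps first advances all walks by one step in every `M` rounds. -/
theorem le_hops_iterate (G : RegularMultigraph V Δ) (ρ : Token V p → Fin p.len → Fin Δ)
    (x : State V p) {M : ℕ}
    (hM : ∀ j < p.len, ∀ v, (⟨x.pos, x.active⟩ : Config V p).walkLoad G ρ j v ≤ M) (j : ℕ)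
    (hj : j ≤ p.len) : WalkInv G ρ x ((walkRound G ρ)^[M * j] (startPhase x)) ∧
      ∀ t, x.active t = true → j ≤ ((walkRound G ρ)^[M * j] (startPhase x)).hops t := by
  induction j with
  | zero => exact ⟨WalkInv.startPhase G ρ x, fun t _ => Nat.zero_le _⟩
  | succ j ih =>
    obtain ⟨hinv, hhops⟩ := ih (by omega)
    rw [Nat.mul_succ, Nat.add_comm, Function.iterate_add_apply]
    set y := (walkRound G ρ)^[M * j] (startPhase x) with hy
    have hmono : ∀ z : State V p, WalkInv G ρ x z ∧ (∀ t, x.active t = true → j ≤ z.hops t) →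
        WalkInv G ρ x (walkRound G ρ z) ∧
          (∀ t, x.active t = true → j ≤ (walkRound G ρ z).hops t) := by
      rintro z ⟨h1, h2⟩
      refine ⟨h1.walkRound, fun t ht => ?_⟩
      have := h2 t ht
      simp only [walkRound]
      split_ifs <;> omega
    have hit := fun v => iterate_card_le (walkRound G ρ)
      (fun z : State V p => univ.filter fun t => z.active t = true ∧ z.hops t = j ∧ z.pos t = v)
      (fun z => WalkInv G ρ x z ∧ (∀ t, x.active t = true → j ≤ z.hops t)) hmono
      (fun z hz => card_waiting_walkRound_le G ρ z (by omega)
        (fun t ht => hz.2 t (hz.1.active ▸ ht)) v) (x := y) ⟨hinv, hhops⟩ M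
    refine ⟨hinv.iterate M, fun t ht => ?_⟩
    · set z := (walkRound G ρ)^[M] y with hz
      obtain ⟨⟨hzi, hzj⟩, hcard⟩ := hit (z.pos t)
      have hle : (univ.filter fun t' => y.active t' = true ∧ y.hops t' = j ∧
          y.pos t' = z.pos t).card ≤ M := by
        refine le_trans (Finset.card_le_card ?_) (hM j (by omega) (z.pos t))
        intro t' ht'
        simp only [mem_filter, mem_univ, true_and] at ht' ⊢
        refine ⟨hinv.active ▸ ht'.1, ?_⟩
        rw [← ht'.2.2, hinv.pos t', ht'.2.1]
      have h0 : (univ.filter fun t' => z.active t' = true ∧ z.hops t' = j ∧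
          z.pos t' = z.pos t).card = 0 := by omega
      rw [Finset.card_eq_zero, Finset.filter_eq_empty_iff] at h0
      have h1 := h0 (mem_univ t)
      have h2 := hzj t ht
      have h3 : z.hops t ≠ j := fun h => h1 ⟨hzi.active ▸ ht, h, rfl⟩
      omega

theorem hops_le_iterate (G : RegularMultigraph V Δ) (ρ : Token V p → Fin p.len → Fin Δ)
    (y : State V p) (t : Token V p) (r : ℕ) : y.hops t ≤ ((walkRound G ρ)^[r] y).hops t := by
  induction r with
  | zero => exact le_rfl
  | succ r ih =>
    rw [Function.iterate_succ_apply']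
    refine ih.trans ?_
    simp only [walkRound]
    split_ifs <;> omega

/-- With enough rounds, all walks of a phase are completed. -/
theorem hops_walkPart (G : RegularMultigraph V Δ) (ρ : Token V p → Fin p.len → Fin Δ)
    (x : State V p) {M : ℕ}
    (hM : ∀ j < p.len, ∀ v, (⟨x.pos, x.active⟩ : Config V p).walkLoad G ρ j v ≤ M)
    (hR : M * p.len ≤ p.walkRounds) : WalkInv G ρ x (walkPart G ρ x) ∧
      ∀ t, x.active t = true → (walkPart G ρ x).hops t = p.len := by
  have hinv : WalkInv G ρ x (walkPart G ρ x) := (WalkInv.startPhase G ρ x).iterate _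
  refine ⟨hinv, fun t ht => le_antisymm (hinv.hops_active t ht) ?_⟩
  have h := (le_hops_iterate G ρ x hM p.len le_rfl).2 t ht
  obtain ⟨r, hr⟩ := Nat.exists_eq_add_of_le' hR
  rw [walkPart, hr, Function.iterate_add_apply]
  exact h.trans (hops_le_iterate G ρ _ t r)

theorem walking_walkPart (G : RegularMultigraph V Δ) (ρ : Token V p → Fin p.len → Fin Δ)
    (x : State V p) {M : ℕ}
    (hM : ∀ j < p.len, ∀ v, (⟨x.pos, x.active⟩ : Config V p).walkLoad G ρ j v ≤ M)
    (hR : M * p.len ≤ p.walkRounds) : walking (walkPart G ρ x) = ∅ := by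
  obtain ⟨hinv, hh⟩ := hops_walkPart G ρ x hM hR
  refine Finset.filter_eq_empty_iff.2 fun t _ h => ?_
  have := hh t (hinv.active ▸ h.1)
  omega

/-! ### Notifications -/

/-- A snapshot between two phases agrees with a configuration: moreover the sources of the inactive
tokens have been informed, and no node holds more than `δ` inactive tokens. -/
structure Agrees (x : State V p) (y : Config V p) : Prop where
  pos : x.pos = y.pos
  active : x.active = y.act
  holder : ∀ t, x.holder t = if y.act t = true then none else some (y.pos t)
  links : x.links = ∅
  card_le : ∀ v, (univ.filter fun t => y.act t = false ∧ y.pos t = v).card ≤ p.δ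

theorem agrees_initial (G : RegularMultigraph V Δ) (ω : Choices V p Δ) :
    Agrees (initial : State V p) (config G ω 0) where
  pos := rfl
  active := rfl
  holder t := rfl
  links := rfl
  card_le v := by simp [config]

/-- What the notifications of a phase do not change. -/
structure InformInv (x : State V p) (y : State V p) : Prop where
  pos : y.pos = x.pos
  active : y.active = x.active
  links : y.links = x.links
  holder_active : ∀ t, x.active t = true → y.holder t = none
  holder : ∀ t, y.holder t = none ∨ y.holder t = some (x.pos t)

theorem InformInv.informRound {x y : State V p} (h : InformInv x y) :
    InformInv x (informRound y) where
  pos := h.pos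
  active := h.active
  links := h.links
  holder_active t ht := by
    have hs : t ∉ serve y.pos (fun _ => 0)
        (univ.filter fun t => y.active t = false ∧ y.holder t = none) := by
      intro hs
      have := serve_subset _ _ _ hs
      simp [h.active, ht] at this
    simp only [DegreeReduction.informRound, hs, if_false]
    exact h.holder_active t ht
  holder t := by
    simp only [DegreeReduction.informRound]
    split_ifs
    · right; rw [h.pos]
    · exact h.holder t

/-- Every round of notifications decreases the number of inactive tokens at `v` whose sources are not
informed. -/
theorem card_uninformed_informRound_le (y : State V p) (v : V) :
    (univ.filter fun t => (informRound y).active t = false ∧ (informRound y).holder t = none ∧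
      (informRound y).pos t = v).card ≤
    (univ.filter fun t => y.active t = false ∧ y.holder t = none ∧ y.pos t = v).card - 1 := by
  refine card_le_card_sub_one ?_ ?_
  · intro t ht
    simp only [mem_filter, mem_univ, true_and] at ht ⊢
    simp only [informRound] at ht
    refine ⟨ht.1, ?_, ht.2.2⟩
    have := ht.2.1
    split_ifs at this
    exact this
  · intro b hb
    simp only [mem_filter, mem_univ, true_and] at hb
    obtain ⟨t, ht, h1, -⟩ := exists_mem_serve y.pos (fun _ => 0)
      (A := univ.filter fun t => y.active t = false ∧ y.holder t = none) (t := b)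
      (by simp [hb.1, hb.2.1])
    have hw := serve_subset _ _ _ ht
    simp only [mem_filter, mem_univ, true_and] at hw
    refine ⟨t, ?_, ?_⟩
    · simp only [mem_filter, mem_univ, true_and]
      exact ⟨hw.1, hw.2, h1.trans hb.2.2⟩
    · simp only [mem_filter, mem_univ, true_and]
      simp [informRound, ht]

/-- `δ` rounds of notifications suffice if no node holds more than `δ` inactive tokens. -/
theorem informInv_iterate {x : State V p}
    (h0 : ∀ t, x.active t = true → x.holder t = none)
    (h1 : ∀ t, x.holder t = none ∨ x.holder t = some (x.pos t))
    (hc : ∀ v, (univ.filter fun t => x.active t = false ∧ x.pos t = v).card ≤ p.δ) :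
    InformInv x (informRound^[p.δ] x) ∧
      ∀ t, x.active t = false → (informRound^[p.δ] x).holder t = some (x.pos t) := by
  have hx : InformInv x x := ⟨rfl, rfl, rfl, h0, h1⟩
  have hit := fun v => iterate_card_le informRound
    (fun z : State V p => univ.filter fun t => z.active t = false ∧ z.holder t = none ∧
      z.pos t = v) (fun z => InformInv x z) (fun z hz => hz.informRound)
    (fun z _ => card_uninformed_informRound_le z v) hx p.δ
  have hinv : InformInv x (informRound^[p.δ] x) := by
    generalize p.δ = r
    induction r with
    | zero => exact hx
    | succ r ih => rw [Function.iterate_succ_apply']; exact ih.informRound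
  refine ⟨hinv, fun t ht => (hinv.holder t).resolve_left fun hn => ?_⟩
  obtain ⟨-, hcard⟩ := hit (x.pos t)
  have hle : (univ.filter fun t' => x.active t' = false ∧ x.holder t' = none ∧
      x.pos t' = x.pos t).card ≤ p.δ := by
    refine le_trans (Finset.card_le_card ?_) (hc (x.pos t))
    intro t' ht'
    simp only [mem_filter, mem_univ, true_and] at ht' ⊢
    exact ⟨ht'.1, ht'.2.2⟩
  have h0 : (univ.filter fun t' => (informRound^[p.δ] x).active t' = false ∧
      (informRound^[p.δ] x).holder t' = none ∧
      (informRound^[p.δ] x).pos t' = x.pos t).card = 0 := by omega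
  rw [Finset.card_eq_zero, Finset.filter_eq_empty_iff] at h0
  exact h0 (mem_univ t) ⟨hinv.active ▸ ht, hn, congrFun hinv.pos t⟩

/-- No node ever holds more than `δ` inactive tokens: where tokens become inactive, there are at most
`δ` tokens in total. -/
theorem card_inactive_next_le (G : RegularMultigraph V Δ) (x : Config V p)
    (ρ : Token V p → Fin p.len → Fin Δ)
    (h : ∀ v, (univ.filter fun t => x.act t = false ∧ x.pos t = v).card ≤ p.δ) (v : V) :
    (univ.filter fun t => (x.next G ρ).act t = false ∧ (x.next G ρ).pos t = v).card ≤ p.δ := by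
  by_cases hv : (univ.filter fun t => x.land G ρ t = v).card ≤ p.δ
  · refine le_trans (Finset.card_le_card ?_) hv
    intro t ht
    simp only [mem_filter, mem_univ, true_and] at ht ⊢
    exact ht.2
  · refine le_trans (Finset.card_le_card ?_) (h v)
    intro t ht
    simp only [mem_filter, mem_univ, true_and] at ht ⊢
    simp only [Config.next, Bool.and_eq_false_iff, decide_eq_false_iff_not] at ht
    have h1 : x.act t = false := by
      rcases ht.1 with h1 | h1
      · exact h1
      · rw [ht.2] at h1; omega
    refine ⟨h1, ?_⟩
    have h2 := ht.2
    simpa [Config.land, h1] using h2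

/-- A phase in which no node is congested runs as in the idealised procedure. -/
theorem Agrees.runPhase {x : State V p} {y : Config V p} (h : Agrees x y)
    (G : RegularMultigraph V Δ) (ρ : Token V p → Fin p.len → Fin Δ) {M : ℕ}
    (hM : ∀ j < p.len, ∀ v, y.walkLoad G ρ j v ≤ M) (hR : M * p.len ≤ p.walkRounds) :
    Agrees (runPhase G ρ x) (y.next G ρ) := by
  have hy : (⟨x.pos, x.active⟩ : Config V p) = y := by rw [h.pos, h.active]
  obtain ⟨hinv, hh⟩ := hops_walkPart G ρ x (M := M) (by rw [hy]; exact hM) hR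
  have hpos : (walkPart G ρ x).pos = y.land G ρ := by
    funext t
    rw [hinv.pos t, Config.land, ← h.active, ← h.pos]
    by_cases ht : x.active t = true
    · rw [if_pos ht, hh t ht]
    · rw [if_neg ht, hinv.hops_inactive t (by simpa using ht)]; rfl
  set z := settle (walkPart G ρ x) with hz
  have hzpos : z.pos = (y.next G ρ).pos := hpos
  have hzact : z.active = (y.next G ρ).act := by
    funext t
    simp only [hz, settle, Config.next, hinv.active, ← h.active, load, hpos]
    by_cases ht : x.active t = true
    · rw [ht, hh t ht]
      by_cases hc : p.δ < (univ.filter fun t' => y.land G ρ t' = y.land G ρ t).card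
      · simp [hc]
      · simp [hc, not_lt.1 hc]
    · simp [ht]
  have hzh : z.holder = x.holder := hinv.holder
  have hmono : ∀ t, (y.next G ρ).act t = true → y.act t = true := by
    intro t ht
    simp only [Config.next, Bool.and_eq_true] at ht
    exact ht.1
  obtain ⟨hi, hih⟩ := informInv_iterate (x := z)
    (fun t ht => by
      rw [hzact] at ht
      rw [hzh, h.holder, if_pos (hmono t ht)])
    (fun t => by
      rw [hzh, h.holder]
      by_cases ht : y.act t = true
      · simp [ht]
      · right
        rw [if_neg ht, hzpos]
        simp [Config.next, Config.land, ht])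
    (fun v => by
      rw [hzact, hzpos]
      exact card_inactive_next_le G y ρ h.card_le v)
  refine ⟨hi.pos.trans hzpos, hi.active.trans hzact, fun t => ?_, ?_, ?_⟩
  · by_cases ht : (y.next G ρ).act t = true
    · rw [if_pos ht]
      exact hi.holder_active t (by rw [hzact]; exact ht)
    · rw [if_neg ht, ← hzpos]
      exact hih t (by rw [hzact]; simpa using ht)
  · exact hi.links.trans (hinv.links.trans h.links)
  · exact card_inactive_next_le G y ρ h.card_le

/-- No congestion: at most `M` walks are at the same node after the same number of steps. -/
def Uncongested (G : RegularMultigraph V Δ) (ω : Choices V p Δ) (M : ℕ) : Prop :=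
  ∀ k : Fin p.phases, ∀ j < p.len, ∀ v, (config G ω k).walkLoad G (ω k) j v ≤ M

theorem agrees_afterPhases {G : RegularMultigraph V Δ} {ω : Choices V p Δ} {M : ℕ}
    (hM : Uncongested G ω M) (hR : M * p.len ≤ p.walkRounds) (k : ℕ) :
    Agrees (afterPhases G ω k) (config G ω k) := by
  induction k with
  | zero => exact agrees_initial G ω
  | succ k ih =>
    by_cases hk : k < p.phases
    · simp only [afterPhases, config, hk, dif_pos]
      exact ih.runPhase G _ (hM ⟨k, hk⟩) hR
    · simp only [afterPhases, config, hk, dif_neg, not_false_eq_true]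
      exact ih

theorem walksComplete {G : RegularMultigraph V Δ} {ω : Choices V p Δ} {M : ℕ}
    (hM : Uncongested G ω M) (hR : M * p.len ≤ p.walkRounds) : WalksComplete G ω := by
  intro k
  have h := agrees_afterPhases hM hR k
  refine walking_walkPart G _ _ (M := M) ?_ hR
  rw [h.pos, h.active]
  exact hM k

/-! ### Edge creation -/

/-- What edge creation does not change, once all tokens are inactive and located. -/
structure LinkInv (y : Config V p) (x : State V p) : Prop where
  active : ∀ t, x.active t = false
  holder : ∀ t, x.holder t = some (y.pos t)
  links : ∀ u v, (u, v) ∈ x.links → ∃ j, y.pos (u, j) = v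

omit [Fintype V] [LinearOrder V] in
theorem LinkInv.satisfied {y : Config V p} {x : State V p} (h : LinkInv y x) (v : V) :
    Satisfied x v := fun j => ⟨h.active _, by rw [h.holder]; rfl⟩

theorem LinkInv.linkRound {y : Config V p} {x : State V p} (h : LinkInv y x) :
    LinkInv y (linkRound x) where
  active := h.active
  holder := h.holder
  links u v huv := by
    simp only [DegreeReduction.linkRound, mem_union, mem_filter, mem_univ, true_and] at huv
    rcases huv with huv | ⟨t, _, rfl, ht⟩
    · exact h.links u v huv
    · rw [h.holder] at ht
      exact ⟨t.2, by simpa using ht⟩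

/-- Every round of edge creation decreases the number of tokens of `u` to whose holder `u` has not
created an edge yet. -/
theorem LinkInv.card_pending_le {y : Config V p} {x : State V p} (h : LinkInv y x) (u : V) :
    (univ.filter fun j : Fin p.c => (u, y.pos (u, j)) ∉ (DegreeReduction.linkRound x).links).card ≤
    (univ.filter fun j : Fin p.c => (u, y.pos (u, j)) ∉ x.links).card - 1 := by
  refine card_le_card_sub_one ?_ ?_
  · intro j hj
    simp only [mem_filter, mem_univ, true_and, DegreeReduction.linkRound, mem_union] at hj ⊢
    exact fun h' => hj (Or.inl h')
  · intro b hb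
    simp only [mem_filter, mem_univ, true_and] at hb
    obtain ⟨t, ht, h1, -⟩ := exists_mem_serve (Prod.fst : Token V p → V) (fun _ => 0)
      (A := univ.filter fun t => Satisfied x t.1 ∧
        ∃ v, x.holder t = some v ∧ (t.1, v) ∉ x.links) (t := (u, b))
      (by simp [h.satisfied, h.holder, hb])
    have hw := serve_subset _ _ _ ht
    simp only [mem_filter, mem_univ, true_and, h.holder, Option.some.injEq] at hw
    obtain ⟨-, v, hv, hvl⟩ := hw
    obtain ⟨u', j⟩ := t
    simp only at h1
    subst h1
    refine ⟨j, ?_, ?_⟩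
    · simp only [mem_filter, mem_univ, true_and]
      rw [hv]; exact hvl
    · simp only [mem_filter, mem_univ, true_and, not_not, DegreeReduction.linkRound, mem_union]
      right
      exact ⟨(u', j), ht, rfl, h.holder _⟩

/-- If all tokens are inactive after the last phase, then all nodes are satisfied, and the created
edges lead from the sources of the tokens to their final positions. -/
theorem mem_links_finalState {G : RegularMultigraph V Δ} {ω : Choices V p Δ} {M : ℕ}
    (hM : Uncongested G ω M) (hR : M * p.len ≤ p.walkRounds)
    (hT : ∀ t, (config G ω p.phases).act t = false) :
    (∀ v, Satisfied (finalState G ω) v) ∧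
      ∀ u v, (u, v) ∈ (finalState G ω).links ↔ ∃ j, (config G ω p.phases).pos (u, j) = v := by
  have h := agrees_afterPhases hM hR p.phases
  have h0 : LinkInv (config G ω p.phases) (afterPhases G ω p.phases) :=
    ⟨fun t => by rw [h.active, hT], fun t => by rw [h.holder]; simp [hT],
      fun u v huv => by rw [h.links] at huv; simp at huv⟩
  have hinv : LinkInv (config G ω p.phases) (finalState G ω) := by
    unfold finalState
    generalize p.c = r
    induction r with
    | zero => exact h0
    | succ r ih => rw [Function.iterate_succ_apply']; exact ih.linkRound
  refine ⟨hinv.satisfied, fun u v => ⟨hinv.links u v, ?_⟩⟩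
  rintro ⟨j, rfl⟩
  by_contra hj
  have hit := (iterate_card_le linkRound
    (fun z : State V p => univ.filter fun j : Fin p.c =>
      (u, (config G ω p.phases).pos (u, j)) ∉ z.links)
    (fun z => LinkInv (config G ω p.phases) z) (fun z hz => hz.linkRound)
    (fun z hz => hz.card_pending_le u) h0 p.c).2
  have hle : (univ.filter fun j : Fin p.c => (u, (config G ω p.phases).pos (u, j)) ∉
      (afterPhases G ω p.phases).links).card ≤ p.c := by
    refine (Finset.card_le_univ _).trans ?_
    simp
  have h0 : (univ.filter fun j : Fin p.c => (u, (config G ω p.phases).pos (u, j)) ∉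
      (finalState G ω).links).card = 0 := by
    unfold finalState; omega
  rw [Finset.card_eq_zero, Finset.filter_eq_empty_iff] at h0
  exact h0 (mem_univ j) hj

/-- The degree is bounded because every node generated `c` tokens and holds at most `δ`. -/
theorem degree_output_le {G : RegularMultigraph V Δ} {ω : Choices V p Δ} {M : ℕ}
    (hM : Uncongested G ω M) (hR : M * p.len ≤ p.walkRounds)
    (hT : ∀ t, (config G ω p.phases).act t = false) (u : V) :
    (output G ω).degree u ≤ p.c + p.δ := by
  obtain ⟨-, hl⟩ := mem_links_finalState hM hR hT
  have hcard := (agrees_afterPhases hM hR p.phases).card_le u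
  have h1 : (output G ω).degree u = (univ.filter fun v =>
      (∃ j, (config G ω p.phases).pos (u, j) = v) ∨
        ∃ j, (config G ω p.phases).pos (v, j) = u).card := by
    simp only [Multigraph.degree, output, hl, Finset.card_filter]
  rw [h1, Finset.filter_or]
  refine (Finset.card_union_le _ _).trans (Nat.add_le_add ?_ ?_)
  · calc _ ≤ (univ.image fun j : Fin p.c => (config G ω p.phases).pos (u, j)).card := by
          refine Finset.card_le_card fun v hv => ?_
          simpa using hv
      _ ≤ _ := Finset.card_image_le.trans (by simp)
  · calc _ ≤ ((univ.filter fun t : Token V p => (config G ω p.phases).act t = false ∧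
            (config G ω p.phases).pos t = u).image Prod.fst).card := by
          refine Finset.card_le_card fun v hv => ?_
          simp only [mem_filter, mem_univ, true_and] at hv
          obtain ⟨j, hj⟩ := hv
          exact Finset.mem_image.2 ⟨(v, j), by simp [hT, hj], rfl⟩
      _ ≤ _ := Finset.card_image_le.trans hcard

/-! ### Rounds and messages -/

/-- The snapshot `y` is reached from `x` in exactly `r` rounds, in each of which every node sends at
most one message. -/
def Cost (x y : State V p) (r : ℕ) : Prop :=
  y.rounds = x.rounds + r ∧ y.messages ≤ x.messages + Fintype.card V * r

omit [LinearOrder V] in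
theorem Cost.trans {x y z : State V p} {r s : ℕ} (h1 : Cost x y r) (h2 : Cost y z s) :
    Cost x z (r + s) :=
  ⟨by rw [h2.1, h1.1, add_assoc], by
    rw [mul_add, ← add_assoc]; exact h2.2.trans (Nat.add_le_add_right h1.2 _)⟩

omit [LinearOrder V] in
theorem Cost.iterate {f : State V p → State V p} (hf : ∀ x, Cost x (f x) 1) (x : State V p)
    (r : ℕ) : Cost x (f^[r] x) r := by
  induction r with
  | zero => exact ⟨rfl, le_rfl⟩
  | succ r ih => rw [Function.iterate_succ_apply']; exact ih.trans (hf _)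

theorem cost_runPhase (G : RegularMultigraph V Δ) (ρ : Token V p → Fin p.len → Fin Δ)
    (x : State V p) : Cost x (runPhase G ρ x) (p.walkRounds + p.δ) := by
  have h1 : Cost x (settle (walkPart G ρ x)) p.walkRounds := by
    have : Cost (startPhase x) (walkPart G ρ x) p.walkRounds :=
      Cost.iterate (fun y => ⟨rfl, by
        simpa [walkRound] using card_serve_le y.pos y.hops (walking y)⟩) _ _
    exact this
  exact h1.trans (Cost.iterate (fun y => ⟨rfl, by
    simpa [informRound] using card_serve_le y.pos (fun _ => 0) _⟩) _ _)

theorem cost_finalState (G : RegularMultigraph V Δ) (ω : Choices V p Δ) :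
    (finalState G ω).rounds ≤ p.phases * (p.walkRounds + p.δ) + p.c ∧
      (finalState G ω).messages ≤
        Fintype.card V * (p.phases * (p.walkRounds + p.δ) + p.c) := by
  have h1 : ∀ k ≤ p.phases, Cost initial (afterPhases G ω k) (k * (p.walkRounds + p.δ)) := by
    intro k
    induction k with
    | zero => intro _; simp [Cost, afterPhases]
    | succ k ih =>
      intro hk
      have hk' : k < p.phases := hk
      simp only [afterPhases, hk', dif_pos, Nat.succ_mul]
      exact (ih hk'.le).trans (cost_runPhase G _ _)
  have h2 : Cost initial (finalState G ω) (p.phases * (p.walkRounds + p.δ) + p.c) :=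
    (h1 _ le_rfl).trans (Cost.iterate (fun y => ⟨rfl, by
      simpa [linkRound] using card_serve_le Prod.fst (fun _ => 0) _⟩) _ _)
  refine ⟨by rw [h2.1]; simp [initial], h2.2.trans (by simp [initial])⟩

end Deterministic

end DegreeReduction

/-! ### Uniform probability on finite product spaces -/

section Probability

open scoped BigOperators

open Classical in
/-- The probability of an event under the uniform distribution on a finite type. -/
noncomputable def unifProb {Ω : Type*} [Fintype Ω] (E : Ω → Prop) : ℝ :=
  𝔼 ω, if E ω then (1 : ℝ) else 0

section Basic

variable {Ω : Type*} [Fintype Ω] {E F : Ω → Prop}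

theorem unifProb_mono (h : ∀ ω, E ω → F ω) : unifProb E ≤ unifProb F := by
  refine Finset.expect_le_expect fun ω _ => ?_
  by_cases hE : E ω
  · simp [hE, h ω hE]
  · simp only [hE, if_false]; split_ifs <;> norm_num

theorem unifProb_false (h : ∀ ω, ¬ E ω) : unifProb E = 0 := by
  simp [unifProb, h]

theorem unifProb_or_le (E F : Ω → Prop) :
    unifProb (fun ω => E ω ∨ F ω) ≤ unifProb E + unifProb F := by
  rw [unifProb, unifProb, unifProb, ← Finset.expect_add_distrib]
  refine Finset.expect_le_expect fun ω _ => ?_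
  by_cases hE : E ω <;> by_cases hF : F ω <;> simp [hE, hF]

theorem unifProb_exists_le {ι : Type*} (s : Finset ι) (E : ι → Ω → Prop) :
    unifProb (fun ω => ∃ i ∈ s, E i ω) ≤ ∑ i ∈ s, unifProb (E i) := by
  classical
  induction s using Finset.induction_on with
  | empty => rw [unifProb_false (by simp)]; simp
  | insert a s ha ih =>
    rw [Finset.sum_insert ha]
    refine le_trans (unifProb_mono fun ω h => ?_)
      ((unifProb_or_le (E a) (fun ω => ∃ i ∈ s, E i ω)).trans (by linarith))
    simpa [Finset.mem_insert, or_and_right, exists_or] using h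

theorem unifProb_not [Nonempty Ω] (E : Ω → Prop) :
    unifProb (fun ω => ¬ E ω) = 1 - unifProb E := by
  have h : unifProb E + unifProb (fun ω => ¬ E ω) = 1 := by
    rw [unifProb, unifProb, ← Finset.expect_add_distrib, ← Fintype.expect_const (ι := Ω) (1 : ℝ)]
    refine Finset.expect_congr rfl fun ω _ => ?_
    by_cases hE : E ω <;> simp [hE]
  linarith

/-- Markov's inequality for the exponential of a counting variable. -/
theorem unifProb_le_of_expect_pow_le {X : Ω → ℕ} {z B : ℝ} (hz : 1 ≤ z)
    (h : 𝔼 ω, z ^ X ω ≤ B) (m : ℕ) : unifProb (fun ω => m ≤ X ω) ≤ B / z ^ m := by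
  have hz0 : 0 < z := by linarith
  rw [le_div_iff₀ (by positivity)]
  refine le_trans ?_ h
  rw [unifProb, Finset.expect_mul]
  refine Finset.expect_le_expect fun ω _ => ?_
  by_cases hm : m ≤ X ω
  · simpa [hm] using pow_le_pow_right₀ hz hm
  · simp only [hm, if_false, zero_mul]; positivity

end Basic

section Product

variable {ι Y : Type*} [Fintype ι] [DecidableEq ι] [Fintype Y] [Nonempty Y]

/-- Resampling one coordinate does not change the uniform distribution on a product space. -/
theorem expect_update (i : ι) (F : (ι → Y) → ℝ) :
    𝔼 ω, F ω = 𝔼 ω, 𝔼 y, F (Function.update ω i y) := by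
  let e : (ι → Y) × Y → (ι → Y) × Y := fun q => (Function.update q.1 i q.2, q.1 i)
  have he : Function.Involutive e := by
    rintro ⟨ω, y⟩
    simp [e]
  have h1 : 𝔼 ω : ι → Y, 𝔼 y : Y, F (Function.update ω i y)
      = 𝔼 q : (ι → Y) × Y, F (Function.update q.1 i q.2) := by
    rw [← Finset.expect_product', Finset.univ_product_univ]
  have h2 : 𝔼 ω : ι → Y, F ω = 𝔼 q : (ι → Y) × Y, F q.1 := by
    rw [← Finset.univ_product_univ, Finset.expect_product]
    exact Finset.expect_congr rfl fun ω _ => (Fintype.expect_const _).symm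
  rw [h1, h2]
  exact (Fintype.expect_equiv he.toPerm _ _ fun q => rfl).symm

theorem unifProb_le_of_update {E : (ι → Y) → Prop} {w : ℝ} (i : ι)
    (h : ∀ ω, unifProb (fun y => E (Function.update ω i y)) ≤ w) : unifProb E ≤ w := by
  rw [unifProb, expect_update i]
  calc _ ≤ 𝔼 _ω : ι → Y, w := Finset.expect_le_expect fun ω _ => h ω
    _ = w := Fintype.expect_const _

/-- If the factor `f i` does not depend on the coordinates of higher rank, and has expectation at
most `W i` when its own coordinate is resampled, then the expectation of the product is at most the
product of the `W i`: the coordinates can be integrated out by decreasing rank. -/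
theorem expect_prod_le (r : ι → ℕ) (f : ι → (ι → Y) → ℝ) (W : ι → ℝ) (Z : Finset ι)
    (hf : ∀ i ω, 0 ≤ f i ω)
    (hdep : ∀ i ∈ Z, ∀ j ∈ Z, j ≠ i → r j ≤ r i → ∀ ω y, f j (Function.update ω i y) = f j ω)
    (hW : ∀ i ∈ Z, ∀ ω, 𝔼 y, f i (Function.update ω i y) ≤ W i) :
    𝔼 ω, ∏ i ∈ Z, f i ω ≤ ∏ i ∈ Z, W i := by
  induction Z using Finset.induction_on_max_value r with
  | empty => simp
  | insert a s ha hmax ih =>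
    have hWa : 0 ≤ W a := by
      refine le_trans ?_ (hW a (mem_insert_self a s) (fun _ => Classical.arbitrary Y))
      exact Finset.expect_nonneg fun y _ => hf a _
    have hs : ∀ ω y, ∏ i ∈ s, f i (Function.update ω a y) = ∏ i ∈ s, f i ω := fun ω y =>
      Finset.prod_congr rfl fun j hj => hdep a (mem_insert_self a s) j (mem_insert_of_mem hj)
        (fun h => ha (h ▸ hj)) (hmax j hj) ω y
    calc 𝔼 ω, ∏ i ∈ insert a s, f i ω
        = 𝔼 ω, (𝔼 y, f a (Function.update ω a y)) * ∏ i ∈ s, f i ω := by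
          rw [expect_update a]
          refine Finset.expect_congr rfl fun ω _ => ?_
          rw [Finset.expect_mul]
          refine Finset.expect_congr rfl fun y _ => ?_
          rw [Finset.prod_insert ha, hs]
      _ ≤ 𝔼 ω, W a * ∏ i ∈ s, f i ω := by
          refine Finset.expect_le_expect fun ω _ => ?_
          exact mul_le_mul_of_nonneg_right (hW a (mem_insert_self a s) ω)
            (Finset.prod_nonneg fun i _ => hf i ω)
      _ = W a * 𝔼 ω, ∏ i ∈ s, f i ω := (Finset.mul_expect _ _ _).symm
      _ ≤ W a * ∏ i ∈ s, W i := by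
          refine mul_le_mul_of_nonneg_left (ih ?_ ?_) hWa
          · exact fun i hi j hj => hdep i (mem_insert_of_mem hi) j (mem_insert_of_mem hj)
          · exact fun i hi => hW i (mem_insert_of_mem hi)
      _ = _ := (Finset.prod_insert ha).symm

open Classical in
/-- The moment generating function of the number of events that occur, for events that are revealed
one after the other. -/
theorem expect_pow_card_le (r : ι → ℕ) (B : ι → (ι → Y) → Prop) (w : ι → ℝ) (Z : Finset ι)
    {z : ℝ} (hz : 1 ≤ z)
    (hdep : ∀ i ∈ Z, ∀ j ∈ Z, j ≠ i → r j ≤ r i →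
      ∀ ω y, B j (Function.update ω i y) ↔ B j ω)
    (hw : ∀ i ∈ Z, ∀ ω, unifProb (fun y => B i (Function.update ω i y)) ≤ w i) :
    𝔼 ω, z ^ (Z.filter fun i => B i ω).card ≤ ∏ i ∈ Z, (1 + (z - 1) * w i) := by
  have h1 : ∀ ω, z ^ (Z.filter fun i => B i ω).card = ∏ i ∈ Z, if B i ω then z else 1 := by
    intro ω
    rw [Finset.prod_ite, Finset.prod_const, Finset.prod_const_one, mul_one]
  simp only [h1]
  refine expect_prod_le r (fun i ω => if B i ω then z else 1) _ Z ?_ ?_ ?_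
  · intro i ω; split_ifs <;> linarith
  · intro i hi j hj hne hr ω y
    simp only [hdep i hi j hj hne hr ω y]
  · intro i hi ω
    have h2 : 𝔼 y, (if B i (Function.update ω i y) then z else 1)
        = 1 + (z - 1) * unifProb (fun y => B i (Function.update ω i y)) := by
      rw [unifProb, Finset.mul_expect, ← Fintype.expect_const (ι := Y) (1 : ℝ),
        ← Finset.expect_add_distrib, Fintype.expect_const]
      refine Finset.expect_congr rfl fun y _ => ?_
      split_ifs <;> ring
    rw [h2]
    have := mul_le_mul_of_nonneg_left (hw i hi ω) (sub_nonneg.2 hz)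
    linarith

end Product

end Probability

/-! ### The law of the random walk -/

namespace DegreeReduction

section Walk

open scoped BigOperators

variable {V : Type*} [Fintype V] [LinearOrder V] {p : Params} {Δ : ℕ}

theorem walkPos_update_of_le (G : RegularMultigraph V Δ) {l : ℕ} (v : V) (ρ : Fin l → Fin Δ)
    (i : Fin l) (y : Fin Δ) {j : ℕ} (hj : j ≤ i) :
    walkPos G v (Function.update ρ i y) j = walkPos G v ρ j := by
  induction j with
  | zero => rfl
  | succ j ih =>
    simp only [walkPos, ih (by omega)]
    split_ifs with h
    · rw [Function.update_of_ne]
      intro he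
      rw [← he] at hj
      simp at hj
    · rfl

theorem expect_nbr (G : RegularMultigraph V Δ) (v : V) (g : V → ℝ) :
    𝔼 y : Fin Δ, g (G.nbr v y) = ∑ u, G.walkMatrix v u * g u := by
  rw [Fintype.expect_eq_sum_div_card, Fintype.card_fin,
    ← Finset.sum_fiberwise (univ : Finset (Fin Δ)) (G.nbr v) (fun y => g (G.nbr v y)),
    Finset.sum_div]
  refine Finset.sum_congr rfl fun u _ => ?_
  have : ∑ y ∈ univ.filter (fun y => G.nbr v y = u), g (G.nbr v y)
      = (univ.filter fun y => G.nbr v y = u).card * g u := by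
    rw [← nsmul_eq_mul, ← Finset.sum_const]
    refine Finset.sum_congr rfl fun y hy => ?_
    rw [(mem_filter.1 hy).2]
  rw [this]
  simp only [RegularMultigraph.walkMatrix, Matrix.of_apply, RegularMultigraph.toMultigraph]
  ring

/-- The law of the walk after `j` steps is given by the `j`-th power of the walk matrix. -/
theorem expect_walkPos [Nonempty (Fin Δ)] (G : RegularMultigraph V Δ) {l : ℕ} (v : V) {j : ℕ}
    (hj : j ≤ l) (g : V → ℝ) :
    𝔼 ρ : Fin l → Fin Δ, g (walkPos G v ρ j) = ∑ u, (G.walkMatrix ^ j) v u * g u := by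
  induction j generalizing g with
  | zero => simp [walkPos, Matrix.one_apply]
  | succ j ih =>
    have hj' : j < l := hj
    rw [expect_update (⟨j, hj'⟩ : Fin l)]
    have h1 : ∀ ρ : Fin l → Fin Δ, 𝔼 y, g (walkPos G v (Function.update ρ ⟨j, hj'⟩ y) (j + 1))
        = ∑ u, G.walkMatrix (walkPos G v ρ j) u * g u := by
      intro ρ
      rw [← expect_nbr]
      refine Finset.expect_congr rfl fun y _ => ?_
      simp only [walkPos, hj', dif_pos, Function.update_self]
      rw [walkPos_update_of_le G v ρ _ y le_rfl]
    simp only [h1]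
    rw [ih hj'.le (fun a => ∑ u, G.walkMatrix a u * g u)]
    simp only [pow_succ, Matrix.mul_apply, Finset.sum_mul, Finset.mul_sum]
    rw [Finset.sum_comm]
    exact Finset.sum_congr rfl fun u _ => Finset.sum_congr rfl fun a _ => by ring

theorem unifProb_walkPos_mem [Nonempty (Fin Δ)] (G : RegularMultigraph V Δ) {l : ℕ} (v : V)
    {j : ℕ} (hj : j ≤ l) (A : Finset V) :
    unifProb (fun ρ : Fin l → Fin Δ => walkPos G v ρ j ∈ A)
      = ∑ u ∈ A, (G.walkMatrix ^ j) v u := by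
  have := expect_walkPos G v hj (fun u => if u ∈ A then 1 else 0)
  simp only [mul_ite, mul_one, mul_zero, Finset.sum_ite_mem, Finset.univ_inter] at this
  rw [unifProb, ← this]
  exact Finset.expect_congr rfl fun ρ _ => by split_ifs <;> rfl

/-- The bound on the probability that the end of a mixed walk is a given node. -/
noncomputable def mixBound (V : Type*) [Fintype V] : ℝ :=
  1 / (Fintype.card V : ℝ) + 1 / (Fintype.card V : ℝ) ^ 2

omit [LinearOrder V] in
theorem mixBound_nonneg : 0 ≤ mixBound V := by unfold mixBound; positivity

theorem unifProb_walkPos_mem_le [Nonempty (Fin Δ)] {G : RegularMultigraph V Δ} {l : ℕ}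
    (hG : G.MixedAfter l) (v : V) (A : Finset V) :
    unifProb (fun ρ : Fin l → Fin Δ => walkPos G v ρ l ∈ A) ≤ A.card * mixBound V := by
  rw [unifProb_walkPos_mem G v le_rfl, ← nsmul_eq_mul, ← Finset.sum_const]
  refine Finset.sum_le_sum fun u _ => ?_
  have := (abs_le.1 (hG v u)).2
  unfold mixBound; linarith

theorem sum_walkMatrix_pow (G : RegularMultigraph V Δ) (hΔ : 0 < Δ) (j : ℕ) (v : V) :
    ∑ u, (G.walkMatrix ^ j) u v = 1 := by
  induction j generalizing v with
  | zero => simp [Matrix.one_apply]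
  | succ j ih =>
    simp only [pow_succ, Matrix.mul_apply]
    rw [Finset.sum_comm]
    simp only [← Finset.sum_mul, ih, one_mul]
    rw [← RegularMultigraph.sum_walkMatrix (G := G) hΔ v]
    exact Finset.sum_congr rfl fun u _ => RegularMultigraph.walkMatrix_symm u v

theorem walkMatrix_pow_nonneg (G : RegularMultigraph V Δ) (j : ℕ) (u v : V) :
    0 ≤ (G.walkMatrix ^ j) u v := by
  induction j generalizing v with
  | zero => simp only [pow_zero, Matrix.one_apply]; split_ifs <;> norm_num
  | succ j ih =>
    simp only [pow_succ, Matrix.mul_apply]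
    exact Finset.sum_nonneg fun a _ => mul_nonneg (ih a) (RegularMultigraph.walkMatrix_nonneg _ _)

/-! ### One phase: congestion and rejections -/

/-- The number of active tokens at `v`. -/
def Config.activeLoad (x : Config V p) (v : V) : ℕ :=
  (univ.filter fun t => x.act t = true ∧ x.pos t = v).card

/-- The number of active tokens. -/
def Config.numActive (x : Config V p) : ℕ := (univ.filter fun t => x.act t = true).card

theorem Config.land_update_of_ne (G : RegularMultigraph V Δ) (x : Config V p)
    (ρ : Token V p → Fin p.len → Fin Δ) {t t' : Token V p} (h : t' ≠ t) (y : Fin p.len → Fin Δ) :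
    x.land G (Function.update ρ t y) t' = x.land G ρ t' := by
  simp [Config.land, Function.update_of_ne h]

theorem Config.unifProb_land_mem_le [Nonempty (Fin Δ)] {G : RegularMultigraph V Δ}
    (hG : G.MixedAfter p.len) (x : Config V p) {t : Token V p} (ht : x.act t = true)
    (ρ : Token V p → Fin p.len → Fin Δ) (A : Finset V) :
    unifProb (fun y => x.land G (Function.update ρ t y) t ∈ A) ≤ A.card * mixBound V := by
  refine le_trans (unifProb_mono fun y hy => ?_) (unifProb_walkPos_mem_le hG (x.pos t) A)
  simpa [Config.land, ht] using hy

theorem one_add_mul_le_exp {z w : ℝ} (hw : 0 ≤ w) : 1 + (z - 1) * w ≤ Real.exp (z * w) := by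
  have := Real.add_one_le_exp (z * w)
  linarith

/-- A Chernoff bound for the number of walks at a node after `j` steps. -/
theorem Config.unifProb_walkLoad_le [Nonempty (Fin Δ)] (G : RegularMultigraph V Δ)
    (x : Config V p) {j : ℕ} (hj : j ≤ p.len) (v : V) {s : ℝ}
    (hs : ∑ t ∈ univ.filter (fun t => x.act t = true), (G.walkMatrix ^ j) (x.pos t) v ≤ s)
    (m : ℕ) :
    unifProb (fun ρ => m ≤ x.walkLoad G ρ j v) ≤ Real.exp (3 * s - m) := by
  classical
  have hz : (1 : ℝ) ≤ Real.exp 1 := Real.one_le_exp (by norm_num)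
  have h := expect_pow_card_le (fun _ : Token V p => 0)
    (fun t (ρ : Token V p → Fin p.len → Fin Δ) => walkPos G (x.pos t) (ρ t) j = v)
    (fun t => (G.walkMatrix ^ j) (x.pos t) v) (univ.filter fun t => x.act t = true) hz
    (fun t _ t' _ hne _ ρ y => by rw [Function.update_of_ne hne])
    (fun t _ ρ => by
      have := unifProb_walkPos_mem G (x.pos t) hj {v}
      simp only [mem_singleton, sum_singleton] at this
      simp [this])
  have h2 : ∏ t ∈ univ.filter (fun t => x.act t = true),
      (1 + (Real.exp 1 - 1) * (G.walkMatrix ^ j) (x.pos t) v) ≤ Real.exp (3 * s) := by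
    calc _ ≤ ∏ t ∈ univ.filter (fun t => x.act t = true),
          Real.exp (Real.exp 1 * (G.walkMatrix ^ j) (x.pos t) v) := by
          refine Finset.prod_le_prod (fun t _ => ?_) fun t _ =>
            one_add_mul_le_exp (walkMatrix_pow_nonneg G j _ _)
          have := mul_nonneg (sub_nonneg.2 hz) (walkMatrix_pow_nonneg G j (x.pos t) v)
          linarith
      _ ≤ _ := by
          rw [← Real.exp_sum, ← Finset.mul_sum]
          refine Real.exp_le_exp.2 ?_
          have h0 : 0 ≤ ∑ t ∈ univ.filter (fun t => x.act t = true),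
            (G.walkMatrix ^ j) (x.pos t) v :=
              Finset.sum_nonneg fun t _ => walkMatrix_pow_nonneg G j _ _
          have h3 := Real.exp_one_lt_d9
          nlinarith
  have h3 := unifProb_le_of_expect_pow_le hz (h.trans h2) m
  rw [← Real.exp_nat_mul, mul_one, ← Real.exp_sub] at h3
  refine le_trans (le_of_eq ?_) h3
  congr 1
  funext ρ
  rw [Config.walkLoad, Finset.filter_filter]
  congr!

/-- The expected number of walks at a node is at most the maximal initial number of active tokens
at a node, because the walk matrix is doubly stochastic. -/
theorem Config.sum_walkMatrix_pow_le (G : RegularMultigraph V Δ) (hΔ : 0 < Δ) (x : Config V p)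
    {s : ℕ} (hs : ∀ u, x.activeLoad u ≤ s) (j : ℕ) (v : V) :
    ∑ t ∈ univ.filter (fun t => x.act t = true), (G.walkMatrix ^ j) (x.pos t) v ≤ s := by
  rw [← Finset.sum_fiberwise _ x.pos]
  calc _ ≤ ∑ u, (s : ℝ) * (G.walkMatrix ^ j) u v := by
        refine Finset.sum_le_sum fun u _ => ?_
        have : ∑ t ∈ (univ.filter (fun t => x.act t = true)).filter (fun t => x.pos t = u),
            (G.walkMatrix ^ j) (x.pos t) v = x.activeLoad u * (G.walkMatrix ^ j) u v := by
          rw [Config.activeLoad, ← Finset.filter_filter, ← nsmul_eq_mul, ← Finset.sum_const]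
          exact Finset.sum_congr rfl fun t ht => by rw [(mem_filter.1 ht).2]
        rw [this]
        exact mul_le_mul_of_nonneg_right (by exact_mod_cast hs u) (walkMatrix_pow_nonneg G j u v)
    _ = s := by rw [← Finset.mul_sum, sum_walkMatrix_pow G hΔ, mul_one]

omit [LinearOrder V] in
theorem card_token : Fintype.card (Token V p) = Fintype.card V * p.c := by simp [Token]

theorem Config.sum_walkMatrix_len_le {G : RegularMultigraph V Δ} (hG : G.MixedAfter p.len)
    (x : Config V p) (v : V) :
    ∑ t ∈ univ.filter (fun t => x.act t = true), (G.walkMatrix ^ p.len) (x.pos t) v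
      ≤ (Fintype.card V * p.c : ℕ) * mixBound V := by
  calc _ ≤ ∑ t ∈ univ.filter (fun t => x.act t = true), mixBound V := by
        refine Finset.sum_le_sum fun t _ => ?_
        have := (abs_le.1 (hG (x.pos t) v)).2
        unfold mixBound; linarith
    _ ≤ _ := by
        rw [Finset.sum_const, nsmul_eq_mul, ← card_token (V := V) (p := p)]
        exact mul_le_mul_of_nonneg_right (by exact_mod_cast Finset.card_le_univ _) mixBound_nonneg

/-- Few values are attained by `m` or more elements. -/
theorem card_filter_mul_le {ι κ : Type*} [Fintype κ] [DecidableEq κ] (s : Finset ι) (f : ι → κ)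
    (m : ℕ) : (univ.filter fun v => m ≤ (s.filter fun i => f i = v).card).card * m ≤ s.card := by
  calc _ = ∑ v ∈ univ.filter (fun v => m ≤ (s.filter fun i => f i = v).card), m := by
        rw [Finset.sum_const, smul_eq_mul]
    _ ≤ ∑ v ∈ univ.filter (fun v => m ≤ (s.filter fun i => f i = v).card),
        (s.filter fun i => f i = v).card :=
        Finset.sum_le_sum fun v hv => (mem_filter.1 hv).2
    _ ≤ ∑ v, (s.filter fun i => f i = v).card :=
        Finset.sum_le_sum_of_subset (Finset.subset_univ _)
    _ = s.card := (Finset.card_eq_sum_card_fiberwise (fun _ _ => by simp)).symm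

/-- A token remains active with small probability, whatever the other tokens do: few nodes hold `δ`
or more of the other tokens. -/
theorem Config.unifProb_act_next_le [Nonempty (Fin Δ)] {G : RegularMultigraph V Δ}
    (hG : G.MixedAfter p.len) (hδ : 0 < p.δ) (x : Config V p) (t : Token V p) :
    unifProb (fun ρ => (x.next G ρ).act t = true)
      ≤ (Fintype.card V * p.c : ℕ) / p.δ * mixBound V := by
  by_cases hact : x.act t = true
  swap
  · rw [unifProb_false (by simp [Config.next, hact])]
    exact mul_nonneg (by positivity) mixBound_nonneg
  refine unifProb_le_of_update t fun ρ => ?_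
  -- The token can be rejected only at a node with at least `δ` other tokens.
  set A := univ.filter fun v => p.δ ≤ ((univ.filter fun t' => t' ≠ t).filter
    fun t' => x.land G ρ t' = v).card with hA
  have hAc : (A.card : ℝ) ≤ (Fintype.card V * p.c : ℕ) / p.δ := by
    rw [le_div_iff₀ (by positivity), ← card_token (V := V) (p := p)]
    exact_mod_cast (card_filter_mul_le _ (x.land G ρ) p.δ).trans (Finset.card_le_univ _)
  refine le_trans (unifProb_mono fun y hy => ?_) ((x.unifProb_land_mem_le hG hact ρ A).trans
    (mul_le_mul_of_nonneg_right hAc mixBound_nonneg))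
  simp only [Config.next, Bool.and_eq_true, decide_eq_true_eq] at hy
  set v := x.land G (Function.update ρ t y) t with hv
  simp only [hA, mem_filter, mem_univ, true_and]
  have hsub : (univ.filter fun t' => x.land G (Function.update ρ t y) t' = v) ⊆
      insert t ((univ.filter fun t' => t' ≠ t).filter fun t' => x.land G ρ t' = v) := by
    intro t' ht'
    by_cases h : t' = t
    · simp [h]
    · simp only [mem_insert, mem_filter, mem_univ, true_and, h, false_or, not_false_eq_true, ne_eq]
      rw [← (mem_filter.1 ht').2, x.land_update_of_ne G ρ h]
  have := (Finset.card_le_card hsub).trans (Finset.card_insert_le _ _)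
  omega

/-- An enumeration of the tokens. The walks of a phase are revealed in this order. -/
noncomputable def rank (t : Token V p) : ℕ := Fintype.equivFin (Token V p) t

omit [LinearOrder V] in
theorem rank_injective : Function.Injective (rank : Token V p → ℕ) := fun _ _ h =>
  (Fintype.equivFin (Token V p)).injective (Fin.ext h)

/-- The tokens that count as present when the walk of `t` is revealed: those that are inactive, and
those whose walk has been revealed already. -/
noncomputable def Config.before (x : Config V p) (t : Token V p) : Finset (Token V p) :=
  univ.filter fun t' => t' ≠ t ∧ (x.act t' = false ∨ rank t' < rank t)

/-- A token is late if, when its walk is revealed, it arrives at a node that already holds at least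
`δ / 2` tokens. -/
def Config.Late (G : RegularMultigraph V Δ) (x : Config V p)
    (ρ : Token V p → Fin p.len → Fin Δ) (t : Token V p) : Prop :=
  p.δ ≤ 2 * ((x.before t).filter fun t' => x.land G ρ t' = x.land G ρ t).card

open Classical in
/-- At least half of the tokens that are rejected at a node are late. -/
theorem Config.numActive_next_le (G : RegularMultigraph V Δ) (x : Config V p)
    (ρ : Token V p → Fin p.len → Fin Δ) :
    (x.next G ρ).numActive ≤
      2 * ((univ.filter fun t => x.act t = true).filter fun t => x.Late G ρ t).card := by
  rw [Config.numActive, Finset.card_eq_sum_card_fiberwise (f := x.land G ρ) (t := univ)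
    (fun _ _ => by simp), Finset.card_eq_sum_card_fiberwise (f := x.land G ρ) (t := univ)
    (s := (univ.filter fun t => x.act t = true).filter fun t => x.Late G ρ t)
    (fun _ _ => by simp), Finset.mul_sum]
  refine Finset.sum_le_sum fun v _ => ?_
  by_cases hv : p.δ < (univ.filter fun t => x.land G ρ t = v).card
  swap
  · rw [Finset.card_eq_zero.2]
    · omega
    · rw [Finset.filter_eq_empty_iff]
      intro t ht htv
      simp only [mem_filter, mem_univ, true_and, Config.next, Bool.and_eq_true,
        decide_eq_true_eq] at ht
      rw [htv] at ht
      exact hv ht.2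
  set A := univ.filter fun t => x.act t = true ∧ x.land G ρ t = v with hA
  set I := univ.filter fun t => x.act t = false ∧ x.land G ρ t = v with hI
  have hAI : (univ.filter fun t => x.land G ρ t = v).card = A.card + I.card := by
    rw [← Finset.card_union_of_disjoint]
    · congr 1
      ext t
      simp only [hA, hI, mem_filter, mem_univ, true_and, mem_union]
      cases x.act t <;> simp
    · rw [Finset.disjoint_filter]
      intro t _ h1 h2
      rw [h1.1] at h2
      exact absurd h2.1 (by simp)
  have hsplit := Finset.card_filter_add_card_filter_not (s := A) (fun t => x.Late G ρ t)
  -- Tokens that are not late arrive among the first `δ / 2` tokens of the node.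
  have hnot : 2 * (I.card + (A.filter fun t => ¬ x.Late G ρ t).card) ≤ p.δ + 1 ∨
      (A.filter fun t => ¬ x.Late G ρ t).card = 0 := by
    rcases (A.filter fun t => ¬ x.Late G ρ t).eq_empty_or_nonempty with he | hne
    · right; rw [he]; rfl
    left
    obtain ⟨t, ht, hmax⟩ := (A.filter fun t => ¬ x.Late G ρ t).exists_max_image rank hne
    set NL := A.filter fun t => ¬ x.Late G ρ t with hNL
    have htA := mem_filter.1 ht
    have htA' : x.act t = true ∧ x.land G ρ t = v := by simpa [hA] using htA.1
    have hsub : I ∪ NL.erase t ⊆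
        (x.before t).filter fun t' => x.land G ρ t' = x.land G ρ t := by
      intro t' ht'
      rw [htA'.2]
      simp only [Config.before, mem_filter, mem_univ, true_and]
      rcases mem_union.1 ht' with h | h
      · have h' : x.act t' = false ∧ x.land G ρ t' = v := by simpa [hI] using h
        refine ⟨⟨fun he => ?_, Or.inl h'.1⟩, h'.2⟩
        rw [he, htA'.1] at h'
        exact absurd h'.1 (by simp)
      · obtain ⟨hne', hmem⟩ := mem_erase.1 h
        have h' : x.act t' = true ∧ x.land G ρ t' = v := by
          simpa [hA] using (mem_filter.1 hmem).1
        refine ⟨⟨hne', Or.inr (lt_of_le_of_ne (hmax t' hmem) fun he => hne' ?_)⟩, h'.2⟩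
        exact rank_injective he
    have hdisj : Disjoint I (NL.erase t) := by
      rw [Finset.disjoint_left]
      intro t' h1 h2
      have h1' : x.act t' = false ∧ x.land G ρ t' = v := by simpa [hI] using h1
      have h2' : x.act t' = true ∧ x.land G ρ t' = v := by
        simpa [hA] using (mem_filter.1 (mem_of_mem_erase h2)).1
      rw [h1'.1] at h2'
      exact absurd h2'.1 (by simp)
    have h1 := Finset.card_le_card hsub
    rw [Finset.card_union_of_disjoint hdisj, Finset.card_erase_of_mem ht] at h1
    have h2 := htA.2
    have h3 := Finset.card_pos.2 ⟨t, ht⟩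
    unfold Config.Late at h2
    omega
  have hle : ((univ.filter fun t => (x.next G ρ).act t = true).filter
      fun t => x.land G ρ t = v).card ≤ A.card := by
    refine Finset.card_le_card fun t ht => ?_
    simp only [mem_filter, mem_univ, true_and] at ht
    have h1 := ht.1
    simp only [Config.next, Bool.and_eq_true] at h1
    simp only [hA, mem_filter, mem_univ, true_and]
    exact ⟨h1.1, ht.2⟩
  have heq : ((univ.filter fun t => x.act t = true).filter fun t => x.Late G ρ t).filter
      (fun t => x.land G ρ t = v) = A.filter fun t => x.Late G ρ t := by
    ext t
    simp only [hA, mem_filter, mem_univ, true_and]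
    tauto
  rw [heq]
  omega

/-- Whether a token is late does not depend on the walks that are revealed after its own. -/
theorem Config.late_update_iff (G : RegularMultigraph V Δ) (x : Config V p)
    (ρ : Token V p → Fin p.len → Fin Δ) {t t' : Token V p} (ht : x.act t = true)
    (hne : t' ≠ t) (hr : rank t' ≤ rank t) (y : Fin p.len → Fin Δ) :
    x.Late G (Function.update ρ t y) t' ↔ x.Late G ρ t' := by
  unfold Config.Late
  rw [x.land_update_of_ne G ρ hne]
  have : (x.before t').filter (fun s => x.land G (Function.update ρ t y) s = x.land G ρ t')
      = (x.before t').filter fun s => x.land G ρ s = x.land G ρ t' := by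
    refine Finset.filter_congr fun s hs => ?_
    rw [x.land_update_of_ne G ρ]
    rintro rfl
    simp only [Config.before, mem_filter, mem_univ, true_and] at hs
    rcases hs.2 with h | h
    · rw [ht] at h; exact absurd h (by simp)
    · omega
  rw [this]

theorem Config.unifProb_late_le [Nonempty (Fin Δ)] {G : RegularMultigraph V Δ}
    (hG : G.MixedAfter p.len) (hδ : 0 < p.δ) (x : Config V p) {t : Token V p}
    (ht : x.act t = true) (ρ : Token V p → Fin p.len → Fin Δ) :
    unifProb (fun y => x.Late G (Function.update ρ t y) t)
      ≤ 2 * (Fintype.card V * p.c : ℕ) / p.δ * mixBound V := by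
  set A := univ.filter fun v => p.δ ≤ 2 * ((x.before t).filter
    fun t' => x.land G ρ t' = v).card with hA
  have hAc : (A.card : ℝ) ≤ 2 * (Fintype.card V * p.c : ℕ) / p.δ := by
    rw [le_div_iff₀ (by positivity), ← card_token (V := V) (p := p)]
    have h1 : A.card * p.δ ≤ 2 * (x.before t).card := by
      calc A.card * p.δ = ∑ v ∈ A, p.δ := by rw [Finset.sum_const, smul_eq_mul]
        _ ≤ ∑ v ∈ A, 2 * ((x.before t).filter fun t' => x.land G ρ t' = v).card :=
            Finset.sum_le_sum fun v hv => (mem_filter.1 hv).2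
        _ ≤ ∑ v, 2 * ((x.before t).filter fun t' => x.land G ρ t' = v).card :=
            Finset.sum_le_sum_of_subset (Finset.subset_univ _)
        _ = 2 * (x.before t).card := by
            rw [← Finset.mul_sum, ← Finset.card_eq_sum_card_fiberwise (fun _ _ => by simp)]
    exact_mod_cast h1.trans (Nat.mul_le_mul_left _ (Finset.card_le_univ _))
  refine le_trans (unifProb_mono fun y hy => ?_) ((x.unifProb_land_mem_le hG ht ρ A).trans
    (mul_le_mul_of_nonneg_right hAc mixBound_nonneg))
  simp only [hA, mem_filter, mem_univ, true_and]
  refine le_trans hy (Nat.mul_le_mul_left _ (Finset.card_le_card fun t' ht' => ?_))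
  simp only [mem_filter] at ht' ⊢
  refine ⟨ht'.1, ?_⟩
  rw [← ht'.2, x.land_update_of_ne G ρ]
  have := ht'.1
  simp only [Config.before, mem_filter] at this
  exact this.2.1

/-- A Chernoff bound for the number of active tokens that are rejected, through the number of late
tokens. -/
theorem Config.unifProb_numActive_next_le [Nonempty (Fin Δ)] {G : RegularMultigraph V Δ}
    (hG : G.MixedAfter p.len) (hδ : 0 < p.δ) (x : Config V p) {z : ℝ} (hz : 1 ≤ z)
    (hq : z * (2 * (Fintype.card V * p.c : ℕ) / p.δ * mixBound V) ≤ 1) (m : ℕ) :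
    unifProb (fun ρ => 2 * m ≤ (x.next G ρ).numActive + 1) ≤ Real.exp x.numActive / z ^ m := by
  classical
  set q := 2 * (Fintype.card V * p.c : ℕ) / p.δ * mixBound V with hqdef
  have hq0 : 0 ≤ q := mul_nonneg (by positivity) mixBound_nonneg
  have h := expect_pow_card_le rank
    (fun t (ρ : Token V p → Fin p.len → Fin Δ) => x.Late G ρ t)
    (fun _ => q) (univ.filter fun t => x.act t = true) hz
    (fun t ht t' _ hne hr ρ y => x.late_update_iff G ρ (by simpa using ht) hne hr y)
    (fun t ht ρ => x.unifProb_late_le hG hδ (by simpa using ht) ρ)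
  have h2 : ∏ t ∈ univ.filter (fun t => x.act t = true), (1 + (z - 1) * q)
      ≤ Real.exp x.numActive := by
    rw [Finset.prod_const, ← mul_one (x.numActive : ℝ), Real.exp_nat_mul]
    refine pow_le_pow_left₀ ?_ ?_ _
    · have := mul_nonneg (sub_nonneg.2 hz) hq0
      linarith
    · exact (one_add_mul_le_exp hq0).trans (Real.exp_le_exp.2 hq)
  refine le_trans (unifProb_mono fun ρ hρ => ?_) (unifProb_le_of_expect_pow_le hz (h.trans h2) m)
  have := x.numActive_next_le G ρ
  omega

end Walk

section Phases

open scoped BigOperators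

variable {V : Type*} [Fintype V] [LinearOrder V] {p : Params} {Δ : ℕ}

/-! ### All phases: congestion and rejections -/

theorem config_succ (G : RegularMultigraph V Δ) (ω : Choices V p Δ) (k : Fin p.phases) :
    config G ω (k + 1) = (config G ω k).next G (ω k) := by
  simp [config]

theorem config_update_of_le (G : RegularMultigraph V Δ) (ω : Choices V p Δ) (k : Fin p.phases)
    (ρ : Token V p → Fin p.len → Fin Δ) {j : ℕ} (hj : j ≤ k) :
    config G (Function.update ω k ρ) j = config G ω j := by
  induction j with
  | zero => rfl
  | succ j ih =>
    simp only [config, ih (by omega)]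
    split_ifs with h
    · rw [Function.update_of_ne]
      intro he
      rw [← he] at hj
      simp at hj
    · rfl

theorem act_of_act_config (G : RegularMultigraph V Δ) (ω : Choices V p Δ) (t : Token V p)
    {k k' : ℕ} (hk : k ≤ k') (h : (config G ω k').act t = true) : (config G ω k).act t = true := by
  induction k' with
  | zero => rwa [Nat.le_zero.1 hk]
  | succ k' ih =>
    rcases Nat.lt_or_ge k' k with h' | h'
    · have : k = k' + 1 := by omega
      rwa [this]
    · refine ih h' ?_
      simp only [config] at h
      split_ifs at h
      · simp only [Config.next, Bool.and_eq_true] at h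
        exact h.1
      · exact h

theorem pos_config_of_inactive (G : RegularMultigraph V Δ) (ω : Choices V p Δ) (t : Token V p)
    {k k' : ℕ} (hk : k ≤ k') (h : (config G ω k).act t = false) :
    (config G ω k').pos t = (config G ω k).pos t := by
  induction k', hk using Nat.le_induction with
  | base => rfl
  | succ k' hk' ih =>
    have h' : ¬ (config G ω k').act t = true := by
      intro h'
      rw [act_of_act_config G ω t hk' h'] at h
      exact absurd h (by simp)
    simp only [config]
    split_ifs
    · simpa [Config.next, Config.land, h'] using ih
    · exact ih

theorem numActive_le_of_le (G : RegularMultigraph V Δ) (ω : Choices V p Δ) {k k' : ℕ}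
    (hk : k ≤ k') : (config G ω k').numActive ≤ (config G ω k).numActive := by
  refine Finset.card_le_card fun t ht => ?_
  simp only [mem_filter, mem_univ, true_and] at ht ⊢
  exact act_of_act_config G ω t hk ht

theorem Config.activeLoad_next_le (G : RegularMultigraph V Δ) (x : Config V p)
    (ρ : Token V p → Fin p.len → Fin Δ) (v : V) :
    (x.next G ρ).activeLoad v ≤ x.walkLoad G ρ p.len v := by
  refine Finset.card_le_card fun t ht => ?_
  simp only [mem_filter, mem_univ, true_and] at ht ⊢
  have h1 := ht.1
  simp only [Config.next, Bool.and_eq_true] at h1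
  refine ⟨h1.1, ?_⟩
  have h2 := ht.2
  simpa [Config.next, Config.land, h1.1] using h2

/-- The tokens that are active at a node at the start of a phase are those whose walks ended there in
the preceding phase. -/
theorem activeLoad_config_le {G : RegularMultigraph V Δ} {ω : Choices V p Δ} {s : ℕ}
    (hc : p.c ≤ s)
    (h : ∀ (k : Fin p.phases) (v : V), (config G ω k).walkLoad G (ω k) p.len v ≤ s)
    (k : ℕ) (v : V) : (config G ω k).activeLoad v ≤ s := by
  induction k with
  | zero =>
    refine le_trans ?_ hc
    calc _ ≤ (univ.image fun j : Fin p.c => ((v, j) : Token V p)).card := by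
          refine Finset.card_le_card fun t ht => ?_
          simp only [config, mem_filter, mem_univ, true_and] at ht
          exact mem_image.2 ⟨t.2, mem_univ _, Prod.ext ht.symm rfl⟩
      _ ≤ _ := Finset.card_image_le.trans (by simp)
  | succ k ih =>
    by_cases hk : k < p.phases
    · rw [config_succ G ω ⟨k, hk⟩]
      exact (Config.activeLoad_next_le G _ _ v).trans (h ⟨k, hk⟩ v)
    · simpa [config, hk] using ih

/-- The number of active tokens decays geometrically until it drops below `M`. -/
theorem numActive_config_le {G : RegularMultigraph V Δ} {ω : Choices V p Δ} {ε M : ℝ}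
    (hε : 0 ≤ ε)
    (h : ∀ k : Fin p.phases, ¬ (M ≤ (config G ω k).numActive ∧
      ε * (config G ω k).numActive ≤ (config G ω (k + 1)).numActive))
    {k : ℕ} (hk : k ≤ p.phases) :
    ((config G ω k).numActive : ℝ) ≤ max (ε ^ k * (Fintype.card V * p.c : ℕ)) M := by
  induction k with
  | zero =>
    refine le_max_of_le_left ?_
    rw [pow_zero, one_mul, ← card_token (V := V) (p := p)]
    exact_mod_cast Finset.card_le_univ _
  | succ k ih =>
    have ih := ih (by omega)
    have hk' : k < p.phases := hk
    by_cases hM : M ≤ (config G ω k).numActive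
    · have h1 : ((config G ω (k + 1)).numActive : ℝ) < ε * (config G ω k).numActive := by
        by_contra h'
        exact h ⟨k, hk'⟩ ⟨hM, not_lt.1 h'⟩
      rcases le_max_iff.1 ih with h2 | h2
      · refine le_max_of_le_left (h1.le.trans ?_)
        rw [pow_succ', mul_assoc]
        exact mul_le_mul_of_nonneg_left h2 hε
      · refine le_max_of_le_right (le_trans ?_ h2)
        exact_mod_cast numActive_le_of_le G ω (Nat.le_succ k)
    · refine le_max_of_le_right (le_trans ?_ (not_le.1 hM).le)
      exact_mod_cast numActive_le_of_le G ω (Nat.le_succ k)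

variable [Nonempty (Fin Δ)]

/-- What holds for a phase from every configuration holds for phase `k`: its random choices are
independent of the configuration at its start. -/
theorem unifProb_phase_le (G : RegularMultigraph V Δ) (k : Fin p.phases)
    (E : Config V p → (Token V p → Fin p.len → Fin Δ) → Prop) {w : ℝ}
    (h : ∀ x, unifProb (E x) ≤ w) :
    unifProb (fun ω : Choices V p Δ => E (config G ω k) (ω k)) ≤ w := by
  refine unifProb_le_of_update k fun ω => ?_
  simp only [config_update_of_le G ω k _ le_rfl, Function.update_self]
  exact h _

/-- A token survives all phases with exponentially small probability. -/
theorem unifProb_act_le {G : RegularMultigraph V Δ} (hG : G.MixedAfter p.len) (hδ : 0 < p.δ)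
    (t : Token V p) :
    unifProb (fun ω : Choices V p Δ => (config G ω p.phases).act t = true)
      ≤ ((Fintype.card V * p.c : ℕ) / p.δ * mixBound V) ^ p.phases := by
  classical
  set r := ((Fintype.card V * p.c : ℕ) / p.δ * mixBound V : ℝ) with hr
  have h := expect_prod_le (fun k : Fin p.phases => (k : ℕ))
    (fun k (ω : Choices V p Δ) => if (config G ω (k + 1)).act t = true then (1 : ℝ) else 0)
    (fun _ => r) univ (fun k ω => by split_ifs <;> norm_num)
    (fun i _ j _ hne hji ω y => by
      have : (j : ℕ) < i := lt_of_le_of_ne hji fun h => hne (Fin.ext h)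
      simp only [config_update_of_le G ω i y (Nat.succ_le_of_lt this)])
    (fun k _ ω => by
      simp only [config_succ, config_update_of_le G ω k _ le_rfl, Function.update_self]
      refine le_trans (le_of_eq ?_) ((config G ω k).unifProb_act_next_le hG hδ t)
      unfold unifProb
      exact Finset.expect_congr rfl fun ρ _ => by congr)
  simp only [Finset.prod_const, Finset.card_univ, Fintype.card_fin] at h
  refine le_trans ?_ h
  unfold unifProb
  refine Finset.expect_le_expect fun ω _ => ?_
  by_cases hact : (config G ω p.phases).act t = true
  · rw [if_pos hact, Finset.prod_eq_one]
    intro k _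
    rw [if_pos (act_of_act_config G ω t (by omega) hact)]
  · rw [if_neg hact]
    exact Finset.prod_nonneg fun k _ => by split_ifs <;> norm_num

/-- If no node starts a phase with more than `s` active tokens, it is unlikely that many more walks
are at the same node after the same number of steps. -/
theorem unifProb_congested_le (G : RegularMultigraph V Δ) (k : Fin p.phases) {s j : ℕ}
    (hj : j ≤ p.len) (v : V) (m : ℕ) :
    unifProb (fun ω : Choices V p Δ => (∀ u, (config G ω k).activeLoad u ≤ s) ∧
      m ≤ (config G ω k).walkLoad G (ω k) j v) ≤ Real.exp (3 * s - m) := by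
  refine unifProb_phase_le G k (fun x ρ => (∀ u, x.activeLoad u ≤ s) ∧ m ≤ x.walkLoad G ρ j v)
    fun x => ?_
  by_cases hs : ∀ u, x.activeLoad u ≤ s
  · refine le_trans (unifProb_mono fun ρ hρ => hρ.2) (x.unifProb_walkLoad_le G hj v
      (x.sum_walkMatrix_pow_le G ?_ hs j v) m)
    exact Fin.pos (Classical.arbitrary (Fin Δ))
  · rw [unifProb_false (fun ρ hρ => hs hρ.1)]
    exact (Real.exp_pos _).le

/-- The bound on the number of walks that end at `v` does not depend on the configuration at the start
of the phase, so that congestion does not build up from phase to phase. -/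
theorem unifProb_endLoad_le {G : RegularMultigraph V Δ} (hG : G.MixedAfter p.len)
    (k : Fin p.phases) (v : V) (m : ℕ) :
    unifProb (fun ω : Choices V p Δ => m ≤ (config G ω k).walkLoad G (ω k) p.len v)
      ≤ Real.exp (3 * ((Fintype.card V * p.c : ℕ) * mixBound V) - m) :=
  unifProb_phase_le G k (fun x ρ => m ≤ x.walkLoad G ρ p.len v) fun x =>
    x.unifProb_walkLoad_le G le_rfl v (x.sum_walkMatrix_len_le hG v) m

/-- It is unlikely that at least a fraction `ε` of at least `M` active tokens is rejected in a
phase. -/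
theorem unifProb_numActive_le {G : RegularMultigraph V Δ} (hG : G.MixedAfter p.len)
    (hδ : 0 < p.δ) (k : Fin p.phases) {θ ε : ℝ} (hθ : 0 ≤ θ) (hθε : 4 ≤ θ * ε)
    (hq : Real.exp θ * (2 * (Fintype.card V * p.c : ℕ) / p.δ * mixBound V) ≤ 1) {M : ℝ} :
    unifProb (fun ω : Choices V p Δ => M ≤ (config G ω k).numActive ∧
      ε * (config G ω k).numActive ≤ (config G ω (k + 1)).numActive) ≤ Real.exp (-M) := by
  simp only [config_succ]
  refine unifProb_phase_le G k (fun x ρ => M ≤ x.numActive ∧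
    ε * x.numActive ≤ (x.next G ρ).numActive) fun x => ?_
  by_cases hM : M ≤ x.numActive
  swap
  · rw [unifProb_false (fun ρ hρ => hM hρ.1)]
    exact (Real.exp_pos _).le
  set m := ⌈ε * x.numActive / 2⌉₊ with hm
  have h := x.unifProb_numActive_next_le hG hδ (Real.one_le_exp hθ) hq m
  refine le_trans (unifProb_mono fun ρ hρ => ?_) (h.trans ?_)
  · have h1 : m ≤ ((x.next G ρ).numActive + 1) / 2 := by
      refine Nat.ceil_le.2 ?_
      have h2 : (x.next G ρ).numActive ≤ 2 * (((x.next G ρ).numActive + 1) / 2) := by omega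
      have h3 : ((x.next G ρ).numActive : ℝ) ≤
        2 * ((((x.next G ρ).numActive + 1) / 2 : ℕ) : ℝ) := by exact_mod_cast h2
      linarith [hρ.2]
    omega
  · rw [← Real.exp_nat_mul, ← Real.exp_sub]
    refine Real.exp_le_exp.2 ?_
    have h1 : ε * x.numActive / 2 ≤ m := Nat.le_ceil _
    have h2 : (0 : ℝ) ≤ x.numActive := Nat.cast_nonneg _
    nlinarith

end Phases

/-! ### Wasted walks -/

section Wasted

open scoped BigOperators

variable {V : Type*} [Fintype V] [LinearOrder V] {p : Params} {Δ : ℕ}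

/-- The position of `t'` that is known when the walk of `t` is revealed. -/
noncomputable def Config.current (G : RegularMultigraph V Δ) (x : Config V p)
    (ρ : Token V p → Fin p.len → Fin Δ) (t t' : Token V p) : V :=
  if rank t' < rank t then x.land G ρ t' else x.pos t'

/-- With respect to a set `S` of nodes, the walk of an active token is wasted if it ends in `S` or at
a node where another token of the same source is known to be: an edge created because of this token
need not leave `S`, or might be counted twice. -/
def Config.Wasted (G : RegularMultigraph V Δ) (x : Config V p)
    (ρ : Token V p → Fin p.len → Fin Δ) (S : Finset V) (t : Token V p) : Prop :=
  x.act t = true ∧ (x.land G ρ t ∈ S ∨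
    ∃ j, j ≠ t.2 ∧ x.land G ρ t = x.current G ρ t (t.1, j))

theorem Config.current_update (G : RegularMultigraph V Δ) (x : Config V p)
    (ρ : Token V p → Fin p.len → Fin Δ) {t t' : Token V p} (hr : rank t' ≤ rank t)
    (s : Token V p) (y : Fin p.len → Fin Δ) :
    x.current G (Function.update ρ t y) t' s = x.current G ρ t' s := by
  unfold Config.current
  split_ifs with h
  · exact x.land_update_of_ne G ρ (fun he => by rw [he] at h; omega) y
  · rfl

/-- Whether a walk is wasted does not depend on the walks that are revealed after it. -/
theorem Config.wasted_update_iff (G : RegularMultigraph V Δ) (x : Config V p)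
    (ρ : Token V p → Fin p.len → Fin Δ) (S : Finset V) {t t' : Token V p} (hne : t' ≠ t)
    (hr : rank t' ≤ rank t) (y : Fin p.len → Fin Δ) :
    x.Wasted G (Function.update ρ t y) S t' ↔ x.Wasted G ρ S t' := by
  unfold Config.Wasted
  simp only [x.land_update_of_ne G ρ hne, x.current_update G ρ hr]

variable [Nonempty (Fin Δ)]

theorem Config.unifProb_wasted_le {G : RegularMultigraph V Δ}
    (hG : G.MixedAfter p.len) (x : Config V p) (S : Finset V) (t : Token V p)
    (ρ : Token V p → Fin p.len → Fin Δ) :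
    unifProb (fun y => x.Wasted G (Function.update ρ t y) S t)
      ≤ (S.card + p.c : ℕ) * mixBound V := by
  by_cases ht : x.act t = true
  swap
  · rw [unifProb_false (fun y hy => ht hy.1)]
    exact mul_nonneg (by positivity) mixBound_nonneg
  set A := S ∪ univ.image fun j => x.current G ρ t (t.1, j) with hA
  have hAc : A.card ≤ S.card + p.c :=
    (Finset.card_union_le _ _).trans (Nat.add_le_add_left (Finset.card_image_le.trans (by simp)) _)
  refine le_trans (unifProb_mono fun y hy => ?_) ((x.unifProb_land_mem_le hG ht ρ A).trans
    (mul_le_mul_of_nonneg_right (by exact_mod_cast hAc) mixBound_nonneg))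
  rcases hy.2 with h | ⟨j, -, h⟩
  · exact mem_union_left _ h
  · refine mem_union_right _ (mem_image.2 ⟨j, mem_univ _, ?_⟩)
    rw [h, x.current_update G ρ le_rfl]

open Classical in
/-- The number of wasted walks of tokens generated in `S` in a phase. -/
noncomputable def Config.numWasted (G : RegularMultigraph V Δ) (x : Config V p)
    (ρ : Token V p → Fin p.len → Fin Δ) (S : Finset V) : ℕ :=
  ((S ×ˢ univ).filter fun t => x.Wasted G ρ S t).card

/-- The number of wasted walks of tokens generated in `S` in the first `k` phases. -/
noncomputable def totalWasted (G : RegularMultigraph V Δ) (ω : Choices V p Δ) (S : Finset V)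
    (k : ℕ) : ℕ :=
  ∑ i ∈ univ.filter (fun i : Fin p.phases => (i : ℕ) < k), (config G ω i).numWasted G (ω i) S

/-- A Chernoff bound for the number of wasted walks. -/
theorem unifProb_totalWasted_le {G : RegularMultigraph V Δ} (hG : G.MixedAfter p.len)
    (S : Finset V) (k : ℕ) {z : ℝ} (hz : 1 ≤ z) (m : ℕ) :
    unifProb (fun ω : Choices V p Δ => m ≤ totalWasted G ω S k) ≤
      (1 + (z - 1) * ((S.card + p.c : ℕ) * mixBound V)) ^ (k * (S.card * p.c)) / z ^ m := by
  classical
  set w := (S.card + p.c : ℕ) * mixBound V with hw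
  have hw0 : 0 ≤ w := mul_nonneg (by positivity) mixBound_nonneg
  have hb : 1 ≤ 1 + (z - 1) * w := by
    have := mul_nonneg (sub_nonneg.2 hz) hw0
    linarith
  refine unifProb_le_of_expect_pow_le hz ?_ m
  have h := expect_prod_le (fun k : Fin p.phases => (k : ℕ))
    (fun i (ω : Choices V p Δ) => z ^ (config G ω i).numWasted G (ω i) S)
    (fun _ => (1 + (z - 1) * w) ^ (S.card * p.c))
    (univ.filter fun i : Fin p.phases => (i : ℕ) < k)
    (fun i ω => by positivity)
    (fun i _ j _ hne hji ω y => by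
      simp only [config_update_of_le G ω i y hji, Function.update_of_ne hne])
    (fun i _ ω => by
      simp only [config_update_of_le G ω i _ le_rfl, Function.update_self]
      have h1 := expect_pow_card_le rank
        (fun t (ρ : Token V p → Fin p.len → Fin Δ) => (config G ω i).Wasted G ρ S t)
        (fun _ => w) (S ×ˢ univ) hz
        (fun t _ t' _ hne hr ρ y => (config G ω i).wasted_update_iff G ρ S hne hr y)
        (fun t _ ρ => (config G ω i).unifProb_wasted_le hG S t ρ)
      simp only [Finset.prod_const, Finset.card_product, Finset.card_univ, Fintype.card_fin] at h1
      exact h1)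
  simp only [Finset.prod_const, Finset.prod_pow_eq_pow_sum, ← pow_mul] at h
  refine h.trans (pow_le_pow_right₀ hb ?_)
  rw [mul_comm]
  refine Nat.mul_le_mul_right _ ?_
  calc _ ≤ (range k).card := Finset.card_le_card_of_injOn (fun i : Fin p.phases => (i : ℕ))
        (fun i hi => by simpa using hi) (fun i _ j _ h => Fin.ext h)
    _ = k := card_range k

end Wasted

section Expansion

variable {V : Type*} [Fintype V] [LinearOrder V] {p : Params} {Δ : ℕ}

/-- Inactive tokens generated in `S` none of whose walks was wasted are outside of `S`, and those of
the same source are at different nodes. -/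
theorem pos_of_not_wasted (G : RegularMultigraph V Δ) (ω : Choices V p Δ) (S : Finset V) (k : ℕ) :
    ∀ t, (config G ω k).act t = false →
      (∀ i : Fin p.phases, (i : ℕ) < k → ¬ (config G ω i).Wasted G (ω i) S t) →
      (config G ω k).pos t ∉ S ∧ ∀ j, j ≠ t.2 → (config G ω k).act (t.1, j) = false →
        (∀ i : Fin p.phases, (i : ℕ) < k → ¬ (config G ω i).Wasted G (ω i) S (t.1, j)) →
        (config G ω k).pos t ≠ (config G ω k).pos (t.1, j) := by
  induction k with
  | zero => intro t ht; simp [config] at ht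
  | succ k ih =>
    intro t ht hw
    by_cases hk : k < p.phases
    swap
    · have hc : config G ω (k + 1) = config G ω k := by simp [config, hk]
      rw [hc] at ht ⊢
      have := ih t ht fun i hi => hw i (by omega)
      exact ⟨this.1, fun j hj hact hw' => this.2 j hj hact fun i hi => hw' i (by omega)⟩
    have hc := config_succ G ω ⟨k, hk⟩
    simp only at hc
    rw [hc] at ht ⊢
    set x := config G ω k with hx
    set ρ := ω ⟨k, hk⟩ with hρ
    have hpos : (x.next G ρ).pos = x.land G ρ := rfl
    rw [hpos]
    have hland : ∀ s, x.act s = false → x.land G ρ s = x.pos s := fun s hs => by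
      simp [Config.land, hs]
    -- A token whose walk in this phase is not wasted avoids the nodes known to be occupied.
    have hnew : ∀ s, x.act s = true → ¬ x.Wasted G ρ S s →
        x.land G ρ s ∉ S ∧ ∀ j, j ≠ s.2 → x.land G ρ s ≠ x.current G ρ s (s.1, j) := by
      intro s hs hns
      simp only [Config.Wasted, hs, true_and, not_or, not_exists, not_and] at hns
      exact hns
    have hcur : ∀ s s', x.act s' = false → x.current G ρ s s' = x.land G ρ s' := by
      intro s s' hs'
      rw [Config.current, hland s' hs', ite_self]
    constructor
    · by_cases hact : x.act t = true
      · exact (hnew t hact (hw ⟨k, hk⟩ (Nat.lt_succ_self k))).1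
      · rw [hland t (by simpa using hact)]
        exact (ih t (by simpa using hact) fun i hi => hw i (by omega)).1
    · intro j hj hjact hw'
      have ht1 := hw ⟨k, hk⟩ (Nat.lt_succ_self k)
      have hj1 := hw' ⟨k, hk⟩ (Nat.lt_succ_self k)
      by_cases hact : x.act t = true <;> by_cases hact' : x.act (t.1, j) = true
      · rcases lt_or_gt_of_ne (fun h : rank (t.1, j) = rank t =>
          hj (congrArg Prod.snd (rank_injective h))) with hr | hr
        · have := (hnew t hact ht1).2 j hj
          rwa [Config.current, if_pos hr] at this
        · have := (hnew (t.1, j) hact' hj1).2 t.2 hj.symm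
          rw [Config.current, if_pos hr] at this
          exact this.symm
      · have := (hnew t hact ht1).2 j hj
        rwa [hcur _ _ (by simpa using hact')] at this
      · have := (hnew (t.1, j) hact' hj1).2 t.2 hj.symm
        rw [hcur _ _ (by simpa using hact)] at this
        exact this.symm
      · have h1 : x.act t = false := by simpa using hact
        have h2 : x.act (t.1, j) = false := by simpa using hact'
        rw [hland _ h1, hland _ h2]
        exact (ih t h1 fun i hi => hw i (by omega)).2 j hj h2 fun i hi => hw' i (by omega)

/-- Tokens generated in `S` that are neither active after `k` phases nor wasted before provide
distinct edges that leave `S`. -/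
theorem exists_good_tokens (G : RegularMultigraph V Δ) (ω : Choices V p Δ) (S : Finset V) {k : ℕ}
    (hk : k ≤ p.phases) : ∃ D : Finset (Token V p), D ⊆ S ×ˢ univ ∧
      S.card * p.c ≤ D.card + (config G ω k).numActive + totalWasted G ω S k ∧
      (∀ t ∈ D, (config G ω p.phases).pos t ∉ S) ∧
      Set.InjOn (fun t : Token V p => (t.1, (config G ω p.phases).pos t)) D := by
  classical
  set D := (S ×ˢ (univ : Finset (Fin p.c))).filter fun t => (config G ω k).act t = false ∧
    ∀ i : Fin p.phases, (i : ℕ) < k → ¬ (config G ω i).Wasted G (ω i) S t with hD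
  have hpos : ∀ t ∈ D, (config G ω p.phases).pos t = (config G ω k).pos t := fun t ht =>
    pos_config_of_inactive G ω t hk (mem_filter.1 ht).2.1
  refine ⟨D, Finset.filter_subset _ _, ?_, fun t ht => ?_, fun t ht t' ht' h => ?_⟩
  · have hsub : S ×ˢ (univ : Finset (Fin p.c)) ⊆
        (D ∪ univ.filter fun t => (config G ω k).act t = true) ∪
        (univ.filter fun i : Fin p.phases => (i : ℕ) < k).biUnion fun i =>
          (S ×ˢ univ).filter fun t => (config G ω i).Wasted G (ω i) S t := by
      intro t ht
      by_cases h1 : (config G ω k).act t = true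
      · exact mem_union_left _ (mem_union_right _ (by simp [h1]))
      by_cases h2 : ∀ i : Fin p.phases, (i : ℕ) < k → ¬ (config G ω i).Wasted G (ω i) S t
      · exact mem_union_left _ (mem_union_left _ (mem_filter.2 ⟨ht, by simpa using h1, h2⟩))
      · push Not at h2
        obtain ⟨i, hi, hi'⟩ := h2
        exact mem_union_right _ (mem_biUnion.2 ⟨i, by simp [hi], mem_filter.2 ⟨ht, hi'⟩⟩)
    have h1 := Finset.card_le_card hsub
    rw [Finset.card_product, Finset.card_univ, Fintype.card_fin] at h1
    refine h1.trans ((Finset.card_union_le _ _).trans (Nat.add_le_add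
      (Finset.card_union_le _ _) (Finset.card_biUnion_le.trans (le_of_eq ?_))))
    rfl
  · rw [hpos t ht]
    have := (mem_filter.1 ht).2
    exact (pos_of_not_wasted G ω S k t this.1 this.2).1
  · simp only [Prod.mk.injEq] at h
    have h1 := (mem_filter.1 (mem_coe.1 ht)).2
    have h2 := (mem_filter.1 (mem_coe.1 ht')).2
    by_contra hne
    have hj : t'.2 ≠ t.2 := fun hj => hne (Prod.ext h.1 hj.symm)
    have ht't : t' = (t.1, t'.2) := Prod.ext h.1.symm rfl
    have := (pos_of_not_wasted G ω S k t h1.1 h1.2).2 t'.2 hj (ht't ▸ h2.1) (ht't ▸ h2.2)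
    rw [← ht't, ← hpos t ht, ← hpos t' ht'] at this
    exact this h.2

end Expansion

end DegreeReduction

/-! ### From good tokens to conductance -/

namespace Multigraph

variable {V : Type*} [Fintype V] [DecidableEq V]

theorem cut_compl (H : Multigraph V) (S : Finset V) : H.cut Sᶜ = H.cut S := by
  unfold cut
  rw [compl_compl, Finset.sum_comm]
  exact Finset.sum_congr rfl fun u _ => Finset.sum_congr rfl fun v _ => H.symm v u

theorem vol_eq_cut_add (H : Multigraph V) (S : Finset V) :
    H.vol S = H.cut S + ∑ u ∈ S, ∑ v ∈ S, H.mult u v := by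
  unfold vol cut degree
  rw [← Finset.sum_add_distrib]
  refine Finset.sum_congr rfl fun u _ => ?_
  rw [add_comm, Finset.sum_add_sum_compl]

/-- For the conductance it is enough to consider sets of at most half of the nodes. -/
theorem le_conductance {H : Multigraph V} {φ : ℝ} (hn : 2 ≤ Fintype.card V)
    (h : ∀ S : Finset V, S.Nonempty → 2 * S.card ≤ Fintype.card V →
      0 < H.cut S ∧ φ * H.vol S ≤ H.cut S) (hφ : 0 ≤ φ) : φ ≤ H.conductance := by
  have hne : Nonempty {S : Finset V // S.Nonempty ∧ S ≠ univ} := by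
    obtain ⟨v⟩ : Nonempty V := Fintype.card_pos_iff.1 (by omega)
    refine ⟨⟨{v}, Finset.singleton_nonempty v, fun h' => ?_⟩⟩
    have := congrArg Finset.card h'
    simp at this; omega
  refine le_ciInf fun ⟨S, hS1, hS2⟩ => ?_
  simp only
  have key : ∀ A B : Finset V, H.cut A = H.cut S → H.cut B = H.cut S →
      0 < H.cut A → φ * H.vol A ≤ H.cut A →
      φ ≤ (H.cut S : ℝ) / ((min (H.vol A) (H.vol B) : ℕ) : ℝ) := by
    intro A B hA hB h1 h2
    have hA' := H.vol_eq_cut_add A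
    have hB' := H.vol_eq_cut_add B
    have hpos : 0 < min (H.vol A) (H.vol B) := by rw [lt_min_iff]; omega
    rw [le_div_iff₀ (by exact_mod_cast hpos), ← hA]
    refine le_trans (mul_le_mul_of_nonneg_left ?_ hφ) h2
    exact_mod_cast min_le_left _ _
  by_cases hc : 2 * S.card ≤ Fintype.card V
  · exact key S Sᶜ rfl (H.cut_compl S) (h S hS1 hc).1 (h S hS1 hc).2
  · have hcard : Sᶜ.card = Fintype.card V - S.card := Finset.card_compl S
    have hne' : Sᶜ.Nonempty := by
      rw [Finset.nonempty_iff_ne_empty, Ne, Finset.compl_eq_empty_iff]; exact hS2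
    have h' := h Sᶜ hne' (by omega)
    rw [min_comm]
    exact key Sᶜ S (H.cut_compl S) rfl h'.1 h'.2

end Multigraph

namespace DegreeReduction

section Expansion

variable {V : Type*} [Fintype V] [LinearOrder V] {p : Params} {Δ : ℕ}

/-- If `D` is a set of tokens generated in `S` that are, per source, at different nodes outside of
`S`, then `|D|` edges leave `S`; the remaining tokens generated in `S` account for the edges within
`S`. -/
theorem cut_output {G : RegularMultigraph V Δ} {ω : Choices V p Δ} {M : ℕ}
    (hM : Uncongested G ω M) (hR : M * p.len ≤ p.walkRounds)
    (hT : ∀ t, (config G ω p.phases).act t = false) {S : Finset V} {D : Finset (Token V p)}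
    (hD : D ⊆ S ×ˢ univ) (hpos : ∀ t ∈ D, (config G ω p.phases).pos t ∉ S)
    (hinj : Set.InjOn (fun t : Token V p => (t.1, (config G ω p.phases).pos t)) D) :
    D.card ≤ (output G ω).cut S ∧
      (output G ω).vol S + 2 * D.card ≤ (output G ω).cut S + 2 * (S.card * p.c) := by
  classical
  obtain ⟨-, hl⟩ := mem_links_finalState hM hR hT
  set pos := (config G ω p.phases).pos with hposdef
  have hmult : ∀ u v, (output G ω).mult u v =
      if (∃ j, pos (u, j) = v) ∨ ∃ j, pos (v, j) = u then 1 else 0 := by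
    intro u v
    simp only [output, hl]
  constructor
  · have h1 : (output G ω).cut S = ((S ×ˢ Sᶜ).filter fun e =>
        (∃ j, pos (e.1, j) = e.2) ∨ ∃ j, pos (e.2, j) = e.1).card := by
      rw [Multigraph.cut, ← Finset.sum_product', Finset.card_filter]
      exact Finset.sum_congr rfl fun e _ => hmult _ _
    rw [h1]
    refine Finset.card_le_card_of_injOn (fun t => (t.1, pos t)) (fun t ht => ?_) hinj
    have h2 := hD ht
    simp only [mem_product, mem_univ, and_true] at h2
    simp only [coe_filter, mem_product, mem_compl, Set.mem_ofPred_eq]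
    exact ⟨⟨h2, hpos t ht⟩, Or.inl ⟨t.2, rfl⟩⟩
  · rw [Multigraph.vol_eq_cut_add]
    have hin : ∑ u ∈ S, ∑ v ∈ S, (univ.filter fun j => pos (u, j) = v).card
        = ((S ×ˢ univ).filter fun t => pos t ∈ S).card := by
      rw [Finset.card_filter, Finset.sum_product]
      refine Finset.sum_congr rfl fun u _ => ?_
      simp only [Finset.card_filter]
      rw [Finset.sum_comm]
      exact Finset.sum_congr rfl fun j _ => by simp
    have hcard : ((S ×ˢ univ).filter fun t => pos t ∈ S).card + D.card ≤ S.card * p.c := by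
      rw [← Finset.card_union_of_disjoint]
      · refine (Finset.card_le_card (Finset.union_subset (Finset.filter_subset _ _) hD)).trans ?_
        simp
      · rw [Finset.disjoint_left]
        exact fun t h1 h2 => hpos t h2 (mem_filter.1 h1).2
    have hle : ∑ u ∈ S, ∑ v ∈ S, (output G ω).mult u v ≤
        ((S ×ˢ univ).filter fun t => pos t ∈ S).card +
        ((S ×ˢ univ).filter fun t => pos t ∈ S).card := by
      have hin' : ∑ u ∈ S, ∑ v ∈ S, (univ.filter fun j => pos (v, j) = u).card
          = ((S ×ˢ univ).filter fun t => pos t ∈ S).card := by rw [Finset.sum_comm, hin]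
      nth_rewrite 1 [← hin]
      rw [← hin', ← Finset.sum_add_distrib]
      refine Finset.sum_le_sum fun u _ => ?_
      rw [← Finset.sum_add_distrib]
      refine Finset.sum_le_sum fun v _ => ?_
      rw [hmult]
      split_ifs with h
      · rcases h with ⟨j, hj⟩ | ⟨j, hj⟩
        · have : 0 < (univ.filter fun j => pos (u, j) = v).card :=
            Finset.card_pos.2 ⟨j, by simp [hj]⟩
          omega
        · have : 0 < (univ.filter fun j => pos (v, j) = u).card :=
            Finset.card_pos.2 ⟨j, by simp [hj]⟩
          omega
      · exact Nat.zero_le _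
    omega

end Expansion

end DegreeReduction

/-! ### Estimates for the union bound over sets of nodes -/

namespace DegreeReduction

section Estimates

open Filter

/-- A constant that is at least `8 * exp 4 * 401 ^ 3`, where `401` is one more than the number of tokens
of a node. A set of `s` nodes is examined for about `(n / (bigConst * s)) ^ (1 / 3)` phases. -/
def bigConst : ℕ := 440 * 401 ^ 3

theorem bigConst_pos : 0 < bigConst := by norm_num [bigConst]

theorem choose_le_pow {n s : ℕ} (hs : 1 ≤ s) :
    (n.choose s : ℝ) ≤ (Real.exp 1 * n / s) ^ s := by
  have hs0 : (0 : ℝ) < s := by exact_mod_cast hs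
  have h1 : (n.choose s : ℝ) ≤ (n : ℝ) ^ s / s.factorial := Nat.choose_le_pow_div s n
  have h2 : (s : ℝ) ^ s / s.factorial ≤ Real.exp s := Real.pow_div_factorial_le_exp _ hs0.le s
  have h3 : (0 : ℝ) < s.factorial := by exact_mod_cast Nat.factorial_pos s
  calc (n.choose s : ℝ) ≤ (n : ℝ) ^ s / s.factorial := h1
    _ = (n : ℝ) ^ s / (s : ℝ) ^ s * ((s : ℝ) ^ s / s.factorial) := by field_simp
    _ ≤ (n : ℝ) ^ s / (s : ℝ) ^ s * Real.exp s :=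
        mul_le_mul_of_nonneg_left h2 (by positivity)
    _ = _ := by
        rw [← mul_one (s : ℝ), Real.exp_nat_mul, mul_one, ← div_pow, ← mul_pow]
        congr 1; ring

theorem eventually_pow_le_two_pow (a : ℝ) (b : ℕ) :
    ∀ᶠ s : ℕ in atTop, (a * s) ^ b ≤ (2 : ℝ) ^ s := by
  have h := tendsto_pow_const_div_const_pow_of_one_lt b (r := (2 : ℝ)) (by norm_num)
  have h2 := h.const_mul (a ^ b)
  rw [mul_zero] at h2
  filter_upwards [h2.eventually_le_const (zero_lt_one)] with s hs
  rw [← mul_div_assoc, div_le_one (by positivity)] at hs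
  rwa [mul_pow]

theorem exp_four_le : Real.exp 4 ≤ 55 := by
  have h := Real.exp_one_lt_d9
  have : Real.exp 4 = Real.exp 1 ^ 4 := by rw [← Real.exp_nat_mul]; norm_num
  rw [this]
  calc Real.exp 1 ^ 4 ≤ (2.7182818286 : ℝ) ^ 4 := by gcongr
    _ ≤ 55 := by norm_num

/-- Sets of linear size: a single phase wastes few walks, because a walk ends in the set with
probability close to at most one half. -/
theorem large_set_bound {n s : ℕ} (hn : 1000000 ≤ n) (hs : 1 ≤ s) (h2 : 2 * s ≤ n)
    (hD : n < bigConst * s) (hpow : ((bigConst : ℝ) * s) ^ 3 ≤ 2 ^ s) :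
    (n.choose s : ℝ) * ((1 + ((3 : ℝ) - 1) * ((s + 400 : ℕ) *
      (1 / (n : ℝ) + 1 / (n : ℝ) ^ 2))) ^ (1 * (s * 400)) / 3 ^ (300 * s)) ≤ 1 / (n : ℝ) ^ 3 := by
  have hn0 : (0 : ℝ) < n := by positivity
  have hs0 : (0 : ℝ) < s := by exact_mod_cast hs
  have hnr : (1000000 : ℝ) ≤ n := by exact_mod_cast hn
  have h2r : 2 * (s : ℝ) ≤ n := by exact_mod_cast h2
  have hDr : (n : ℝ) ≤ bigConst * s := by exact_mod_cast hD.le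
  have hw : 1 + ((3 : ℝ) - 1) * ((s + 400 : ℕ) * (1 / (n : ℝ) + 1 / (n : ℝ) ^ 2)) ≤ 2.01 := by
    have : ((s + 400 : ℕ) : ℝ) * (1 / (n : ℝ) + 1 / (n : ℝ) ^ 2) ≤ 0.505 := by
      have e : ((s + 400 : ℕ) : ℝ) * (1 / (n : ℝ) + 1 / (n : ℝ) ^ 2)
          = ((s : ℝ) + 400) * (n + 1) / (n : ℝ) ^ 2 := by push_cast; field_simp
      rw [e, div_le_iff₀ (by positivity)]
      nlinarith
    linarith
  have hw0 : (0 : ℝ) ≤ 1 + ((3 : ℝ) - 1) * ((s + 400 : ℕ) * (1 / (n : ℝ) + 1 / (n : ℝ) ^ 2)) := by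
    have : (0 : ℝ) ≤ ((s + 400 : ℕ) : ℝ) * (1 / (n : ℝ) + 1 / (n : ℝ) ^ 2) := by positivity
    linarith
  have hch : (n.choose s : ℝ) ≤ (3 * bigConst : ℝ) ^ s := by
    refine (choose_le_pow hs).trans (pow_le_pow_left₀ (by positivity) ?_ _)
    rw [div_le_iff₀ hs0]
    have := Real.exp_one_lt_d9
    nlinarith [Real.exp_pos 1]
  calc _ ≤ (3 * bigConst : ℝ) ^ s * ((2.01 : ℝ) ^ (1 * (s * 400)) / 3 ^ (300 * s)) := by
        gcongr
    _ = (3 * bigConst * (((2.01 : ℝ) ^ 4 / 3 ^ 3) ^ 10) ^ 10) ^ s := by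
        have e1 : (2.01 : ℝ) ^ (1 * (s * 400)) = ((((2.01 : ℝ) ^ 4) ^ 10) ^ 10) ^ s := by
          simp only [← pow_mul]; congr 1; omega
        have e2 : (3 : ℝ) ^ (300 * s) = ((((3 : ℝ) ^ 3) ^ 10) ^ 10) ^ s := by
          simp only [← pow_mul]
        rw [e1, e2, ← div_pow, ← mul_pow, ← div_pow, ← div_pow]
    _ ≤ (3 * bigConst * ((1 / 100 : ℝ)) ^ 10) ^ s := by
        gcongr
        norm_num
    _ ≤ (1 / 2 : ℝ) ^ s := by
        refine pow_le_pow_left₀ (by positivity) ?_ _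
        norm_num [bigConst]
    _ = 1 / 2 ^ s := by rw [div_pow, one_pow]
    _ ≤ 1 / (n : ℝ) ^ 3 := by
        refine one_div_le_one_div_of_le (by positivity) (le_trans ?_ hpow)
        gcongr

/-- Smaller sets: a walk is wasted with probability at most `w = 802 * s / n`, and the walks of `k`
phases are considered, with `w * k` so small that the expected number of wasted walks is negligible.
The base `z = 1 / (w * k)` nearly optimises the Chernoff bound. -/
theorem small_set_bound {n s k : ℕ} (hs : 1 ≤ s) (hk : 1 ≤ k)
    (hD : bigConst * (k ^ 3 * s) ≤ n) (hpow : n < s ^ 2 → ((1 : ℝ) * s) ^ 6 ≤ 2 ^ s) :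
    1 ≤ (n : ℝ) / (802 * k * s) ∧
    (n.choose s : ℝ) * ((1 + ((n : ℝ) / (802 * k * s) - 1) * ((s + 400 : ℕ) *
      (1 / (n : ℝ) + 1 / (n : ℝ) ^ 2))) ^ (k * (s * 400)) / ((n : ℝ) / (802 * k * s)) ^ (300 * s))
      ≤ 1 / (n : ℝ) ^ 3 := by
  have hs1 : (1 : ℝ) ≤ s := by exact_mod_cast hs
  have hk1 : (1 : ℝ) ≤ k := by exact_mod_cast hk
  have hs0 : (0 : ℝ) < s := by linarith
  have hk0 : (0 : ℝ) < k := by linarith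
  have hDr : (bigConst : ℝ) * ((k : ℝ) ^ 3 * s) ≤ n := by exact_mod_cast hD
  have hB : (bigConst : ℝ) = 440 * 401 ^ 3 := by norm_num [bigConst]
  have hn0 : (0 : ℝ) < n := lt_of_lt_of_le (by rw [hB]; positivity) hDr
  have hn1 : (1 : ℝ) ≤ n := by
    have : 0 < n := by exact_mod_cast hn0
    exact_mod_cast this
  set z : ℝ := (n : ℝ) / (802 * k * s) with hz
  have hz1 : 1 ≤ z := by
    rw [hz, one_le_div (by positivity)]
    refine le_trans ?_ hDr
    have : (k : ℝ) ≤ (k : ℝ) ^ 3 := le_self_pow₀ hk1 (by norm_num)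
    rw [hB]
    calc (802 : ℝ) * k * s = 802 * (k * s) := by ring
      _ ≤ 440 * 401 ^ 3 * (k * s) := by gcongr; norm_num
      _ ≤ _ := by gcongr
  refine ⟨hz1, ?_⟩
  have hz0 : 0 < z := by linarith
  set w : ℝ := (s + 400 : ℕ) * (1 / (n : ℝ) + 1 / (n : ℝ) ^ 2) with hw
  have hw0 : 0 ≤ w := by positivity
  have hwz : z * w * k ≤ 1 := by
    have h1 : w ≤ 401 * s * (2 / n) := by
      rw [hw]
      refine mul_le_mul ?_ ?_ (by positivity) (by positivity)
      · push_cast; linarith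
      · have : 1 / (n : ℝ) ^ 2 ≤ 1 / n :=
          one_div_le_one_div_of_le hn0 (le_self_pow₀ hn1 (by norm_num))
        calc 1 / (n : ℝ) + 1 / (n : ℝ) ^ 2 ≤ 1 / n + 1 / n := by linarith
          _ = 2 / n := by ring
    calc z * w * k ≤ z * (401 * s * (2 / n)) * k := by gcongr
      _ = 1 := by rw [hz]; field_simp; norm_num
  set q : ℝ := (s : ℝ) / n with hq
  have hq0 : 0 < q := by positivity
  have hqB : bigConst * (k : ℝ) ^ 3 * q ≤ 1 := by
    rw [hq, ← mul_div_assoc, div_le_one hn0]; linarith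
  have hqhalf : 3 * q ≤ 1 := by
    have h1 : (1 : ℝ) ≤ (k : ℝ) ^ 3 := one_le_pow₀ hk1
    rw [hB] at hqB
    nlinarith
  have hmain : (1 + (z - 1) * w) ^ (k * (s * 400)) / z ^ (300 * s) ≤ (q ^ 200) ^ s := by
    have h1 : (1 + (z - 1) * w) ^ (k * (s * 400)) ≤ (Real.exp 4 ^ 100) ^ s := by
      calc _ ≤ (Real.exp (z * w)) ^ (k * (s * 400)) := by
            refine pow_le_pow_left₀ ?_ (one_add_mul_le_exp hw0) _
            have := mul_nonneg (sub_nonneg.2 hz1) hw0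
            linarith
        _ = Real.exp ((z * w * k) * (400 * s)) := by
            rw [← Real.exp_nat_mul]; congr 1; push_cast; ring
        _ ≤ Real.exp (1 * (400 * s)) := by gcongr
        _ = _ := by
            rw [← pow_mul, ← Real.exp_nat_mul]; congr 1; push_cast; ring
    have h2 : z ^ (300 * s) = ((z ^ 3) ^ 100) ^ s := by
      rw [← pow_mul, ← pow_mul]; congr 1; omega
    have h3 : Real.exp 4 / z ^ 3 ≤ q ^ 2 := by
      have : 1 / z ^ 3 = 802 ^ 3 * k ^ 3 * q ^ 3 := by
        rw [hz, hq]; field_simp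
      calc Real.exp 4 / z ^ 3 = Real.exp 4 * (1 / z ^ 3) := by ring
        _ ≤ 55 * (802 ^ 3 * k ^ 3 * q ^ 3) := by
            rw [this]; exact mul_le_mul_of_nonneg_right exp_four_le (by positivity)
        _ = (bigConst * k ^ 3 * q) * q ^ 2 := by rw [hB]; ring
        _ ≤ 1 * q ^ 2 := by gcongr
        _ = q ^ 2 := one_mul _
    calc _ ≤ (Real.exp 4 ^ 100) ^ s / ((z ^ 3) ^ 100) ^ s := by rw [h2]; gcongr
      _ = ((Real.exp 4 / z ^ 3) ^ 100) ^ s := by rw [← div_pow, ← div_pow]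
      _ ≤ ((q ^ 2) ^ 100) ^ s := by gcongr
      _ = _ := by rw [← pow_mul q]
  have hch : (n.choose s : ℝ) ≤ (3 / q) ^ s := by
    refine (choose_le_pow hs).trans (pow_le_pow_left₀ (by positivity) ?_ _)
    have : Real.exp 1 ≤ 3 := by have := Real.exp_one_lt_d9; linarith
    calc Real.exp 1 * n / s ≤ 3 * n / s := by gcongr
      _ = 3 / q := by rw [hq]; field_simp
  calc _ ≤ (3 / q) ^ s * (q ^ 200) ^ s := by gcongr
    _ = ((3 * q) * q ^ 198) ^ s := by
        rw [← mul_pow]; congr 1; field_simp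
    _ ≤ (1 * q ^ 6) ^ s := by
        refine pow_le_pow_left₀ (by positivity) ?_ _
        refine mul_le_mul hqhalf ?_ (by positivity) (by norm_num)
        exact pow_le_pow_of_le_one hq0.le (by linarith) (by norm_num)
    _ = (q ^ 6) ^ s := by rw [one_mul]
    _ ≤ 1 / (n : ℝ) ^ 3 := by
        have hq6 : q ^ 6 ≤ 1 := pow_le_one₀ hq0.le (by linarith)
        rcases lt_or_ge n (s ^ 2) with h | h
        · have h1 : (n : ℝ) ^ 3 ≤ 2 ^ s := by
            refine le_trans ?_ (hpow h)
            have : (n : ℝ) ≤ (s : ℝ) ^ 2 := by exact_mod_cast h.le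
            calc (n : ℝ) ^ 3 ≤ ((s : ℝ) ^ 2) ^ 3 := by gcongr
              _ = _ := by rw [one_mul, ← pow_mul]
          calc (q ^ 6) ^ s ≤ (1 / 2 : ℝ) ^ s := by
                refine pow_le_pow_left₀ (by positivity) ?_ _
                calc q ^ 6 ≤ q ^ 1 := pow_le_pow_of_le_one hq0.le (by linarith) (by norm_num)
                  _ ≤ 1 / 2 := by rw [pow_one]; linarith
            _ = 1 / 2 ^ s := by rw [div_pow, one_pow]
            _ ≤ _ := one_div_le_one_div_of_le (by positivity) h1
        · have h1 : q ^ 2 ≤ 1 / n := by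
            rw [hq, div_pow, div_le_div_iff₀ (by positivity) hn0]
            have : (s : ℝ) ^ 2 ≤ n := by exact_mod_cast h
            nlinarith
          calc (q ^ 6) ^ s ≤ q ^ 6 := pow_le_of_le_one (by positivity) hq6 (by omega)
            _ = (q ^ 2) ^ 3 := by rw [← pow_mul]
            _ ≤ (1 / n) ^ 3 := by gcongr
            _ = _ := by rw [div_pow, one_pow]

/-- The failure probabilities for the sets of a given size `s` add up to at most `1 / n ^ 3`. -/
def SizeBound (n : ℕ) : Prop :=
  ∀ s : ℕ, 1 ≤ s → 2 * s ≤ n → ∃ (k : ℕ) (z : ℝ), 1 ≤ k ∧ 1 ≤ z ∧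
    n < bigConst * ((k + 1) ^ 3 * s) ∧
    (n.choose s : ℝ) * ((1 + (z - 1) * ((s + 400 : ℕ) *
      (1 / (n : ℝ) + 1 / (n : ℝ) ^ 2))) ^ (k * (s * 400)) / z ^ (300 * s)) ≤ 1 / (n : ℝ) ^ 3

theorem eventually_sizeBound : ∀ᶠ n : ℕ in atTop, SizeBound n := by
  obtain ⟨s₁, h₁⟩ := eventually_atTop.1 (eventually_pow_le_two_pow bigConst 3)
  obtain ⟨s₂, h₂⟩ := eventually_atTop.1 (eventually_pow_le_two_pow 1 6)
  filter_upwards [eventually_ge_atTop (1000000 + bigConst * s₁ + s₂ ^ 2)] with n hn s hs h2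
  rcases lt_or_ge n (bigConst * s) with hD | hD
  · refine ⟨1, 3, le_rfl, by norm_num, ?_, large_set_bound (by omega) hs h2 hD (h₁ s ?_)⟩
    · refine hD.trans_le (Nat.mul_le_mul_left _ ?_)
      omega
    · by_contra hlt
      have := Nat.mul_le_mul_left bigConst (not_le.1 hlt).le
      omega
  · have hex : ∃ k, n < bigConst * ((k + 1) ^ 3 * s) := by
      refine ⟨n, ?_⟩
      have h1 : n + 1 ≤ (n + 1) ^ 3 := Nat.le_self_pow (by norm_num) _
      calc n < n + 1 := Nat.lt_succ_self n
        _ ≤ (n + 1) ^ 3 := h1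
        _ ≤ (n + 1) ^ 3 * s := Nat.le_mul_of_pos_right _ hs
        _ ≤ _ := Nat.le_mul_of_pos_left _ bigConst_pos
    classical
    set k := Nat.find hex with hkdef
    have hk : n < bigConst * ((k + 1) ^ 3 * s) := Nat.find_spec hex
    have hk0 : k ≠ 0 := by
      intro h0
      rw [h0] at hk
      simp at hk
      omega
    have hk' : bigConst * (k ^ 3 * s) ≤ n := by
      have := Nat.find_min hex (m := k - 1) (by omega)
      rw [Nat.sub_add_cancel (by omega)] at this
      exact not_lt.1 this
    obtain ⟨hz, hb⟩ := small_set_bound hs (Nat.one_le_iff_ne_zero.2 hk0) hk' (fun h => h₂ s (by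
      by_contra hlt
      have := Nat.pow_le_pow_left (not_le.1 hlt).le 2
      omega))
    exact ⟨k, _, Nat.one_le_iff_ne_zero.2 hk0, hz, hk, hb⟩

end Estimates

section Final

variable {V : Type*} [Fintype V] [LinearOrder V] {p : Params} {Δ : ℕ}

/-! ### The failure probability -/

theorem prob_eq_unifProb (E : Set (Choices V p Δ)) : prob E = unifProb (fun ω => ω ∈ E) := by
  classical
  rw [prob, MeasureTheory.measureReal_def, ProbabilityTheory.uniformOn_univ,
    MeasureTheory.Measure.count_apply_finite _ (Set.toFinite E), ENNReal.toReal_div,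
    unifProb, Fintype.expect_eq_sum_div_card]
  simp only [ENNReal.toReal_natCast]
  congr 1
  rw [Finset.sum_boole]
  congr 2
  ext ω
  simp

/-- Of the `400 s` tokens generated in `S`, at least `400 s - 300 s - 8 s = 92 s` give edges that leave
`S`, and the other ones give at most `2 * (400 s - 92 s)` to the volume of `S`. -/
theorem le_conductance_output {G : RegularMultigraph V Δ} {ω : Choices V p Δ} {M : ℕ}
    (hM : Uncongested G ω M) (hR : M * p.len ≤ p.walkRounds) (hc : p.c = 400)
    (hT : ∀ t, (config G ω p.phases).act t = false) (hn : 2 ≤ Fintype.card V)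
    (h : ∀ S : Finset V, S.Nonempty → 2 * S.card ≤ Fintype.card V → ∃ k ≤ p.phases,
      (config G ω k).numActive ≤ 8 * S.card ∧ totalWasted G ω S k < 300 * S.card) :
    1 / 10 ≤ (output G ω).conductance := by
  refine Multigraph.le_conductance hn (fun S hS hS2 => ?_) (by norm_num)
  obtain ⟨k, hk, h1, h2⟩ := h S hS hS2
  obtain ⟨D, hD, hcard, hpos, hinj⟩ := exists_good_tokens G ω S hk
  obtain ⟨h3, h4⟩ := cut_output hM hR hT hD hpos hinj
  have hS0 := hS.card_pos
  rw [hc] at hcard h4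
  refine ⟨by omega, ?_⟩
  have h5 : (output G ω).vol S ≤ 10 * (output G ω).cut S := by omega
  have h6 : ((output G ω).vol S : ℝ) ≤ 10 * (output G ω).cut S := by exact_mod_cast h5
  linarith

theorem totalWasted_mono (G : RegularMultigraph V Δ) (ω : Choices V p Δ) (S : Finset V)
    {k k' : ℕ} (h : k ≤ k') : totalWasted G ω S k ≤ totalWasted G ω S k' := by
  refine Finset.sum_le_sum_of_subset fun i hi => ?_
  simp only [mem_filter, mem_univ, true_and] at hi ⊢
  omega

/-- If the number of active tokens decreases fast, then after `k` phases it is small compared with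
`s`, for `k` about `(n / s) ^ (1 / 3)`. -/
theorem numActive_le_eight_mul {G : RegularMultigraph V Δ} {ω : Choices V p Δ} {M : ℝ}
    (hc : p.c = 400)
    (h : ∀ k : Fin p.phases, ¬ (M ≤ (config G ω k).numActive ∧
      (1 / (400 * bigConst : ℝ)) * (config G ω k).numActive ≤ (config G ω (k + 1)).numActive))
    (hM : M * (bigConst * (p.phases : ℝ) ^ 3) ≤ 8 * Fintype.card V) {k s : ℕ} (hk1 : 1 ≤ k)
    (hk : k < p.phases) (hks : Fintype.card V < bigConst * ((k + 1) ^ 3 * s)) :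
    (config G ω k).numActive ≤ 8 * s := by
  have hB : (0 : ℝ) < bigConst := by exact_mod_cast bigConst_pos
  have hB1 : (1 : ℝ) ≤ bigConst := by exact_mod_cast bigConst_pos
  have hks' : (Fintype.card V : ℝ) ≤ bigConst * (((k : ℝ) + 1) ^ 3 * s) := by
    exact_mod_cast hks.le
  have h0 := numActive_config_le (by positivity) h hk.le
  suffices ((config G ω k).numActive : ℝ) ≤ 8 * s by exact_mod_cast this
  rcases le_max_iff.1 h0 with h1 | h1
  · refine h1.trans ?_
    rw [hc]
    push_cast
    have h2 : ((k : ℝ) + 1) ^ 3 ≤ 8 ^ k := by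
      have : k + 1 ≤ 2 ^ k := Nat.lt_two_pow_self
      have h3 : (k : ℝ) + 1 ≤ 2 ^ k := by exact_mod_cast this
      calc ((k : ℝ) + 1) ^ 3 ≤ (2 ^ k) ^ 3 := by gcongr
        _ = 8 ^ k := by rw [← pow_mul, mul_comm, pow_mul]; norm_num
    have h3 : (8 / (400 * bigConst : ℝ)) ^ k ≤ 8 / (400 * bigConst) := by
      refine pow_le_of_le_one (by positivity) ?_ (by omega)
      rw [div_le_one (by positivity)]; linarith
    calc (1 / (400 * bigConst : ℝ)) ^ k * (Fintype.card V * 400)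
        ≤ (1 / (400 * bigConst : ℝ)) ^ k * ((bigConst * (8 ^ k * s)) * 400) := by
          gcongr
          exact hks'.trans (by gcongr)
      _ = (8 / (400 * bigConst : ℝ)) ^ k * (400 * bigConst * s) := by
          rw [div_pow, div_pow, one_pow]; ring
      _ ≤ 8 / (400 * bigConst) * (400 * bigConst * s) := by gcongr
      _ = 8 * s := by field_simp
  · refine h1.trans ?_
    have h2 : (Fintype.card V : ℝ) ≤ (bigConst * (p.phases : ℝ) ^ 3) * s := by
      refine hks'.trans ?_
      rw [mul_assoc]
      gcongr
      exact_mod_cast hk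
    have hT : (0 : ℝ) < p.phases := by exact_mod_cast (by omega : 0 < p.phases)
    have h3 : M * (bigConst * (p.phases : ℝ) ^ 3) ≤ 8 * s * (bigConst * (p.phases : ℝ) ^ 3) := by
      linarith
    exact le_of_mul_le_mul_right h3 (by positivity)

omit [LinearOrder V] in
theorem card_mul_mixBound_le [Nonempty V] : Fintype.card V * mixBound V ≤ 2 := by
  have h : (1 : ℝ) ≤ Fintype.card V := by exact_mod_cast Fintype.card_pos (α := V)
  have h0 : (0 : ℝ) < Fintype.card V := by linarith
  have : (Fintype.card V : ℝ) * mixBound V = 1 + 1 / Fintype.card V := by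
    unfold mixBound; field_simp
  rw [this]
  have := (div_le_one h0).2 h
  linarith

/-- The union bound over all sets of at most half of the nodes. -/
theorem unifProb_exists_wasted_le [Nonempty (Fin Δ)] {G : RegularMultigraph V Δ}
    (hG : G.MixedAfter p.len) (hc : p.c = 400) {n : ℕ} (hn : Fintype.card V = n)
    (k : ℕ → ℕ) (z : ℕ → ℝ) (hz : ∀ s, 1 ≤ s → 2 * s ≤ n → 1 ≤ z s)
    (hkz : ∀ s, 1 ≤ s → 2 * s ≤ n →
      (n.choose s : ℝ) * ((1 + (z s - 1) * ((s + 400 : ℕ) *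
        (1 / (n : ℝ) + 1 / (n : ℝ) ^ 2))) ^ (k s * (s * 400)) / z s ^ (300 * s)) ≤
          1 / (n : ℝ) ^ 3) :
    unifProb (fun ω : Choices V p Δ => ∃ S ∈ univ.filter
      (fun S : Finset V => 1 ≤ S.card ∧ 2 * S.card ≤ n),
        300 * S.card ≤ totalWasted G ω S (k S.card)) ≤ (n + 1) * (1 / (n : ℝ) ^ 3) := by
  set f : ℕ → ℝ := fun s => if 1 ≤ s ∧ 2 * s ≤ n then
    (1 + (z s - 1) * ((s + 400 : ℕ) *
      (1 / (n : ℝ) + 1 / (n : ℝ) ^ 2))) ^ (k s * (s * 400)) / z s ^ (300 * s) else 0 with hf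
  have h1 : ∀ S ∈ univ.filter (fun S : Finset V => 1 ≤ S.card ∧ 2 * S.card ≤ n),
      unifProb (fun ω : Choices V p Δ => 300 * S.card ≤ totalWasted G ω S (k S.card))
        ≤ f S.card := by
    intro S hS
    have hS' := (mem_filter.1 hS).2
    have h := unifProb_totalWasted_le hG S (k S.card) (hz _ hS'.1 hS'.2) (300 * S.card)
    simp only [hc, mixBound, hn] at h
    simp only [hf, hS', and_self, if_true]
    exact h
  have hsum : ∑ S : Finset V, f S.card = ∑ s ∈ range (n + 1), (n.choose s : ℝ) * f s := by
    have := Finset.sum_powerset_apply_card f (x := (univ : Finset V))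
    rw [Finset.powerset_univ, Finset.card_univ, hn] at this
    simpa only [nsmul_eq_mul] using this
  calc _ ≤ ∑ S ∈ univ.filter (fun S : Finset V => 1 ≤ S.card ∧ 2 * S.card ≤ n), f S.card :=
        (unifProb_exists_le _ _).trans (Finset.sum_le_sum h1)
    _ = ∑ S : Finset V, f S.card := by
        refine Finset.sum_subset (Finset.subset_univ _) fun S _ hS => ?_
        simp only [mem_filter, mem_univ, true_and] at hS
        simp only [hf, hS, if_false]
    _ = ∑ s ∈ range (n + 1), (n.choose s : ℝ) * f s := hsum
    _ ≤ ∑ s ∈ range (n + 1), 1 / (n : ℝ) ^ 3 := by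
        refine Finset.sum_le_sum fun s _ => ?_
        by_cases h : 1 ≤ s ∧ 2 * s ≤ n
        · simp only [hf, h, and_self, if_true]
          exact hkz s h.1 h.2
        · simp only [hf, h, if_false, mul_zero]; positivity
    _ = _ := by rw [Finset.sum_const, card_range, nsmul_eq_mul]; push_cast; ring

/-- A union bound over `m` events of probability at most `b` each. -/
theorem unifProb_exists_le_mul {Ω ι : Type*} [Fintype Ω] [Fintype ι] (E : ι → Ω → Prop) {b : ℝ}
    (h : ∀ i, unifProb (E i) ≤ b) :
    unifProb (fun ω => ∃ i, E i ω) ≤ Fintype.card ι * b := by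
  have h1 := unifProb_exists_le (univ : Finset ι) E
  simp only [mem_univ, true_and] at h1
  refine h1.trans ((Finset.sum_le_sum fun i _ => h i).trans (le_of_eq ?_))
  rw [Finset.sum_const, Finset.card_univ, nsmul_eq_mul]

/-- For suitable parameters, the procedure succeeds with high probability. -/
theorem good_event [Nonempty (Fin Δ)] {G : RegularMultigraph V Δ}
    (hG : G.MixedAfter p.len) (hc : p.c = 400)
    (hδ : 1600 * Real.exp (1600 * bigConst) ≤ p.δ) {n : ℕ} (hn : Fintype.card V = n)
    (hsize : SizeBound n) {s : ℕ} (hs : 4 * Real.log n ≤ s) (hs400 : 400 ≤ s)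
    (hT : 4 * Real.log n ≤ p.phases) (hR : 4 * s * p.len ≤ p.walkRounds)
    (h1 : (p.phases * p.len : ℝ) ≤ n) (h2 : p.phases * Real.exp 2400 ≤ n)
    (h3 : 3 * Real.log n * (bigConst * (p.phases : ℝ) ^ 3) ≤ 8 * n) (hn400 : 400 ≤ n) :
    1 - 1 / (n : ℝ) ≤ unifProb (fun ω : Choices V p Δ =>
      WalksComplete G ω ∧ (∀ v, Satisfied (finalState G ω) v) ∧
      (∀ v, (output G ω).degree v ≤ p.c + p.δ) ∧ 1 / 10 ≤ (output G ω).conductance) := by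
  have hnV : Nonempty V := Fintype.card_pos_iff.1 (by omega)
  have hnr : (400 : ℝ) ≤ n := by exact_mod_cast hn400
  have hn0 : (0 : ℝ) < n := by linarith
  have hB1 : (1 : ℝ) ≤ bigConst := by exact_mod_cast bigConst_pos
  have hδ0 : (0 : ℝ) < p.δ := lt_of_lt_of_le (by positivity) hδ
  have hδN : 0 < p.δ := by exact_mod_cast hδ0
  have hmix : (n : ℝ) * mixBound V ≤ 2 := hn ▸ card_mul_mixBound_le (V := V)
  have hlog : ∀ x : ℝ, 4 * Real.log n ≤ x → Real.exp (-x) ≤ 1 / (n : ℝ) ^ 4 := by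
    intro x hx
    calc Real.exp (-x) ≤ Real.exp (-((4 : ℕ) * Real.log n)) :=
          Real.exp_le_exp.2 (by push_cast; linarith)
      _ = 1 / (n : ℝ) ^ 4 := by
          rw [Real.exp_neg, Real.exp_nat_mul, Real.exp_log hn0, one_div]
  choose! k z hk1 hz hkn hkz using hsize
  -- The failure events: congestion during or at the end of the walks of a phase, a surviving token,
  -- a phase in which too many tokens are rejected, and a set of nodes with too many wasted walks.
  set F1 : Choices V p Δ → Prop := fun ω => ∃ e : Fin p.phases × Fin p.len × V,
    (∀ u, (config G ω e.1).activeLoad u ≤ s) ∧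
      4 * s ≤ (config G ω e.1).walkLoad G (ω e.1) e.2.1 e.2.2 with hF1
  set F2 : Choices V p Δ → Prop := fun ω => ∃ e : Fin p.phases × V,
    s + 1 ≤ (config G ω e.1).walkLoad G (ω e.1) p.len e.2 with hF2
  set F3 : Choices V p Δ → Prop := fun ω => ∃ t : Token V p,
    (config G ω p.phases).act t = true with hF3
  set F4 : Choices V p Δ → Prop := fun ω => ∃ i : Fin p.phases,
    3 * Real.log n ≤ (config G ω i).numActive ∧
      (1 / (400 * bigConst : ℝ)) * (config G ω i).numActive ≤ (config G ω (i + 1)).numActive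
    with hF4
  set F5 : Choices V p Δ → Prop := fun ω => ∃ S ∈ univ.filter
      (fun S : Finset V => 1 ≤ S.card ∧ 2 * S.card ≤ n),
        300 * S.card ≤ totalWasted G ω S (k S.card) with hF5
  have b1 : unifProb F1 ≤ 1 / (n : ℝ) ^ 2 := by
    have h := unifProb_exists_le_mul (fun (e : Fin p.phases × Fin p.len × V) ω =>
      (∀ u, (config G ω e.1).activeLoad u ≤ s) ∧
      4 * s ≤ (config G ω e.1).walkLoad G (ω e.1) e.2.1 e.2.2) (b := 1 / (n : ℝ) ^ 4) (fun e => by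
        refine (unifProb_congested_le G e.1 e.2.1.2.le e.2.2 (4 * s)).trans ?_
        have : 3 * (s : ℝ) - (4 * s : ℕ) = -s := by push_cast; ring
        rw [this]
        exact hlog s hs)
    refine h.trans ?_
    simp only [Fintype.card_prod, Fintype.card_fin, hn]
    push_cast
    calc (p.phases * (p.len * n) : ℝ) * (1 / (n : ℝ) ^ 4)
        = (p.phases * p.len) * (n * (1 / (n : ℝ) ^ 4)) := by ring
      _ ≤ n * (n * (1 / (n : ℝ) ^ 4)) := by gcongr
      _ = _ := by field_simp
  have b2 : unifProb F2 ≤ 1 / (n : ℝ) ^ 2 := by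
    have h := unifProb_exists_le_mul (fun (e : Fin p.phases × V) (ω : Choices V p Δ) =>
      s + 1 ≤ (config G ω e.1).walkLoad G (ω e.1) p.len e.2)
      (b := Real.exp 2400 * (1 / (n : ℝ) ^ 4)) (fun e => by
        refine (unifProb_endLoad_le hG e.1 e.2 (s + 1)).trans ?_
        refine le_trans ?_ (mul_le_mul_of_nonneg_left (hlog s hs) (Real.exp_pos _).le)
        rw [← Real.exp_add]
        refine Real.exp_le_exp.2 ?_
        rw [hc, hn]
        push_cast
        linarith)
    refine h.trans ?_
    simp only [Fintype.card_prod, Fintype.card_fin, hn]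
    push_cast
    calc (p.phases * n : ℝ) * (Real.exp 2400 * (1 / (n : ℝ) ^ 4))
        = (p.phases * Real.exp 2400) * (n * (1 / (n : ℝ) ^ 4)) := by ring
      _ ≤ n * (n * (1 / (n : ℝ) ^ 4)) := by gcongr
      _ = _ := by field_simp
  have hexp : (1 : ℝ) ≤ Real.exp (1600 * bigConst) := Real.one_le_exp (by positivity)
  have hr : ((Fintype.card V * p.c : ℕ) / p.δ * mixBound V : ℝ) ≤ 800 / p.δ := by
    rw [hc, hn]
    push_cast
    calc (n * 400 : ℝ) / p.δ * mixBound V = 400 / p.δ * (n * mixBound V) := by ring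
      _ ≤ 400 / p.δ * 2 := by gcongr
      _ = _ := by ring
  have b3 : unifProb F3 ≤ 1 / (n : ℝ) ^ 2 := by
    have h := unifProb_exists_le_mul (fun (t : Token V p) (ω : Choices V p Δ) =>
      (config G ω p.phases).act t = true) (b := 1 / (n : ℝ) ^ 4) (fun t => by
        refine (unifProb_act_le hG hδN t).trans (le_trans ?_ (hlog p.phases hT))
        rw [← mul_neg_one, Real.exp_nat_mul]
        refine pow_le_pow_left₀ (mul_nonneg (by positivity) mixBound_nonneg) (hr.trans ?_) _
        rw [Real.exp_neg, div_le_iff₀ hδ0, ← div_eq_inv_mul, le_div_iff₀ (Real.exp_pos _)]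
        have : Real.exp 1 ≤ Real.exp (1600 * bigConst) := Real.exp_le_exp.2 (by linarith)
        linarith [Real.exp_pos 1])
    refine h.trans ?_
    rw [card_token, hc, hn]
    push_cast
    calc (n * 400 : ℝ) * (1 / (n : ℝ) ^ 4) ≤ (n * n) * (1 / (n : ℝ) ^ 4) := by gcongr
      _ = _ := by field_simp
  have b4 : unifProb F4 ≤ 1 / (n : ℝ) ^ 2 := by
    have h := unifProb_exists_le_mul (fun (i : Fin p.phases) (ω : Choices V p Δ) =>
      3 * Real.log n ≤ (config G ω i).numActive ∧
      (1 / (400 * bigConst : ℝ)) * (config G ω i).numActive ≤ (config G ω (i + 1)).numActive)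
      (b := 1 / (n : ℝ) ^ 3) (fun i => by
        refine (unifProb_numActive_le hG hδN i (θ := 1600 * bigConst) (by positivity) ?_ ?_).trans
          (le_of_eq ?_)
        · refine le_of_eq ?_
          field_simp; norm_num
        · calc Real.exp (1600 * bigConst) *
                (2 * (Fintype.card V * p.c : ℕ) / p.δ * mixBound V)
              = Real.exp (1600 * bigConst) * 2 *
                ((Fintype.card V * p.c : ℕ) / p.δ * mixBound V) := by ring
            _ ≤ Real.exp (1600 * bigConst) * 2 * (800 / p.δ) := by gcongr
            _ = 1600 * Real.exp (1600 * bigConst) / p.δ := by ring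
            _ ≤ 1 := (div_le_one hδ0).2 hδ
        · have : (3 : ℝ) = (3 : ℕ) := by norm_num
          rw [this, Real.exp_neg, Real.exp_nat_mul, Real.exp_log hn0, one_div])
    refine h.trans ?_
    rw [Fintype.card_fin]
    have hTn : (p.phases : ℝ) ≤ n := by
      refine le_trans ?_ h2
      exact le_mul_of_one_le_right (by positivity) (Real.one_le_exp (by norm_num))
    calc (p.phases : ℝ) * (1 / (n : ℝ) ^ 3) ≤ n * (1 / (n : ℝ) ^ 3) := by gcongr
      _ = _ := by field_simp
  have b5 : unifProb F5 ≤ 2 * (1 / (n : ℝ) ^ 2) := by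
    refine (unifProb_exists_wasted_le hG hc hn k z hz hkz).trans ?_
    calc ((n : ℝ) + 1) * (1 / (n : ℝ) ^ 3) ≤ (2 * n) * (1 / (n : ℝ) ^ 3) := by
          gcongr; linarith
      _ = _ := by field_simp
  have hfail : unifProb (fun ω => F1 ω ∨ F2 ω ∨ F3 ω ∨ F4 ω ∨ F5 ω) ≤ 1 / (n : ℝ) := by
    have u1 := unifProb_or_le F1 (fun ω => F2 ω ∨ F3 ω ∨ F4 ω ∨ F5 ω)
    have u2 := unifProb_or_le F2 (fun ω => F3 ω ∨ F4 ω ∨ F5 ω)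
    have u3 := unifProb_or_le F3 (fun ω => F4 ω ∨ F5 ω)
    have u4 := unifProb_or_le F4 F5
    have : 6 * (1 / (n : ℝ) ^ 2) ≤ 1 / n := by
      rw [mul_one_div, div_le_div_iff₀ (by positivity) hn0]
      nlinarith
    linarith
  refine le_trans (b := unifProb (fun ω => ¬ (F1 ω ∨ F2 ω ∨ F3 ω ∨ F4 ω ∨ F5 ω))) ?_
    (unifProb_mono fun ω hω => ?_)
  · rw [unifProb_not]; linarith
  push Not at hω
  obtain ⟨w1, w2, w3, w4, w5⟩ := hω
  have hload : ∀ (i : ℕ) (u : V), (config G ω i).activeLoad u ≤ s :=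
    activeLoad_config_le (by omega) fun i v => by
      by_contra hlt
      exact w2 ⟨(i, v), not_le.1 hlt⟩
  have hM : Uncongested G ω (4 * s) := by
    intro i j hj v
    by_contra hlt
    exact w1 ⟨(i, ⟨j, hj⟩, v), hload i, (not_le.1 hlt).le⟩
  have hact : ∀ t, (config G ω p.phases).act t = false := by
    intro t
    by_contra ht
    exact w3 ⟨t, by simpa using ht⟩
  refine ⟨walksComplete hM hR, (mem_links_finalState hM hR hact).1,
    fun v => degree_output_le hM hR hact v,
    le_conductance_output hM hR hc hact (by omega) fun S hS hS2 => ?_⟩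
  have hS1 : 1 ≤ S.card := hS.card_pos
  rw [hn] at hS2
  have hw : totalWasted G ω S (k S.card) < 300 * S.card := by
    by_contra hlt
    exact w5 ⟨S, by simp only [mem_filter, mem_univ, true_and]; exact ⟨hS1, hS2⟩, not_lt.1 hlt⟩
  rcases lt_or_ge (k S.card) p.phases with hlt | hge
  · refine ⟨k S.card, hlt.le, ?_, hw⟩
    exact numActive_le_eight_mul (M := 3 * Real.log n) hc (fun i hi => w4 ⟨i, hi⟩)
      (by rw [hn]; exact h3) (hk1 _ hS1 hS2) hlt (by rw [hn]; exact hkn _ hS1 hS2)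
  · -- More than the available phases are asked for; then no token is active at the end.
    refine ⟨p.phases, le_rfl, ?_, (totalWasted_mono G ω S hge).trans_lt hw⟩
    have : (config G ω p.phases).numActive = 0 := by
      rw [Config.numActive, Finset.card_eq_zero, Finset.filter_eq_empty_iff]
      intro t _ ht
      rw [hact t] at ht
      exact absurd ht (by simp)
    omega

end Final

end DegreeReduction

/-! ### The choice of the constants -/

theorem eventually_mul_log_pow_le (a : ℝ) (b : ℕ) :
    ∀ᶠ n : ℕ in Filter.atTop, a * Real.log n ^ b ≤ n := by
  have h := (Real.tendsto_pow_log_div_mul_add_atTop 1 0 b one_ne_zero).const_mul a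
  rw [mul_zero] at h
  have h2 := (h.comp tendsto_natCast_atTop_atTop).eventually_le_const (zero_lt_one)
  filter_upwards [h2, Filter.eventually_gt_atTop 0] with n hn h0
  have h0' : (0 : ℝ) < n := by exact_mod_cast h0
  simp only [Function.comp_apply, one_mul, add_zero] at hn
  rwa [← mul_div_assoc, div_le_one h0'] at hn

/-- Walks of logarithmic length mix. -/
theorem RegularMultigraph.mixedAfter {V : Type*} [Fintype V] [DecidableEq V] {Δ : ℕ}
    {G : RegularMultigraph V Δ} {α β γ : ℝ} (hα : 0 < α)
    (h : α ≤ G.toMultigraph.conductance) (hn : 2 ≤ Fintype.card V)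
    (hβ : ∀ μ : ℝ, Module.End.HasEigenvalue (Matrix.toLin' G.walkMatrix) μ → -1 + β ≤ μ)
    (h1 : γ ≤ 1) (h2 : γ ≤ α ^ 2 / 2) (h3 : γ ≤ β) {t : ℕ}
    (ht : 2 * Real.log (Fintype.card V) ≤ γ * t) : G.MixedAfter t := by
  have hn0 : (0 : ℝ) < Fintype.card V := by exact_mod_cast (by omega : 0 < Fintype.card V)
  have hlog : 0 < Real.log (Fintype.card V) := Real.log_pos (by exact_mod_cast hn)
  have ht0 : t ≠ 0 := by
    rintro rfl
    simp only [Nat.cast_zero, mul_zero] at ht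
    linarith
  intro u v
  refine (abs_walkMatrix_pow_sub_le hα h hn hβ (lam := 1 - γ) (by linarith) (by linarith)
    (by linarith) ht0 u v).trans ?_
  calc (1 - γ) ^ t ≤ Real.exp (-γ) ^ t :=
        pow_le_pow_left₀ (by linarith) (by linarith [Real.add_one_le_exp (-γ)]) _
    _ = Real.exp (-(γ * t)) := by rw [← Real.exp_nat_mul]; congr 1; ring
    _ ≤ Real.exp (-((2 : ℕ) * Real.log (Fintype.card V))) :=
        Real.exp_le_exp.2 (by push_cast; linarith)
    _ = 1 / (Fintype.card V : ℝ) ^ 2 := by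
        rw [Real.exp_neg, Real.exp_nat_mul, Real.exp_log hn0, one_div]

theorem mainTheorem2 (Φ : ℝ) (hΦ_pos : 0 < Φ) (hΦ_le : Φ ≤ 1 / 10) :
    ∃ c δ : ℕ, 1 ≤ c ∧ 10 * c < δ ∧
      ∀ K α β κ : ℝ, 0 < K → 0 < α → 0 < β → 1 ≤ κ →
        ∃ (aLen aPhases aWalk C : ℝ) (n₀ : ℕ),
          0 < aLen ∧ 0 < aPhases ∧ 0 < aWalk ∧ 0 < C ∧
          ∀ (V : Type*) [Fintype V] [LinearOrder V] (n : ℕ), Fintype.card V = n → n₀ ≤ n →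
            ∀ (Δ : ℕ) (G : RegularMultigraph V Δ),
              (Δ : ℝ) ≤ K * Real.log n →
              α ≤ G.toMultigraph.conductance →
              (∀ μ : ℝ, Module.End.HasEigenvalue (Matrix.toLin' G.walkMatrix) μ → -1 + β ≤ μ) →
              -- `L` is the estimate of `log n` that the nodes know
              ∀ (L : ℝ), Real.log n ≤ L → L ≤ κ * Real.log n →
              ∀ (p : DegreeReduction.Params),
                p = { c := c, δ := δ, len := ⌈aLen * L⌉₊, phases := ⌈aPhases * L⌉₊,
                      walkRounds := ⌈aWalk * L ^ 2⌉₊ } →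
                G.MixedAfter p.len ∧
                (∀ ω : DegreeReduction.Choices V p Δ,
                  ((DegreeReduction.finalState G ω).rounds : ℝ) ≤ C * Real.log n ^ 3 ∧
                  ((DegreeReduction.finalState G ω).messages : ℝ) ≤ C * (n * Real.log n ^ 3)) ∧
                1 - 1 / (n : ℝ) ≤
                  DegreeReduction.prob {ω : DegreeReduction.Choices V p Δ |
                    DegreeReduction.WalksComplete G ω ∧
                    (∀ v, DegreeReduction.Satisfied (DegreeReduction.finalState G ω) v) ∧
                    (∀ v, (DegreeReduction.output G ω).degree v ≤ c + δ) ∧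
                    Φ ≤ (DegreeReduction.output G ω).conductance} := by
  -- So large a `δ` makes the probability `q` of a token to be late at most `exp (- 4 / ε)`, where
  -- `ε = 1 / (400 * bigConst)` is the factor by which the number of active tokens decreases.
  obtain ⟨δ, hδ, hδ10⟩ : ∃ δ : ℕ, 1600 * Real.exp (1600 * DegreeReduction.bigConst) ≤ δ ∧
      10 * 400 < δ :=
    ⟨⌈1600 * Real.exp (1600 * DegreeReduction.bigConst)⌉₊ + 4001, by
      push_cast; linarith [Nat.le_ceil (1600 * Real.exp (1600 * DegreeReduction.bigConst))],
      by omega⟩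
  refine ⟨400, δ, by norm_num, hδ10, ?_⟩
  intro K α β κ hK hα hβ hκ
  -- A lower bound on the spectral gap at both ends of the spectrum.
  obtain ⟨γ, hγ0, hγ1, hγα, hγβ⟩ : ∃ γ : ℝ, 0 < γ ∧ γ ≤ 1 ∧ γ ≤ α ^ 2 / 2 ∧ γ ≤ β :=
    ⟨min 1 (min (α ^ 2 / 2) β), by positivity, min_le_left _ _,
      (min_le_right _ _).trans (min_le_left _ _), (min_le_right _ _).trans (min_le_right _ _)⟩
  set a : ℝ := 2 / γ with ha
  have ha0 : 0 < a := by positivity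
  set b : ℝ := 20 * (a + 1) with hb
  have hb0 : 0 < b := by positivity
  have hκ0 : 0 < κ := by linarith
  set C : ℝ := 5 * κ * (b * κ ^ 2 + 1 + δ) + 400 with hC
  have hC0 : 0 < C := by positivity
  obtain ⟨n₀, hn₀⟩ := Filter.eventually_atTop.1 ((((DegreeReduction.eventually_sizeBound.and
    (Filter.eventually_ge_atTop 400)).and
    ((Real.tendsto_log_atTop.comp tendsto_natCast_atTop_atTop).eventually_ge_atTop 100)).and
    (eventually_mul_log_pow_le (5 * κ * ((a + 1) * κ)) 2)).and
    ((eventually_mul_log_pow_le (5 * κ * Real.exp 2400) 1).and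
    (eventually_mul_log_pow_le (3 * (DegreeReduction.bigConst * (5 * κ) ^ 3)) 4)))
  refine ⟨a, 4, b, C, n₀, ha0, by norm_num, hb0, hC0, ?_⟩
  intro V _ _ n hn hnn Δ G _ hcond heig L hL1 hL2 p hp
  obtain ⟨⟨⟨⟨hsize, hn400⟩, hx⟩, e1⟩, e2, e3⟩ := hn₀ n hnn
  simp only [Function.comp_apply] at hx
  set x := Real.log n with hxdef
  have hc : p.c = 400 := by rw [hp]
  have hδp : p.δ = δ := by rw [hp]
  have hlen : p.len = ⌈a * L⌉₊ := by rw [hp]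
  have hT : p.phases = ⌈4 * L⌉₊ := by rw [hp]
  have hRp : p.walkRounds = ⌈b * L ^ 2⌉₊ := by rw [hp]
  have hL100 : 100 ≤ L := by linarith
  have hLx : L ≤ κ * x := hL2
  have hlen_ge : a * L ≤ p.len := hlen ▸ Nat.le_ceil _
  have hlen_le : (p.len : ℝ) ≤ (a + 1) * L := by
    have := Nat.ceil_lt_add_one (show 0 ≤ a * L by positivity)
    rw [hlen]; linarith
  have hT_ge : 4 * L ≤ p.phases := hT ▸ Nat.le_ceil _
  have hT_le : (p.phases : ℝ) ≤ 5 * κ * x := by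
    have := Nat.ceil_lt_add_one (show 0 ≤ 4 * L by positivity)
    rw [hT]; linarith
  have hR_le : (p.walkRounds : ℝ) ≤ b * (κ * x) ^ 2 + 1 := by
    have := Nat.ceil_lt_add_one (show 0 ≤ b * L ^ 2 by positivity)
    rw [hRp]
    have : b * L ^ 2 ≤ b * (κ * x) ^ 2 := by gcongr
    linarith
  have hx0 : 0 ≤ x := by linarith
  have hcard : 2 ≤ Fintype.card V := by omega
  have hmixed : G.MixedAfter p.len := by
    refine RegularMultigraph.mixedAfter hα hcond hcard heig hγ1 hγα hγβ ?_
    rw [hn]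
    calc 2 * x ≤ 2 * L := by linarith
      _ = γ * (a * L) := by rw [ha]; field_simp
      _ ≤ γ * p.len := by gcongr
  have hΔ : 0 < Δ := RegularMultigraph.degree_pos hα hcond hcard
  have : Nonempty (Fin Δ) := ⟨⟨0, hΔ⟩⟩
  refine ⟨hmixed, fun ω => ?_, ?_⟩
  · obtain ⟨h1, h2⟩ := DegreeReduction.cost_finalState G ω
    have hcost : ((p.phases * (p.walkRounds + p.δ) + p.c : ℕ) : ℝ) ≤ C * x ^ 3 := by
      push_cast
      rw [hc, hδp]
      have hx2 : 1 ≤ x ^ 2 := one_le_pow₀ (by linarith)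
      have hx3 : 1 ≤ x ^ 3 := one_le_pow₀ (by linarith)
      calc (p.phases : ℝ) * (p.walkRounds + δ) + (400 : ℕ)
          ≤ (5 * κ * x) * ((b * (κ * x) ^ 2 + 1) + δ) + (400 : ℕ) := by gcongr
        _ ≤ (5 * κ * x) * ((b * κ ^ 2 + 1 + δ) * x ^ 2) + 400 * x ^ 3 := by
            push_cast
            gcongr
            · have : (0 : ℝ) ≤ (1 + δ) * (x ^ 2 - 1) :=
                mul_nonneg (by positivity) (by linarith)
              nlinarith
            · linarith
        _ = C * x ^ 3 := by rw [hC]; ring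
    constructor
    · refine le_trans ?_ hcost
      exact_mod_cast h1
    · calc ((DegreeReduction.finalState G ω).messages : ℝ)
          ≤ n * ((p.phases * (p.walkRounds + p.δ) + p.c : ℕ) : ℝ) := by
            rw [← hn]; exact_mod_cast h2
        _ ≤ n * (C * x ^ 3) := by gcongr
        _ = C * (n * x ^ 3) := by ring
  · -- At the start of every phase a node holds, with high probability, at most `s` active tokens.
    set s : ℕ := ⌈4 * L⌉₊ with hs
    have hs_ge : 4 * L ≤ s := Nat.le_ceil _
    have hs_le : (s : ℝ) ≤ 5 * L := by
      have := Nat.ceil_lt_add_one (show 0 ≤ 4 * L by positivity)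
      linarith
    have hgood := DegreeReduction.good_event hmixed hc (by rw [hδp]; exact hδ) hn hsize (s := s)
      (by linarith) (by
        have : (400 : ℝ) ≤ s := by linarith
        exact_mod_cast this)
      (by linarith)
      (by
        have : ((4 * s * p.len : ℕ) : ℝ) ≤ p.walkRounds := by
          push_cast
          calc 4 * (s : ℝ) * p.len ≤ 4 * (5 * L) * ((a + 1) * L) := by gcongr
            _ = b * L ^ 2 := by rw [hb]; ring
            _ ≤ p.walkRounds := hRp ▸ Nat.le_ceil _
        exact_mod_cast this)
      (by
        calc (p.phases : ℝ) * p.len ≤ (5 * κ * x) * ((a + 1) * (κ * x)) := by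
              gcongr
              exact hlen_le.trans (by gcongr)
          _ = 5 * κ * ((a + 1) * κ) * x ^ 2 := by ring
          _ ≤ n := e1)
      (by
        calc (p.phases : ℝ) * Real.exp 2400 ≤ (5 * κ * x) * Real.exp 2400 := by gcongr
          _ = 5 * κ * Real.exp 2400 * x ^ 1 := by ring
          _ ≤ n := e2)
      (by
        calc 3 * x * (DegreeReduction.bigConst * (p.phases : ℝ) ^ 3)
            ≤ 3 * x * (DegreeReduction.bigConst * (5 * κ * x) ^ 3) := by gcongr
          _ = 3 * (DegreeReduction.bigConst * (5 * κ) ^ 3) * x ^ 4 := by ring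
          _ ≤ n := e3
          _ ≤ 8 * n := by linarith [Nat.cast_nonneg (α := ℝ) n])
      hn400
    rw [DegreeReduction.prob_eq_unifProb]
    refine hgood.trans (unifProb_mono fun ω hω => ?_)
    exact ⟨hω.1, hω.2.1, fun v => (hω.2.2.1 v).trans_eq (by rw [hc, hδp]),
      hΦ_le.trans hω.2.2.2⟩
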